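/- **Theorem 4.1 (interior gradient estimate, with its global version).** Let $n\ge 3$, $2\le k\le n$, and let $(\overline M,g)$ be a smooth compact $n$-dimensional Riemannian manifold, possibly with boundary (or corners), with interior $M$ and boundary $\partial M$. For a function $v$ put $$\mathcal W[v]=g^{-1}\Big(\nabla^2v-dv\otimes dv+\Big(\frac{\Delta v}{n-2}+|\nabla v|^2\Big)g-\frac{\mathrm{Ric}_g}{n-2}\Big),$$ where $\nabla^2,\Delta,|\nabla v|,\mathrm{Ric}_g$ are taken with respect to $g$. For an endomorphism $A$ with eigenvalues $\lambda(A)\in\mathbb R^n$ let $\sigma_j(A)$ be the $j$-th elementary symmetric function of $\lambda(A)$. Call $v$ $(k-1)$-admissible if $\lambda(\mathcal W[v])\in\Gamma_{k-1}=\{\lambda:\sigma_j(\lambda)>0,\ 1\le j\le k-1\}$ at each point, and consider the equation $$\sigma_k\big((n-2)e^{-2v}\mathcal W[v]\big)+\alpha\,\sigma_{k-1}\big((n-2)e^{-2v}\mathcal W[v]\big)=\alpha_0\qquad(*)$$ with real functions $\alpha,\alpha_0$. Write $\|f\|_{C^0(S)}=\sup_S|f|$ and $\|f\|_{C^1(S)}=\sup_S|f|+\sup_S|\nabla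 f|$. (a) Let $B_r\subset M$ be a geodesic ball of radius $r>0$, that is, a ball of the Riemannian distance of $\overline M$, let $B_{r/2}$ be the concentric ball, let $\alpha,\alpha_0\in C^1(B_r)$ with $\inf_{B_r}\alpha_0>0$, and let $v\in C^3(B_r)$ be a $(k-1)$-admissible solution of $(*)$ in $B_r$. Assume that $\|v\|_{C^0(B_r)}$, $\|\alpha\|_{C^1(B_r)}$ and $\|\alpha_0\|_{C^1(B_r)}$ are finite. Then $$\sup_{B_{r/2}}|\nabla v|\le C,$$ where $C$ depends only on $(\overline M,g)$ (in particular on $n$), on $k$, on upper bounds for $r^{-1}$, $\|v\|_{C^0(B_r)}$, $\|\alpha\|_{C^1(B_r)}$, $\|\alpha_0\|_{C^1(B_r)}$, and on a positive lower bound for $\inf_{B_r}\alpha_0$. In particular $C$ does not depend on the centre of the ball. (b) Let $\alpha,\alpha_0\in C^1(M)$ with $\inf_M\alpha_0>0$ and finite $C^1(M)$-norms, and let $v\in C^3(M)\cap C^1(\overline M)$ be a $(k-1)$-admissible solution of $(*)$ in $M$. Then $$\max_{\overline M}|\nabla v|\le C,$$ where $C$ depends only on $(\overline M,g)$, on $k$,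 on upper bounds for $\|v\|_{C^0(\overline M)}$, $\max_{\partial M}|\nabla v|$, $\|\alpha\|_{C^1(M)}$, $\|\alpha_0\|_{C^1(M)}$, and on a positive lower bound for $\inf_M\alpha_0$. (If $\partial M=\emptyset$, the term $\max_{\partial M}|\nabla v|$ is absent.) -/

import Mathlib

open scoped Manifold ContDiff Bundle ENNReal NNReal
open Bundle

namespace ConformalRicci

noncomputable section

/-! ### Elementary symmetric functions of the eigenvalues -/

/-- The eigenvalues `λ(A)` of a square real matrix, with multiplicity, as the multiset of real roots
of the characteristic polynomial. The matrices below are of the form `G⁻¹ B` with `G` positive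
definite and `B` symmetric, so that all their `n` eigenvalues are real. -/
def eigenvalues {n : ℕ} (A : Matrix (Fin n) (Fin n) ℝ) : Multiset ℝ := A.charpoly.roots

/-- `σ_k(A) = σ_k(λ(A))`, the `k`-th elementary symmetric function of the eigenvalues. -/
def sigma {n : ℕ} (k : ℕ) (A : Matrix (Fin n) (Fin n) ℝ) : ℝ := (eigenvalues A).esymm k

/-- Garding's cone `Γ_k = {λ : σ_j(λ) > 0, j = 1, …, k}`. -/
def gardingCone (k : ℕ) : Set (Multiset ℝ) := {s | ∀ j, 1 ≤ j → j ≤ k → 0 < s.esymm j}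

/-! ### Riemannian geometry in local coordinates

Every quantity is computed in the coordinates `y = (y₁, …, y_n)` of the preferred chart
`extChartAt I c` around a point `c`. -/

/-- The partial derivative `∂_i f (y)`. -/
def pderiv {n : ℕ} (i : Fin n) (f : EuclideanSpace ℝ (Fin n) → ℝ)
    (y : EuclideanSpace ℝ (Fin n)) : ℝ :=
  fderiv ℝ f y (EuclideanSpace.single i 1)

variable {n : ℕ} {H : Type*} [TopologicalSpace H]
  (I : ModelWithCorners ℝ (EuclideanSpace ℝ (Fin n)) H)
  {M : Type*} [TopologicalSpace M] [ChartedSpace H M]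

/-- The function `f` read in the chart around `c`. -/
def inChart (c : M) (f : M → ℝ) (y : EuclideanSpace ℝ (Fin n)) : ℝ :=
  f ((extChartAt I c).symm y)

/-- The coordinate vector field `∂/∂y_i` of the chart around `c`, at the point with
coordinates `y`. -/
def coordVec (c : M) (y : EuclideanSpace ℝ (Fin n)) (i : Fin n) :
    TangentSpace I ((extChartAt I c).symm y) :=
  mfderivWithin 𝓘(ℝ, EuclideanSpace ℝ (Fin n)) I (extChartAt I c).symm (Set.range I) y
    (EuclideanSpace.single i (1 : ℝ) : EuclideanSpace ℝ (Fin n))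

variable [RiemannianBundle (fun x : M => TangentSpace I x)]

/-- The matrix `(g_ij)` of the metric in the chart around `c`. -/
def metric (c : M) (y : EuclideanSpace ℝ (Fin n)) : Matrix (Fin n) (Fin n) ℝ :=
  Matrix.of fun i j => inner ℝ (coordVec I c y i) (coordVec I c y j)

/-- The Christoffel symbol
`Γ^k_ij = ½ g^{kl} (∂_i g_jl + ∂_j g_il - ∂_l g_ij)` of the Levi-Civita connection. -/
def christoffel (c : M) (k i j : Fin n) (y : EuclideanSpace ℝ (Fin n)) : ℝ :=
  (1 / 2) * ∑ l, (metric I c y)⁻¹ k l *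
    (pderiv i (fun z => metric I c z j l) y + pderiv j (fun z => metric I c z i l) y
      - pderiv l (fun z => metric I c z i j) y)

/-- The Ricci tensor
`R_ij = ∂_k Γ^k_ij - ∂_j Γ^k_ik + Γ^k_kl Γ^l_ij - Γ^k_jl Γ^l_ik`
(positive on round spheres). -/
def ricci (c : M) (y : EuclideanSpace ℝ (Fin n)) : Matrix (Fin n) (Fin n) ℝ :=
  Matrix.of fun i j =>
    ∑ k, (pderiv k (christoffel I c k i j) y - pderiv j (christoffel I c k i k) y)
      + ∑ k, ∑ l, (christoffel I c k k l y * christoffel I c l i j y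
        - christoffel I c k j l y * christoffel I c l i k y)

/-- The covariant Hessian `∇_ij f = ∂_i ∂_j f - Γ^k_ij ∂_k f`. -/
def hessian (c : M) (f : M → ℝ) (y : EuclideanSpace ℝ (Fin n)) : Matrix (Fin n) (Fin n) ℝ :=
  Matrix.of fun i j =>
    pderiv i (pderiv j (inChart I c f)) y
      - ∑ k, christoffel I c k i j y * pderiv k (inChart I c f) y

/-- The Laplace-Beltrami operator `Δ f = g^{ij} ∇_ij f`. -/
def laplacian (c : M) (f : M → ℝ) (y : EuclideanSpace ℝ (Fin n)) : ℝ :=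
  ∑ i, ∑ j, (metric I c y)⁻¹ i j * hessian I c f y i j

/-- `|∇ f|(x)`, the length of the differential of `f` with respect to the metric. -/
def gradNorm (f : M → ℝ) (x : M) : ℝ := ‖mvfderiv I f x‖

/-- The matrix, in the chart around `c`, of the endomorphism of `T_x M`
`𝒲[v] = g⁻¹ (∇²v - dv ⊗ dv + (Δv / (n - 2) + |∇v|²) g - Ric / (n - 2))`. -/
def calW (c : M) (v : M → ℝ) (x : M) : Matrix (Fin n) (Fin n) ℝ :=
  let y := extChartAt I c x
  (metric I c y)⁻¹ *
    (hessian I c v y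
      - Matrix.of (fun i j => pderiv i (inChart I c v) y * pderiv j (inChart I c v) y)
      + (laplacian I c v y / ((n : ℝ) - 2) + gradNorm I v x ^ 2) • metric I c y
      - (1 / ((n : ℝ) - 2)) • ricci I c y)

/-- `v` is `k`-admissible on `S`: `λ(𝒲[v]) ∈ Γ_k` at each point of `S`. The eigenvalues of the
endomorphism `𝒲[v]` do not depend on the chart; the condition is written in every preferred chart
around the point. -/
def IsAdmissibleOn (k : ℕ) (v : M → ℝ) (S : Set M) : Prop :=
  ∀ x ∈ S, ∀ c : M, x ∈ (extChartAt I c).source →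
    eigenvalues (calW I c v x) ∈ gardingCone k

/-- `v` solves
`σ_k((n-2) e^{-2v} 𝒲[v]) + α σ_{k-1}((n-2) e^{-2v} 𝒲[v]) = α₀`
at each point of `S` (written in every preferred chart around the point). -/
def IsSolutionOn (k : ℕ) (α α₀ v : M → ℝ) (S : Set M) : Prop :=
  ∀ x ∈ S, ∀ c : M, x ∈ (extChartAt I c).source →
    sigma k ((((n : ℝ) - 2) * Real.exp (-2 * v x)) • calW I c v x)
      + α x * sigma (k - 1) ((((n : ℝ) - 2) * Real.exp (-2 * v x)) • calW I c v x) = α₀ x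

/-- The norm `‖f‖_{C⁰(S)} = sup_S |f|`, possibly infinite. -/
def c0Norm (f : M → ℝ) (S : Set M) : ℝ≥0∞ := ⨆ x ∈ S, ENNReal.ofReal |f x|

/-- The norm `‖f‖_{C¹(S)} = sup_S |f| + sup_S |∇f|`, possibly infinite. -/
def c1Norm (f : M → ℝ) (S : Set M) : ℝ≥0∞ := c0Norm f S + c0Norm (gradNorm I f) S

end

end ConformalRicci

namespace ConformalRicci

/-! ### Newton's inequalities -/

section Newton

open Polynomial

/-! The proof is a Bernstein argument. With w = |∇v|², one maximizes (wη)²/(L − v), where η is a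
cutoff (η = 1 in the global case) and L exceeds v by at least 1. Put φ = 1/(2(L − v)). At an
interior maximum ∇w/w = −φ∇v − ∇η/η, and the second derivatives of log w + log η − ½ log(L − v) are
nonpositive in every direction.

The exponential is first absorbed into the coefficients: with ε = e^{2v}/(n − 2) the equation
becomes σ_k(𝒲) + βσ_{k−1}(𝒲) = b, where β = αε and b = α₀ε^k. Let f_i = σ_{k−1}(λ|i) +
βσ_{k−2}(λ|i), T = ∑ f_i and ν = 1/(n − 2). Because of the term νΔv in 𝒲, the linearized operator
has coefficients P_i = f_i + νT, so P_i ≥ νT as soon as f_i ≥ 0. Newton's inequalities give f_i ≥ 0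
and T ≥ c(1 + σ_{k−1}) for either sign of α (`ellipticity`). The second bound is what controls the
term σ_{k−1}∇β of the differentiated equation.

The core is `gradient_core`. The second order conditions are summed with weights P_a. In ∑ P_a w_aa
the third derivatives of v are eliminated by the differentiated equation, and contractions of the
Hessian with ∇v by the critical point condition; after division by w the main part is 2φ(T|∇v|² − ∑
f_i v_i²). By Euler's identity for σ_k and σ_{k−1}, φ∑ P_a v_aa equals −φ(T|∇v|² − ∑ f_i v_i²) up to
lower order, so the sum of the two is essentially nonnegative. The terms in ∇v from the logarithms
leave (2φ² − φ²)∑ P_a v_a² ≥ φ²νT|∇v|². Errors linear in the Hessian are absorbed by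
2νT|∇²v|²/|∇v|². Hence |∇v|² is at most a multiple of |∇v| plus cutoff terms, and multiplying by η
bounds η|∇v|².

The computation uses coordinate derivatives along constant vectors, chosen orthonormal and
diagonalizing 𝒲 at the maximum point (`frame_estimate`, `coordinate_estimate`). These derivatives
commute; Christoffel symbols and curvature enter only through coefficients of lower order terms, of
which only bounds are needed. The coefficients are smooth up to the boundary, so compactness makes
the bounds uniform (`interior_gradient_estimate`, `global_gradient_estimate`). -/

theorem esymm_cons (a : ℝ) (s : Multiset ℝ) (j : ℕ) :
    (a ::ₘ s).esymm (j + 1) = s.esymm (j + 1) + a * s.esymm j := by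
  simp [Multiset.esymm, Multiset.powersetCard_cons, Multiset.sum_map_mul_left]

theorem esymm_zero' (s : Multiset ℝ) : s.esymm 0 = 1 := by
  simp [Multiset.esymm]

theorem esymm_eq_zero_of_card_lt {s : Multiset ℝ} {j : ℕ} (h : s.card < j) : s.esymm j = 0 := by
  simp [Multiset.esymm, Multiset.powersetCard_eq_empty _ h]

/-- Rolle's theorem: differentiation loses at most one real root, counted with multiplicity, while
the degree drops, so the root count is forced to equal the degree. -/
theorem splits_derivative {p : ℝ[X]} (hp : p.Splits) : p.derivative.Splits := by
  rw [splits_iff_card_roots] at hp ⊢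
  have h1 := card_roots_le_derivative p
  have h2 := card_roots' (derivative p)
  by_cases h0 : p.natDegree = 0
  · rw [natDegree_eq_zero] at h0
    obtain ⟨c, rfl⟩ := h0
    simp
  · have h3 := natDegree_derivative_lt h0
    omega

theorem splits_iterate_derivative {p : ℝ[X]} (hp : p.Splits) (r : ℕ) :
    (derivative^[r] p).Splits := by
  induction r with
  | zero => simpa
  | succ r ih => rw [Function.iterate_succ_apply']; exact splits_derivative ih

/-- The Laguerre inequality at `0` for a product of linear factors. -/
theorem laguerre_prod (s : Multiset ℝ) :
    2 * (s.card : ℝ) * (((s.map fun a => X - C a).prod).coeff 0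
      * ((s.map fun a => X - C a).prod).coeff 2)
      ≤ ((s.card : ℝ) - 1) * ((s.map fun a => X - C a).prod).coeff 1 ^ 2 := by
  induction s using Multiset.induction with
  | empty => simp [coeff_one]
  | cons a s ih =>
    simp only [Multiset.map_cons, Multiset.prod_cons, Multiset.card_cons]
    set g := (s.map fun a => X - C a).prod with hg
    have e0 : ((X - C a) * g).coeff 0 = -a * g.coeff 0 := by simp [sub_mul]
    have e1 : ((X - C a) * g).coeff 1 = g.coeff 0 - a * g.coeff 1 := by
      simp [sub_mul]
    have e2 : ((X - C a) * g).coeff 2 = g.coeff 1 - a * g.coeff 2 := by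
      simp [sub_mul, coeff_X_mul g 1]
    rw [e0, e1, e2]
    rcases Nat.eq_zero_or_pos s.card with h | h
    · have : s = 0 := Multiset.card_eq_zero.mp h
      subst this
      simp [hg, coeff_one]
    · set d : ℝ := (Multiset.card s : ℝ) with hd
      have hd1 : (1 : ℝ) ≤ d := by rw [hd]; exact_mod_cast h
      push_cast
      rw [← hd]
      -- Multiplication by X − a sends (c₀, c₁, c₂) to (−ac₀, c₀ − ac₁, c₁ − ac₂). Multiplied by d,
      -- the new deficit is (dc₀ + ac₁)² plus (d + 1)a² times the old one.
      have key : 0 ≤ d * (d * (g.coeff 0 - a * g.coeff 1) ^ 2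
          - 2 * (d + 1) * ((-a * g.coeff 0) * (g.coeff 1 - a * g.coeff 2))) := by
        nlinarith [sq_nonneg (d * g.coeff 0 + a * g.coeff 1),
          mul_le_mul_of_nonneg_left ih (mul_nonneg (sq_nonneg a) (by linarith : 0 ≤ d + 1))]
      have := nonneg_of_mul_nonneg_right key (by linarith)
      linarith

theorem laguerre_coeff {q : ℝ[X]} (hq : q.Splits) :
    2 * (q.natDegree : ℝ) * (q.coeff 0 * q.coeff 2) ≤ ((q.natDegree : ℝ) - 1) * q.coeff 1 ^ 2 := by
  have h := laguerre_prod q.roots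
  rw [← splits_iff_card_roots.mp hq]
  have e : ∀ j, q.coeff j
      = q.leadingCoeff * ((q.roots.map fun a => X - C a).prod).coeff j := by
    intro j
    conv_lhs => rw [hq.eq_prod_roots]
    rw [coeff_C_mul]
  rw [e 0, e 1, e 2]
  nlinarith [mul_le_mul_of_nonneg_left h (sq_nonneg q.leadingCoeff)]

/-- Newton's inequality in its sharp form. -/
theorem newton_sharp (s : Multiset ℝ) (j r : ℕ) (hs : s.card = j + 2 + r) :
    ((j : ℝ) + 2) * (r + 2) * (s.esymm (j + 2) * s.esymm j)
      ≤ (j + 1) * (r + 1) * s.esymm (j + 1) ^ 2 := by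
  -- The r-th derivative of this product is real-rooted of degree j + 2, and its three lowest
  -- coefficients are factorial multiples of σ_{j+2}, σ_{j+1}, σ_j. Newton's inequality is the
  -- Laguerre inequality for it.
  set p : ℝ[X] := (s.map fun a => X + C a).prod with hp
  have hps : p.Splits := by
    rw [hp]
    apply Splits.multisetProd
    intro f hf
    obtain ⟨a, -, rfl⟩ := Multiset.mem_map.mp hf
    exact Splits.X_add_C a
  have hdeg : p.natDegree = s.card := by
    rw [hp, natDegree_multiset_prod_of_monic]
    · simp
    · intro f hf
      obtain ⟨a, -, rfl⟩ := Multiset.mem_map.mp hf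
      exact monic_X_add_C a
  have hq := laguerre_coeff (splits_iterate_derivative hps r)
  have hqd : (derivative^[r] p).natDegree = j + 2 := by
    have (i : ℕ) : (derivative^[i] p).natDegree = p.natDegree - i := by
      induction i with
      | zero => rfl
      | succ i ih => rw [Function.iterate_succ_apply', natDegree_derivative, ih]; omega
    rw [this, hdeg]; omega
  have c (i : ℕ) (hi : i ≤ j + 2) : p.coeff (i + r) = s.esymm (j + 2 - i) := by
    rw [hp, Multiset.prod_X_add_C_coeff _ (by omega)]
    congr 1; omega
  rw [hqd, coeff_iterate_derivative, coeff_iterate_derivative, coeff_iterate_derivative,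
    c 0 (by omega), c 1 (by omega), c 2 (by omega)] at hq
  have d0 : ((0 + r).descFactorial r : ℝ) = r.factorial := by simp [Nat.descFactorial_self]
  have d1 : ((1 + r).descFactorial r : ℝ) = (r + 1) * r.factorial := by
    have := Nat.factorial_mul_descFactorial (show r ≤ 1 + r by omega)
    rw [Nat.add_sub_cancel, Nat.factorial_one, one_mul, add_comm, Nat.factorial_succ] at this
    rw [add_comm, this]; push_cast; ring
  have d2 : 2 * ((2 + r).descFactorial r : ℝ) = (r + 2) * (r + 1) * r.factorial := by
    have := Nat.factorial_mul_descFactorial (show r ≤ 2 + r by omega)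
    rw [Nat.add_sub_cancel, Nat.factorial_two, add_comm, Nat.factorial_succ,
      Nat.factorial_succ] at this
    rw [add_comm]
    have h2 : (2 : ℝ) * ((r + 2).descFactorial r : ℝ) = ((r + 1 + 1) * ((r + 1) * r.factorial)) := by
      exact_mod_cast this
    rw [h2]; ring
  simp only [nsmul_eq_mul] at hq
  rw [d0, d1] at hq
  have hf : (0 : ℝ) < r.factorial := by exact_mod_cast r.factorial_pos
  have hr : (0 : ℝ) < r + 1 := by positivity
  have s0 : j + 2 - 0 = j + 2 := by omega
  have s1 : j + 2 - 1 = j + 1 := by omega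
  have s2 : j + 2 - 2 = j := by omega
  rw [s0, s1, s2] at hq
  push_cast at hq
  have key : ((r : ℝ) + 1) * (r.factorial : ℝ) ^ 2 *
      (((j : ℝ) + 2) * (r + 2) * (s.esymm (j + 2) * s.esymm j))
      ≤ ((r : ℝ) + 1) * (r.factorial : ℝ) ^ 2 * ((j + 1) * (r + 1) * s.esymm (j + 1) ^ 2) := by
    have e1 : 2 * ((j : ℝ) + 2) * (r.factorial * s.esymm (j + 2)
        * ((2 + r).descFactorial r * s.esymm j))
        = ((r : ℝ) + 1) * (r.factorial : ℝ) ^ 2 *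
      (((j : ℝ) + 2) * (r + 2) * (s.esymm (j + 2) * s.esymm j)) := by
      linear_combination (((j : ℝ) + 2) * (r.factorial * s.esymm (j + 2)) * s.esymm j) * d2
    rw [← e1]
    linarith
  exact le_of_mul_le_mul_left key (by positivity)

/-- The sharp factor (j + 1)(r + 1)/((j + 2)(r + 2)) is below one; when there are too few entries
the left side vanishes. -/
theorem newton_weak (s : Multiset ℝ) (j : ℕ) :
    s.esymm (j + 2) * s.esymm j ≤ s.esymm (j + 1) ^ 2 := by
  rcases lt_or_ge s.card (j + 2) with h | h
  · rw [esymm_eq_zero_of_card_lt h, zero_mul]; positivity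
  · obtain ⟨r, hr⟩ := Nat.exists_eq_add_of_le h
    have := newton_sharp s j r hr
    by_contra! hc
    have hpos : 0 < s.esymm (j + 2) * s.esymm j := lt_of_le_of_lt (sq_nonneg _) hc
    have h1 : ((j : ℝ) + 1) * (r + 1) * s.esymm (j + 1) ^ 2
        ≤ (j + 1) * (r + 1) * (s.esymm (j + 2) * s.esymm j) :=
      mul_le_mul_of_nonneg_left hc.le (by positivity)
    nlinarith [mul_nonneg (Nat.cast_nonneg (α := ℝ) j) (Nat.cast_nonneg (α := ℝ) r),
      Nat.cast_nonneg (α := ℝ) j, Nat.cast_nonneg (α := ℝ) r]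

/-- Removing an entry from an element of `Γ_{m+1}` gives an element of `Γ_m`. -/
theorem esymm_pos_of_cons_pos {a : ℝ} {s : Multiset ℝ} {m : ℕ}
    (h : ∀ j, 1 ≤ j → j ≤ m + 1 → 0 < (a ::ₘ s).esymm j) :
    ∀ j, j ≤ m → 0 < s.esymm j := by
  intro j
  induction j with
  | zero => intro _; rw [esymm_zero']; exact one_pos
  | succ j ih =>
    intro hj
    have h0 := ih (by omega)
    have h1 := h (j + 1) (by omega) (by omega)
    have h2 := h (j + 2) (by omega) (by omega)
    rw [esymm_cons] at h1 h2
    have hN := newton_weak s j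
    -- If σ_j(s) > 0 ≥ σ_{j+1}(s), the two positive sums force |σ_{j+1}(s)| < aσ_j(s) and σ_{j+2}(s)
    -- > a|σ_{j+1}(s)|, so that σ_{j+2}σ_j > σ_{j+1}², against Newton.
    by_contra! hc
    have ha : 0 ≤ a := by
      by_contra! ha
      nlinarith
    nlinarith [mul_le_mul_of_nonneg_left hc ha]

/-- By Newton the quotients σ_{j+1}/σ_j decrease in j. If the last one exceeds 1, so do all earlier
ones, and the chain descends to σ₀ = 1. -/
theorem one_lt_esymm {s : Multiset ℝ} {m : ℕ} (h : ∀ j, j ≤ m + 1 → 0 < s.esymm j)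
    (hlt : s.esymm m < s.esymm (m + 1)) : 1 < s.esymm (m + 1) := by
  induction m with
  | zero => rwa [esymm_zero'] at hlt
  | succ m ih =>
    have h0 := h m (by omega)
    have h1 := h (m + 1) (by omega)
    have hN := newton_weak s m
    have : s.esymm m < s.esymm (m + 1) := by nlinarith
    exact (ih (fun j hj => h j (by omega)) this).trans hlt

end Newton

/-! ### The linearized operator on diagonal matrices -/

section Diagonal

open Finset Polynomial

variable {n : ℕ}

/-- `σ_j(λ)`. -/
noncomputable def esym (lam : Fin n → ℝ) (j : ℕ) : ℝ := (univ.val.map lam).esymm j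

/-- `σ_j(λ|i)`, where `λ|i` omits the entry `λ_i`. -/
noncomputable def esymErase (lam : Fin n → ℝ) (i : Fin n) (j : ℕ) : ℝ :=
  ((univ.erase i).val.map lam).esymm j

theorem cons_erase_map (lam : Fin n → ℝ) (i : Fin n) :
    (univ.val.map lam) = lam i ::ₘ ((univ.erase i).val.map lam) := by
  rw [← Multiset.map_cons, Finset.erase_val, Multiset.cons_erase (by simp)]

theorem esym_succ (lam : Fin n → ℝ) (i : Fin n) (j : ℕ) :
    esym lam (j + 1) = esymErase lam i (j + 1) + lam i * esymErase lam i j := by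
  rw [esym, cons_erase_map lam i, esymm_cons]; rfl

/-- Compare coefficients in the derivative of ∏(X + λ_i), which is the sum of the products with one
factor removed. For j = n both sides vanish. -/
theorem sum_esymErase (lam : Fin n → ℝ) (j : ℕ) (hj : j ≤ n) :
    ∑ i, esymErase lam i j = ((n : ℝ) - j) * esym lam j := by
  rcases hj.eq_or_lt with rfl | hj'
  · rw [sub_self, zero_mul]
    apply sum_eq_zero
    intro i _
    apply esymm_eq_zero_of_card_lt
    have := i.pos
    simp only [Multiset.card_map, Finset.card_val, card_erase_of_mem (mem_univ i), card_univ,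
      Fintype.card_fin]
    omega
  · have h1 : (∏ i, (X + C (lam i))).derivative
        = ∑ i, ∏ l ∈ univ.erase i, (X + C (lam l)) := by
      rw [derivative_prod_finset]; simp
    have h2 := congrArg (fun p => p.coeff (n - 1 - j)) h1
    simp only [coeff_derivative, finsetSum_coeff] at h2
    have h3 : (∏ i, (X + C (lam i))).coeff (n - 1 - j + 1) = esym lam j := by
      have := Multiset.prod_X_add_C_coeff' (univ : Finset (Fin n)).val lam (k := n - 1 - j + 1)
        (by simp; omega)
      have hj : Multiset.card (univ : Finset (Fin n)).val - (n - 1 - j + 1) = j := by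
        simp; omega
      rw [hj] at this
      exact this
    have h4 : ∀ i : Fin n, (∏ l ∈ univ.erase i, (X + C (lam l))).coeff (n - 1 - j)
        = esymErase lam i j := by
      intro i
      have hc : Multiset.card (univ.erase i).val = n - 1 := by
        simp
      have := Multiset.prod_X_add_C_coeff' (univ.erase i).val lam (k := n - 1 - j)
        (by rw [hc]; omega)
      rw [hc, show n - 1 - (n - 1 - j) = j by omega] at this
      exact this
    rw [h3] at h2
    simp only [h4] at h2
    rw [← h2]
    have : ((n - 1 - j : ℕ) : ℝ) + 1 = n - j := by
      have : n - 1 - j + 1 = n - j := by omega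
      rw [← Nat.cast_succ, Nat.succ_eq_add_one, this, Nat.cast_sub hj]
    rw [this]; ring

theorem sum_mul_esymErase (lam : Fin n → ℝ) (j : ℕ) (hj : j + 1 ≤ n) :
    ∑ i, esymErase lam i j * lam i = ((j : ℝ) + 1) * esym lam (j + 1) := by
  have h1 : ∀ i, esymErase lam i j * lam i = esym lam (j + 1) - esymErase lam i (j + 1) := by
    intro i; rw [esym_succ lam i]; ring
  simp only [h1, sum_sub_distrib, sum_esymErase lam (j + 1) hj]
  simp
  ring

/-- Ellipticity of `σ_{m+2} + β σ_{m+1}` on the level set `{σ_{m+2} + β σ_{m+1} = b}` with `b`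
bounded below by a positive constant. -/
theorem ellipticity {m : ℕ} (hm : m + 2 ≤ n) {b₀ : ℝ} (hb₀ : 0 < b₀) :
    ∃ c > 0, ∀ (lam : Fin n → ℝ) (β b : ℝ), b₀ ≤ b →
      (∀ j, 1 ≤ j → j ≤ m + 1 → 0 < esym lam j) →
      esym lam (m + 2) + β * esym lam (m + 1) = b →
      (∀ i, 0 ≤ esymErase lam i (m + 1) + β * esymErase lam i m) ∧
      c * (1 + esym lam (m + 1))
        ≤ ∑ i, (esymErase lam i (m + 1) + β * esymErase lam i m) ∧
      ∑ i, (esymErase lam i (m + 1) + β * esymErase lam i m) * lam i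
        = (m + 2) * b - β * esym lam (m + 1) := by
  -- The cap 1/2 leaves room for b₁s² twice inside s²: once for the term s² of s(1 + s), once to
  -- compensate the error in s − s² ≤ σ_m.
  set b₁ := min b₀ (1 / 2) with hb₁
  have hb₁0 : 0 < b₁ := lt_min hb₀ (by norm_num)
  have hb₁1 : b₁ ≤ 1 / 2 := min_le_right _ _
  refine ⟨b₁ / (m + 2), by positivity, ?_⟩
  intro lam β b hb hpos heq
  set s := esym lam (m + 1) with hs
  have hs0 : 0 < s := hpos _ (by omega) le_rfl
  have hpos' : ∀ j, j ≤ m + 1 → 0 < esym lam j := by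
    intro j hj
    rcases Nat.eq_zero_or_pos j with rfl | h
    · rw [esym, esymm_zero']; exact one_pos
    · exact hpos j h hj
  have hem := hpos' m (by omega)
  refine ⟨?_, ?_, ?_⟩
  · intro i
    have hi : 0 < esymErase lam i m := by
      refine esymm_pos_of_cons_pos (a := lam i) (m := m) ?_ m le_rfl
      intro j h1 h2
      rw [← cons_erase_map]
      exact hpos j h1 h2
    have hN : esymErase lam i (m + 2) * esymErase lam i m ≤ esymErase lam i (m + 1) ^ 2 :=
      newton_weak _ _
    have e1 := esym_succ lam i m
    have e2 := esym_succ lam i (m + 1)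
    -- Multiplication by s allows βs = b − σ_{m+2} to eliminate β. What remains is Newton's deficit
    -- for λ|i plus a positive multiple of b, so the sign of β plays no role.
    have : 0 ≤ s * (esymErase lam i (m + 1) + β * esymErase lam i m) := by
      have h1 : s * (esymErase lam i (m + 1) + β * esymErase lam i m)
          = esymErase lam i (m + 1) ^ 2 - esymErase lam i (m + 2) * esymErase lam i m
            + b * esymErase lam i m := by
        rw [← heq, hs]
        rw [e1, show m + 2 = m + 1 + 1 from rfl, e2]; ring
      rw [h1]
      have : 0 < b * esymErase lam i m := mul_pos (by linarith) hi
      linarith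
    exact nonneg_of_mul_nonneg_right this hs0
  · have hT : ∑ i, (esymErase lam i (m + 1) + β * esymErase lam i m)
        = (n - m - 1) * s + β * ((n - m) * esym lam m) := by
      rw [sum_add_distrib, ← mul_sum, sum_esymErase _ _ (by omega), sum_esymErase _ _ (by omega)]
      push_cast; ring
    rw [hT]
    obtain ⟨r, rfl⟩ := Nat.exists_eq_add_of_le hm
    have hN : ((m : ℝ) + 2) * (r + 2) * (esym lam (m + 2) * esym lam m)
        ≤ (m + 1) * (r + 1) * s ^ 2 := newton_sharp _ m r (by simp)
    push_cast
    -- This produces the constant 1 in 1 + s: if s ≤ 1, then s ≤ σ_m by `one_lt_esymm`. It is used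
    -- after multiplying the claim by s, where βs is again replaced and the sharp Newton inequality
    -- leaves (r + 1)s² plus a multiple of bσ_m.
    have hle : s ≤ s ^ 2 + esym lam m := by
      rcases le_or_gt s 1 with h | h
      · have : s ≤ esym lam m := by
          by_contra! hc
          have := one_lt_esymm hpos' hc
          change 1 < s at this
          linarith
        nlinarith
      · nlinarith
    rw [div_mul_eq_mul_div, div_le_iff₀ (by positivity)]
    have e : esym lam (m + 2) = b - β * s := by linarith
    rw [e] at hN
    refine le_of_mul_le_mul_left ?_ hs0
    have hbe : b₁ * (s - s ^ 2) ≤ b * esym lam m := by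
      have h1 : b₁ ≤ b := (min_le_left _ _).trans hb
      calc b₁ * (s - s ^ 2) ≤ b₁ * esym lam m := by
            apply mul_le_mul_of_nonneg_left _ hb₁0.le; linarith
        _ ≤ _ := mul_le_mul_of_nonneg_right h1 hem.le
    have hbm : 0 ≤ b * esym lam m := mul_nonneg (by linarith) hem.le
    have h2 : (1 : ℝ) * (b * esym lam m) ≤ (m + 2) * (r + 2) * (b * esym lam m) := by
      apply mul_le_mul_of_nonneg_right _ hbm
      have : (0 : ℝ) ≤ m := by positivity
      have : (0 : ℝ) ≤ r := by positivity
      nlinarith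
    have h3 : s ^ 2 ≤ (r + 1) * s ^ 2 := by
      have : (0 : ℝ) ≤ r * s ^ 2 := by positivity
      linarith
    have h4 : b₁ * s ^ 2 ≤ 1 / 2 * s ^ 2 := mul_le_mul_of_nonneg_right hb₁1 (sq_nonneg _)
    nlinarith
  · simp only [add_mul, sum_add_distrib]
    rw [sum_mul_esymErase _ _ (by omega)]
    have : ∀ i, β * esymErase lam i m * lam i = β * (esymErase lam i m * lam i) := by
      intro i; ring
    simp only [this, ← mul_sum]
    rw [sum_mul_esymErase _ _ (by omega), ← heq]
    push_cast
    rw [show m + 1 + 1 = m + 2 from rfl]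
    ring

end Diagonal


/-! ### Eigenvalues of `g⁻¹ S` and the derivative of `σ_j` -/

section Spectral

open Finset Polynomial Matrix

variable {n : ℕ}

/-- `σ_j(A)` as a coefficient of the characteristic polynomial. -/
noncomputable def coeffSigma (j : ℕ) (A : Matrix (Fin n) (Fin n) ℝ) : ℝ :=
  (-1) ^ j * A.charpoly.coeff (n - j)

theorem coeff_prod_X_sub_C {ι : Type*} (s : Multiset ι) (lam : ι → ℝ) (j : ℕ)
    (hj : j ≤ Multiset.card s) :
    ((s.map fun i => X - C (lam i)).prod).coeff (Multiset.card s - j)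
      = (-1) ^ j * (s.map lam).esymm j := by
  have h := Multiset.prod_X_sub_C_coeff (s.map lam) (k := Multiset.card s - j)
    (by simp)
  rw [Multiset.map_map] at h
  simp only [Multiset.card_map, Function.comp_def] at h
  rw [show Multiset.card s - (Multiset.card s - j) = j by omega] at h
  exact h

theorem charpoly_diagonal' (lam : Fin n → ℝ) :
    (diagonal lam).charpoly = (univ.val.map fun i => X - C (lam i)).prod := by
  rw [Matrix.charpoly_diagonal]; rfl

theorem coeffSigma_diagonal (lam : Fin n → ℝ) {j : ℕ} (hj : j ≤ n) :
    coeffSigma j (diagonal lam) = esym lam j := by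
  have h := coeff_prod_X_sub_C (univ : Finset (Fin n)).val lam j (by simpa using hj)
  rw [coeffSigma, charpoly_diagonal']
  simp only [card_val, card_univ, Fintype.card_fin] at h
  rw [h, ← mul_assoc, ← mul_pow]
  simp [esym]

theorem eigenvalues_of_charpoly_eq {A : Matrix (Fin n) (Fin n) ℝ} {lam : Fin n → ℝ}
    (h : A.charpoly = (diagonal lam).charpoly) : eigenvalues A = univ.val.map lam := by
  rw [eigenvalues, h, charpoly_diagonal']
  have := Polynomial.roots_multiset_prod_X_sub_C (univ.val.map lam)
  rwa [Multiset.map_map] at this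

theorem sigma_of_charpoly_eq {A : Matrix (Fin n) (Fin n) ℝ} {lam : Fin n → ℝ}
    (h : A.charpoly = (diagonal lam).charpoly) (j : ℕ) : sigma j A = esym lam j := by
  rw [sigma, eigenvalues_of_charpoly_eq h, esym]

theorem coeffSigma_conj {E F A : Matrix (Fin n) (Fin n) ℝ} (hEF : E * F = 1) (j : ℕ) :
    coeffSigma j (F * A * E) = coeffSigma j A := by
  rw [coeffSigma, coeffSigma, Matrix.mul_assoc, Matrix.charpoly_mul_comm, Matrix.mul_assoc, hEF,
    Matrix.mul_one]

theorem exists_orthogonal_diagonalization {S : Matrix (Fin n) (Fin n) ℝ} (hS : S.IsHermitian) :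
    ∃ (U : Matrix (Fin n) (Fin n) ℝ) (d : Fin n → ℝ), Uᵀ * U = 1 ∧ U * Uᵀ = 1 ∧
      S = U * diagonal d * Uᵀ := by
  set U : Matrix (Fin n) (Fin n) ℝ := (hS.eigenvectorUnitary : Matrix (Fin n) (Fin n) ℝ) with hU
  have hU1 : Uᵀ * U = 1 := by
    have := (Matrix.mem_unitaryGroup_iff').mp hS.eigenvectorUnitary.2
    rwa [star_eq_conjTranspose, conjTranspose_eq_transpose_of_trivial] at this
  have hU2 : U * Uᵀ = 1 := mul_eq_one_comm.mp hU1
  have hspec : S = U * diagonal hS.eigenvalues * Uᵀ := by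
    have := hS.spectral_theorem
    rw [Unitary.conjStarAlgAut_apply] at this
    rw [star_eq_conjTranspose, conjTranspose_eq_transpose_of_trivial] at this
    exact this
  exact ⟨U, _, hU1, hU2, hspec⟩

/-- Simultaneous diagonalization of a positive definite and a symmetric matrix. -/
theorem exists_frame {g S : Matrix (Fin n) (Fin n) ℝ} (hg : g.PosDef) (hS : Sᵀ = S) :
    ∃ (E F : Matrix (Fin n) (Fin n) ℝ) (lam : Fin n → ℝ), E * F = 1 ∧ F * E = 1 ∧
      Eᵀ * g * E = 1 ∧ Eᵀ * S * E = diagonal lam := by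
  obtain ⟨B, hB, hgB⟩ : ∃ B : Matrix (Fin n) (Fin n) ℝ, IsUnit B ∧ g = Bᵀ * B := by
    obtain ⟨U, d, hU1, hU2, hd⟩ := exists_orthogonal_diagonalization hg.1
    have hUdet : IsUnit U := by
      rw [Matrix.isUnit_iff_isUnit_det]
      exact Matrix.isUnit_det_of_left_inverse hU1
    have hdg : (diagonal d).PosDef := by
      have h1 : Uᴴ * g * U = diagonal d := by
        rw [conjTranspose_eq_transpose_of_trivial, hd]
        calc Uᵀ * (U * diagonal d * Uᵀ) * U = (Uᵀ * U) * diagonal d * (Uᵀ * U) := by noncomm_ring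
          _ = diagonal d := by rw [hU1]; simp
      rw [← h1]
      exact hg.conjTranspose_mul_mul_same (Matrix.mulVec_injective_of_isUnit hUdet)
    have hpos : ∀ i, 0 < d i := Matrix.posDef_diagonal_iff.mp hdg
    have hgB : g = (diagonal (fun i => √(d i)) * Uᵀ)ᵀ * (diagonal (fun i => √(d i)) * Uᵀ) := by
      rw [transpose_mul, transpose_transpose, diagonal_transpose]
      have h2 : diagonal d = diagonal (fun i => √(d i)) * diagonal (fun i => √(d i)) := by
        rw [diagonal_mul_diagonal]
        congr 1
        ext i
        exact (Real.mul_self_sqrt (hpos i).le).symm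
      conv_lhs => rw [hd, h2]
      noncomm_ring
    refine ⟨_, ?_, hgB⟩
    rw [Matrix.isUnit_iff_isUnit_det]
    have h1 := congrArg Matrix.det hgB
    rw [det_mul, det_transpose] at h1
    rw [isUnit_iff_ne_zero]
    intro h0
    rw [h0, mul_zero] at h1
    exact hg.det_pos.ne' h1
  have hdet : IsUnit B.det := (Matrix.isUnit_iff_isUnit_det B).mp hB
  have hBt : IsUnit Bᵀ.det := by rwa [det_transpose]
  -- Congruence by B⁻¹ turns g = BᵀB into the identity; an orthogonal U diagonalizing the
  -- transformed form preserves it, so E = B⁻¹U serves both.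
  set S' := (B⁻¹)ᵀ * S * B⁻¹ with hS'
  have hH : S'.IsHermitian := by
    rw [Matrix.IsHermitian, conjTranspose_eq_transpose_of_trivial, hS', transpose_mul,
      transpose_mul, hS, transpose_transpose, Matrix.mul_assoc]
  obtain ⟨U, d, hU1, hU2, hspec⟩ := exists_orthogonal_diagonalization hH
  refine ⟨B⁻¹ * U, Uᵀ * B, d, ?_, ?_, ?_, ?_⟩
  · rw [Matrix.mul_assoc, ← Matrix.mul_assoc U, hU2, Matrix.one_mul, nonsing_inv_mul _ hdet]
  · rw [Matrix.mul_assoc, ← Matrix.mul_assoc B, mul_nonsing_inv _ hdet, Matrix.one_mul, hU1]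
  · rw [transpose_mul, hgB]
    have : Uᵀ * (B⁻¹)ᵀ * (Bᵀ * B) * (B⁻¹ * U)
        = Uᵀ * ((B * B⁻¹)ᵀ * (B * B⁻¹)) * U := by
      rw [transpose_mul]; noncomm_ring
    rw [this, mul_nonsing_inv _ hdet]
    simp [hU1]
  · have : (B⁻¹ * U)ᵀ * S * (B⁻¹ * U) = Uᵀ * S' * U := by
      rw [transpose_mul, hS']; noncomm_ring
    rw [this]
    calc Uᵀ * S' * U = Uᵀ * (U * diagonal d * Uᵀ) * U := by rw [← hspec]
      _ = (Uᵀ * U) * diagonal d * (Uᵀ * U) := by noncomm_ring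
      _ = diagonal d := by rw [hU1]; simp

theorem inv_eq_of_frame {g E F : Matrix (Fin n) (Fin n) ℝ} (hEF : E * F = 1)
    (h1 : Eᵀ * g * E = 1) : g⁻¹ = E * Eᵀ := by
  apply Matrix.inv_eq_left_inv
  have h2 : Eᵀ * g = F := by
    calc Eᵀ * g = Eᵀ * g * (E * F) := by rw [hEF, Matrix.mul_one]
      _ = F := by rw [← Matrix.mul_assoc, h1, Matrix.one_mul]
  rw [Matrix.mul_assoc, h2, hEF]

theorem conj_frame {g S E F : Matrix (Fin n) (Fin n) ℝ} {lam : Fin n → ℝ} (hEF : E * F = 1)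
    (h1 : Eᵀ * g * E = 1) (h2 : Eᵀ * S * E = diagonal lam) :
    F * (g⁻¹ * S) * E = diagonal lam := by
  have hFE : F * E = 1 := mul_eq_one_comm.mp hEF
  rw [inv_eq_of_frame hEF h1, ← h2]
  calc F * (E * Eᵀ * S) * E = (F * E) * (Eᵀ * S * E) := by noncomm_ring
    _ = _ := by rw [hFE, Matrix.one_mul]

theorem charpoly_inv_mul {g S E F : Matrix (Fin n) (Fin n) ℝ} {lam : Fin n → ℝ} (hEF : E * F = 1)
    (h1 : Eᵀ * g * E = 1) (h2 : Eᵀ * S * E = diagonal lam) :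
    (g⁻¹ * S).charpoly = (diagonal lam).charpoly := by
  rw [← conj_frame hEF h1 h2, Matrix.mul_assoc F, Matrix.charpoly_mul_comm F,
    Matrix.mul_assoc _ E, hEF, Matrix.mul_one]

/-- The product g⁻¹S is similar to a real diagonal matrix, so no root of its characteristic
polynomial is lost. The coefficients are polynomial in the entries and can be differentiated even
where eigenvalues collide. -/
theorem sigma_eq_coeffSigma {g S : Matrix (Fin n) (Fin n) ℝ} (hg : g.PosDef) (hS : Sᵀ = S)
    {j : ℕ} (hj : j ≤ n) : sigma j (g⁻¹ * S) = coeffSigma j (g⁻¹ * S) := by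
  obtain ⟨E, F, lam, hEF, -, h1, h2⟩ := exists_frame hg hS
  have h := charpoly_inv_mul hEF h1 h2
  rw [sigma_of_charpoly_eq h, ← coeffSigma_diagonal lam hj, coeffSigma, coeffSigma, h]

theorem sigma_smul {g S : Matrix (Fin n) (Fin n) ℝ} (hg : g.PosDef) (hS : Sᵀ = S)
    (c : ℝ) (j : ℕ) : sigma j (c • (g⁻¹ * S)) = c ^ j * sigma j (g⁻¹ * S) := by
  obtain ⟨E, F, lam, hEF, -, h1, h2⟩ := exists_frame hg hS
  have h := charpoly_inv_mul hEF h1 h2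
  have h2' : Eᵀ * (c • S) * E = diagonal (c • lam) := by
    rw [Matrix.mul_smul, Matrix.smul_mul, h2, diagonal_smul]
  have h' := charpoly_inv_mul hEF h1 h2'
  rw [← Matrix.mul_smul, sigma_of_charpoly_eq h', sigma_of_charpoly_eq h, esym, esym,
    ← smul_eq_mul, Multiset.pow_smul_esymm, Multiset.map_map]
  rfl

/-- Coefficientwise derivative of a curve of polynomials. -/
def HasPolyDerivAt (q : ℝ → ℝ[X]) (q' : ℝ[X]) (t : ℝ) : Prop :=
  ∀ m, HasDerivAt (fun s => (q s).coeff m) (q'.coeff m) t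

theorem HasPolyDerivAt.mul {p q : ℝ → ℝ[X]} {p' q' : ℝ[X]} {t : ℝ} (hp : HasPolyDerivAt p p' t)
    (hq : HasPolyDerivAt q q' t) :
    HasPolyDerivAt (fun s => p s * q s) (p' * q t + p t * q') t := by
  intro m
  simp only [coeff_mul, coeff_add, ← sum_add_distrib]
  exact HasDerivAt.fun_sum fun x _ => (hp x.1).mul (hq x.2)

theorem HasPolyDerivAt.sum {ι : Type*} (u : Finset ι) {q : ι → ℝ → ℝ[X]} {q' : ι → ℝ[X]} {t : ℝ}
    (h : ∀ i ∈ u, HasPolyDerivAt (q i) (q' i) t) :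
    HasPolyDerivAt (fun s => ∑ i ∈ u, q i s) (∑ i ∈ u, q' i) t := by
  intro m
  simp only [finsetSum_coeff]
  exact HasDerivAt.fun_sum fun i hi => h i hi m

theorem HasPolyDerivAt.prod {ι : Type*} [DecidableEq ι] (u : Finset ι) {q : ι → ℝ → ℝ[X]}
    {q' : ι → ℝ[X]} {t : ℝ} (h : ∀ i ∈ u, HasPolyDerivAt (q i) (q' i) t) :
    HasPolyDerivAt (fun s => ∏ i ∈ u, q i s)
      (∑ i ∈ u, (∏ j ∈ u.erase i, q j t) * q' i) t := by
  induction u using Finset.induction_on with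
  | empty => intro m; simpa using hasDerivAt_const t _
  | insert a u ha ih =>
    have h1 := (h a (mem_insert_self a u)).mul (ih fun i hi => h i (mem_insert_of_mem hi))
    simp only [prod_insert ha]
    convert h1 using 1
    rw [sum_insert ha, erase_insert ha, mul_comm, mul_sum]
    congr 1
    apply sum_congr rfl
    intro i hi
    have hia : a ≠ i := fun h => ha (h ▸ hi)
    rw [erase_insert_of_ne hia, prod_insert (by simp [ha])]
    ring

theorem hasPolyDerivAt_charpoly {A : ℝ → Matrix (Fin n) (Fin n) ℝ}
    {A' : Matrix (Fin n) (Fin n) ℝ} {lam : Fin n → ℝ} {t : ℝ}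
    (hA : ∀ i j, HasDerivAt (fun s => A s i j) (A' i j) t) (hd : A t = diagonal lam) :
    HasPolyDerivAt (fun s => (A s).charpoly)
      (∑ i, (∏ l ∈ univ.erase i, (X - C (lam l))) * (-C (A' i i))) t := by
  have h1 : ∀ i j, HasPolyDerivAt (fun s => charmatrix (A s) i j) (-C (A' i j)) t := by
    intro i j m
    simp only [charmatrix_apply, coeff_sub, coeff_C, coeff_neg]
    by_cases hm : m = 0
    · simpa [hm] using (hA i j).const_sub ((diagonal (fun _ => X) i j : ℝ[X]).coeff 0)
    · simpa [hm] using hasDerivAt_const t _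
  have h2 : HasPolyDerivAt (fun s => (A s).charpoly)
      (∑ σ : Equiv.Perm (Fin n), C ((Equiv.Perm.sign σ : ℤ) : ℝ) *
        ∑ i, (∏ j ∈ univ.erase i, charmatrix (A t) (σ j) j) * (-C (A' (σ i) i))) t := by
    simp only [Matrix.charpoly, Matrix.det_apply']
    apply HasPolyDerivAt.sum
    intro σ _
    have h3 := HasPolyDerivAt.prod univ fun i _ => h1 (σ i) i
    have h4 : HasPolyDerivAt (fun _ => C ((Equiv.Perm.sign σ : ℤ) : ℝ)) 0 t := by
      intro m; simpa using hasDerivAt_const t _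
    have h5 := h4.mul h3
    simpa using h5
  convert h2 using 1
  symm
  rw [sum_eq_single (1 : Equiv.Perm (Fin n))]
  · simp [hd]
  · intro σ _ hσ
    rw [sum_eq_zero, mul_zero]
    intro i _
    -- A nontrivial permutation moves at least two indices. After one factor has been
    -- differentiated, an off-diagonal entry of the diagonal matrix is still present and kills the
    -- term.
    obtain ⟨j, hj, hji⟩ : ∃ j, σ j ≠ j ∧ j ≠ i := by
      by_contra! hc
      apply hσ
      ext x
      by_cases hx : x = i
      · subst hx
        by_contra h
        have hne : σ x ≠ x := fun h' => h (by rw [h']; rfl)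
        have h6 : σ (σ x) = σ x := by
          by_contra h7
          exact hne (hc (σ x) h7)
        exact hne (σ.injective h6)
      · by_contra h
        exact hx (hc x fun h' => h (by rw [h']; rfl))
    rw [prod_eq_zero (mem_erase.mpr ⟨hji, mem_univ j⟩), zero_mul]
    rw [hd, charmatrix_apply_ne _ _ _ hj, diagonal_apply_ne _ hj, C_0, neg_zero]
  · simp

/-- At a diagonal matrix only diagonal variations count to first order, with weights ∂σ_{j+1}/∂λ_i =
σ_j(λ|i). No symmetry of the nearby matrices is required, which matters because the conjugated 𝒲 is
diagonal only at the point considered. -/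
theorem hasDerivAt_coeffSigma {A : ℝ → Matrix (Fin n) (Fin n) ℝ}
    {A' : Matrix (Fin n) (Fin n) ℝ} {lam : Fin n → ℝ} {t : ℝ}
    (hA : ∀ i j, HasDerivAt (fun s => A s i j) (A' i j) t) (hd : A t = diagonal lam) {j : ℕ}
    (hj : j + 1 ≤ n) :
    HasDerivAt (fun s => coeffSigma (j + 1) (A s)) (∑ i, esymErase lam i j * A' i i) t := by
  have h := (hasPolyDerivAt_charpoly hA hd (n - (j + 1))).const_mul ((-1 : ℝ) ^ (j + 1))
  simp only [finsetSum_coeff, mul_neg, coeff_neg, coeff_mul_C] at h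
  refine h.congr_deriv ?_
  symm
  rw [mul_sum]
  apply sum_congr rfl
  intro i _
  have hc : Multiset.card (univ.erase i).val = n - 1 := by simp
  have h1 := coeff_prod_X_sub_C (univ.erase i).val lam j (by rw [hc]; omega)
  rw [hc, show n - 1 - j = n - (j + 1) by omega] at h1
  change (∏ l ∈ univ.erase i, (X - C (lam l))).coeff (n - (j + 1)) = _ at h1
  rw [h1, esymErase, pow_succ]
  have h2 : ((-1 : ℝ) ^ j) * (-1) ^ j = 1 := by rw [← mul_pow]; simp
  linear_combination (-((univ.erase i).val.map lam).esymm j * A' i i) * h2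

end Spectral


/-! ### The maximum principle inequality in an orthonormal frame -/

section Core

open Finset

variable {n : ℕ}

theorem abs_sum_mul_le {f x : Fin n → ℝ} {B : ℝ} (hf : ∀ i, 0 ≤ f i) (hx : ∀ i, |x i| ≤ B) :
    |∑ i, f i * x i| ≤ (∑ i, f i) * B := by
  rw [sum_mul]
  refine (abs_sum_le_sum_abs _ _).trans (sum_le_sum fun i _ => ?_)
  rw [abs_mul, abs_of_nonneg (hf i)]
  exact mul_le_mul_of_nonneg_left (hx i) (hf i)

theorem abs_sum_le_mul {x : Fin n → ℝ} {B : ℝ} (hx : ∀ i, |x i| ≤ B) :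
    |∑ i, x i| ≤ n * B := by
  refine (abs_sum_le_sum_abs _ _).trans ?_
  refine (sum_le_sum fun i _ => hx i).trans ?_
  simp

/-- Here y stands for |∇²v|/|∇v|. Completing the square removes the linear term in y at the cost of
a constant, and every other error is dominated by X + XD + D² + D₂ because X ≥ 1. -/
theorem numeric_absorb {ν C₁ φ φ₀ X y D D₂ N : ℝ} {n : ℕ} (hν : 0 < ν) (hC₁ : 0 ≤ C₁)
    (hφ₀ : 0 < φ₀) (hφ : φ₀ ≤ φ) (hX : 1 ≤ X) (hD : 0 ≤ D) (hD₂ : 0 ≤ D₂) (hN0 : 0 ≤ N)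
    (main : φ ^ 2 * ν * X ^ 2 ≤ -(2 * ν * y ^ 2) + (2 * n * C₁ + N * C₁) * y
      + (2 * (n + 1) + 2 * N) * (X * D) + (3 * C₁ + 2 * n * C₁) * X + N * C₁ + N * D ^ 2
      + N * D₂) :
    φ₀ ^ 2 * ν * X ^ 2 ≤ ((2 * n * C₁ + N * C₁) ^ 2 / (8 * ν) + 2 * (n + 1) + 2 * N + 3 * C₁
        + 2 * n * C₁ + N * C₁ + N) * (X + X * D + D ^ 2 + D₂) := by
  have hquad : -(2 * ν * y ^ 2) + (2 * n * C₁ + N * C₁) * y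
      ≤ (2 * n * C₁ + N * C₁) ^ 2 / (8 * ν) := by
    rw [le_div_iff₀ (by positivity)]
    nlinarith [sq_nonneg (4 * ν * y - (2 * n * C₁ + N * C₁))]
  have hφ2 : φ₀ ^ 2 * ν * X ^ 2 ≤ φ ^ 2 * ν * X ^ 2 := by
    have : φ₀ ^ 2 ≤ φ ^ 2 := pow_le_pow_left₀ hφ₀.le hφ 2
    have : φ₀ ^ 2 * (ν * X ^ 2) ≤ φ ^ 2 * (ν * X ^ 2) :=
      mul_le_mul_of_nonneg_right this (by positivity)
    linarith
  set q := (2 * n * C₁ + N * C₁) ^ 2 / (8 * ν) with hq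
  have hq0 : 0 ≤ q := by positivity
  have hXD : 0 ≤ X * D := by positivity
  have hn0 : (0 : ℝ) ≤ n := by positivity
  have expand : (q + 2 * (n + 1) + 2 * N + 3 * C₁ + 2 * n * C₁ + N * C₁ + N)
      * (X + X * D + D ^ 2 + D₂)
      ≥ q + (2 * (n + 1) + 2 * N) * (X * D) + (3 * C₁ + 2 * n * C₁) * X + N * C₁ + N * D ^ 2
      + N * D₂ := by
    have hS : X ≤ X + X * D + D ^ 2 + D₂ := by nlinarith [sq_nonneg D]
    have hS1 : X * D ≤ X + X * D + D ^ 2 + D₂ := by nlinarith [sq_nonneg D]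
    have hS2 : D ^ 2 + D₂ ≤ X + X * D + D ^ 2 + D₂ := by linarith
    have a1 := mul_le_mul_of_nonneg_left (hX.trans hS) hq0
    have a2 := mul_le_mul_of_nonneg_left hS1 (by positivity : 0 ≤ 2 * (n + 1 : ℝ) + 2 * N)
    have a3 := mul_le_mul_of_nonneg_left hS (by positivity : 0 ≤ 3 * C₁ + 2 * n * C₁)
    have a4 := mul_le_mul_of_nonneg_left (hX.trans hS) (by positivity : 0 ≤ N * C₁)
    have a5 := mul_le_mul_of_nonneg_left hS2 hN0
    linear_combination a1 + a2 + a3 + a4 + a5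
  linarith

/-- The gradient bound extracted from the linearized equation at a maximum point. -/
theorem gradient_core {ν C₁ φ φ₀ X Y D D₂ T : ℝ} {f p w₁ w₂ Q δ e : Fin n → ℝ}
    {h : Fin n → Fin n → ℝ} {t : Fin n → Fin n → ℝ} (hν : 0 < ν) (hC₁ : 0 ≤ C₁)
    (hφ₀ : 0 < φ₀) (hφ : φ₀ ≤ φ) (hφ1 : φ ≤ 1) (hX : 1 ≤ X) (hD : 0 ≤ D)
    (hD₂ : 0 ≤ D₂)
    (hf : ∀ i, 0 ≤ f i) (hT : T = ∑ i, f i) (hT0 : 0 < T)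
    (hp : ∑ i, p i ^ 2 = X ^ 2) (hhs : ∀ i j, h i j = h j i)
    (hhY : ∑ i, ∑ j, h i j ^ 2 = Y ^ 2) (hδ : ∀ i, |δ i| ≤ D) (he : ∀ i, |e i| ≤ D₂)
    (hQ : ∀ c, Q c = ∑ i, (f i + ν * T) * t c i)
    (H1 : ∀ c, |Q c - 2 * ∑ i, f i * (h c i * p i) + T * w₁ c| ≤ T * (C₁ * (Y + X ^ 2)))
    (H2 : ∀ c, |w₁ c - 2 * ∑ l, h c l * p l| ≤ C₁ * X ^ 2)
    (H3 : ∀ a, |w₂ a - 2 * ∑ k, h a k ^ 2 - 2 * ∑ k, p k * t k a| ≤ C₁ * (X * Y + X ^ 2))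
    (H4 : |∑ i, (f i + ν * T) * h i i - ∑ i, f i * p i ^ 2 + T * X ^ 2| ≤ T * (C₁ * X))
    (H5 : ∀ a, w₁ a = -X ^ 2 * (φ * p a + δ a))
    (H6 : ∀ a, w₂ a / X ^ 2 - (φ * p a + δ a) ^ 2 + φ * h a a + 2 * φ ^ 2 * p a ^ 2 + e a ≤ 0) :
    φ₀ ^ 2 * ν * X ^ 2 ≤
      ((2 * n * C₁ + (1 + n * ν) * C₁) ^ 2 / (8 * ν) + 2 * (n + 1) + 2 * (1 + n * ν) + 3 * C₁
        + 2 * n * C₁ + (1 + n * ν) * C₁ + (1 + n * ν)) * (X + X * D + D ^ 2 + D₂) := by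
  have hX0 : 0 < X := by linarith
  have hφp : 0 < φ := by linarith
  have hpX : ∀ i, |p i| ≤ X := by
    intro i
    apply abs_le_of_sq_le_sq _ hX0.le
    rw [← hp]
    exact single_le_sum (f := fun i => p i ^ 2) (fun i _ => sq_nonneg _) (mem_univ i)
  -- The coefficients of the linearized operator: f_i comes from the Hessian in 𝒲 and νT from the
  -- trace term νΔv.
  set P : Fin n → ℝ := fun i => f i + ν * T with hP
  have hP0 : ∀ i, 0 ≤ P i := fun i => by have := hf i; positivity
  have hPν : ∀ i, ν * T ≤ P i := fun i => by have := hf i; simp only [hP]; linarith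
  set N : ℝ := 1 + n * ν with hN
  have hN0 : 0 ≤ N := by positivity
  have hPS : ∑ i, P i = T * N := by
    simp only [hP, sum_add_distrib, ← hT]; simp [hN]; ring
  set F : ℝ := ∑ i, f i * p i ^ 2 with hF
  have hFX : F ≤ T * X ^ 2 := by
    rw [hF, hT, sum_mul]
    refine sum_le_sum fun i _ => mul_le_mul_of_nonneg_left ?_ (hf i)
    rw [← sq_abs]; exact pow_le_pow_left₀ (abs_nonneg _) (hpX i) 2
  set Z : ℝ := ∑ i, P i * p i ^ 2 with hZ
  have hZX : ν * T * X ^ 2 ≤ Z := by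
    rw [hZ, ← hp, mul_sum]
    exact sum_le_sum fun i _ => mul_le_mul_of_nonneg_right (hPν i) (sq_nonneg _)
  -- the sum of the second order conditions
  have S : (∑ a, P a * w₂ a) / X ^ 2 - ∑ a, P a * (φ * p a + δ a) ^ 2 + φ * ∑ a, P a * h a a
      + 2 * φ ^ 2 * Z + ∑ a, P a * e a ≤ 0 := by
    have : ∑ a, P a * (w₂ a / X ^ 2 - (φ * p a + δ a) ^ 2 + φ * h a a + 2 * φ ^ 2 * p a ^ 2 + e a)
        ≤ 0 := sum_nonpos fun a _ => mul_nonpos_of_nonneg_of_nonpos (hP0 a) (H6 a)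
    refine le_trans (le_of_eq ?_) this
    rw [hZ, sum_div, mul_sum, mul_sum, ← sum_sub_distrib, ← sum_add_distrib, ← sum_add_distrib,
      ← sum_add_distrib]
    exact sum_congr rfl fun a _ => by ring
  have hpQ : ∑ a, P a * ∑ k, p k * t k a = ∑ k, p k * Q k := by
    simp only [hQ, mul_sum]
    rw [sum_comm]
    exact sum_congr rfl fun k _ => sum_congr rfl fun a _ => by simp only [hP]; ring
  -- A Bochner-type inequality for w. The bound P_a ≥ νT keeps the full squared Hessian, which later
  -- absorbs the errors linear in Y.
  have I1 : 2 * ν * T * Y ^ 2 + 2 * ∑ k, p k * Q k - T * N * (C₁ * (X * Y + X ^ 2))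
      ≤ ∑ a, P a * w₂ a := by
    have h1 := abs_le.mp (abs_sum_mul_le hP0 H3)
    rw [hPS] at h1
    have h2 : ∑ a, P a * (w₂ a - 2 * ∑ k, h a k ^ 2 - 2 * ∑ k, p k * t k a)
        = ∑ a, P a * w₂ a - 2 * ∑ a, P a * ∑ k, h a k ^ 2 - 2 * ∑ k, p k * Q k := by
      rw [← hpQ, mul_sum (f := fun a => P a * ∑ k, h a k ^ 2),
        mul_sum (f := fun a => P a * ∑ k, p k * t k a), ← sum_sub_distrib, ← sum_sub_distrib]
      exact sum_congr rfl fun a _ => by ring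
    have h3 : ν * T * Y ^ 2 ≤ ∑ a, P a * ∑ k, h a k ^ 2 := by
      rw [← hhY, mul_sum]
      exact sum_le_sum fun i _ => mul_le_mul_of_nonneg_right (hPν i)
        (sum_nonneg fun _ _ => sq_nonneg _)
    rw [h2] at h1
    linarith [h1.1]
  have I2 : ∑ k, p k * (2 * ∑ i, f i * (h k i * p i)) - T * ∑ k, p k * w₁ k
      - n * (X * (T * (C₁ * (Y + X ^ 2)))) ≤ ∑ k, p k * Q k := by
    have h1 : |∑ k, p k * (Q k - 2 * ∑ i, f i * (h k i * p i) + T * w₁ k)|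
        ≤ n * (X * (T * (C₁ * (Y + X ^ 2)))) := by
      apply abs_sum_le_mul
      intro k
      rw [abs_mul]
      exact mul_le_mul (hpX k) (H1 k) (abs_nonneg _) hX0.le
    have h2 : ∑ k, p k * (Q k - 2 * ∑ i, f i * (h k i * p i) + T * w₁ k)
        = ∑ k, p k * Q k - ∑ k, p k * (2 * ∑ i, f i * (h k i * p i)) + T * ∑ k, p k * w₁ k := by
      rw [mul_sum (f := fun k => p k * w₁ k), ← sum_sub_distrib, ← sum_add_distrib]
      exact sum_congr rfl fun k _ => by ring
    rw [h2] at h1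
    linarith [(abs_le.mp h1).1]
  have hfpδ : |∑ i, f i * (p i * δ i)| ≤ T * (X * D) := by
    rw [hT]
    apply abs_sum_mul_le hf
    intro i
    rw [abs_mul]
    exact mul_le_mul (hpX i) (hδ i) (abs_nonneg _) hX0.le
  have I3 : -X ^ 2 * (φ * F) - X ^ 2 * (T * (X * D)) - T * (X * (C₁ * X ^ 2))
      ≤ ∑ k, p k * (2 * ∑ i, f i * (h k i * p i)) := by
    have h0 : ∑ k, p k * (2 * ∑ i, f i * (h k i * p i))
        = ∑ i, f i * (p i * (2 * ∑ l, h i l * p l)) := by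
      simp only [mul_sum]
      rw [sum_comm]
      refine sum_congr rfl fun i _ => sum_congr rfl fun k _ => ?_
      rw [hhs k i]; ring
    have h1 : |∑ i, f i * (p i * (w₁ i - 2 * ∑ l, h i l * p l))| ≤ T * (X * (C₁ * X ^ 2)) := by
      rw [hT]
      apply abs_sum_mul_le hf
      intro i
      rw [abs_mul]
      exact mul_le_mul (hpX i) (H2 i) (abs_nonneg _) hX0.le
    have h2 : ∑ i, f i * (p i * (w₁ i - 2 * ∑ l, h i l * p l))
        = -X ^ 2 * (φ * F + ∑ i, f i * (p i * δ i))
          - ∑ i, f i * (p i * (2 * ∑ l, h i l * p l)) := by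
      rw [hF, mul_sum, ← sum_add_distrib, mul_sum, ← sum_sub_distrib]
      refine sum_congr rfl fun i _ => ?_
      rw [H5]; ring
    rw [h2] at h1
    rw [h0]
    have h3 : X ^ 2 * ∑ i, f i * (p i * δ i) ≤ X ^ 2 * (T * (X * D)) :=
      mul_le_mul_of_nonneg_left (abs_le.mp hfpδ).2 (sq_nonneg _)
    linarith [(abs_le.mp h1).2]
  have I4 : T * (X ^ 2 * (φ * X ^ 2)) - T * (X ^ 2 * (n * (X * D))) ≤ -(T * ∑ k, p k * w₁ k) := by
    have h1 : |∑ k, p k * δ k| ≤ n * (X * D) := by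
      apply abs_sum_le_mul
      intro i
      rw [abs_mul]
      exact mul_le_mul (hpX i) (hδ i) (abs_nonneg _) hX0.le
    have h2 : ∑ k, p k * w₁ k = -X ^ 2 * (φ * X ^ 2 + ∑ k, p k * δ k) := by
      rw [← hp, mul_sum, ← sum_add_distrib, hp, mul_sum]
      refine sum_congr rfl fun k _ => ?_
      rw [H5]; ring
    rw [h2]
    have h3 : T * (X ^ 2 * (-(n * (X * D)))) ≤ T * (X ^ 2 * ∑ k, p k * δ k) :=
      mul_le_mul_of_nonneg_left (mul_le_mul_of_nonneg_left (abs_le.mp h1).1 (sq_nonneg _)) hT0.le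
    linarith
  have I5 : F - T * X ^ 2 - T * (C₁ * X) ≤ ∑ a, P a * h a a := by
    linarith [(abs_le.mp H4).1]
  have I6 : ∑ a, P a * (φ * p a + δ a) ^ 2 ≤ φ ^ 2 * Z + T * N * (2 * (X * D) + D ^ 2) := by
    rw [← hPS, sum_mul, hZ, mul_sum, ← sum_add_distrib]
    refine sum_le_sum fun a _ => ?_
    have h1 : p a * δ a ≤ X * D := by
      refine (le_abs_self _).trans ?_
      rw [abs_mul]
      exact mul_le_mul (hpX a) (hδ a) (abs_nonneg _) hX0.le
    have h2 : δ a ^ 2 ≤ D ^ 2 := by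
      rw [← sq_abs]; exact pow_le_pow_left₀ (abs_nonneg _) (hδ a) 2
    have h3 : φ * (p a * δ a) ≤ X * D := by
      exact (mul_le_mul_of_nonneg_left h1 hφp.le).trans
        (mul_le_of_le_one_left (mul_nonneg hX0.le hD) hφ1)
    have h4 : (φ * p a + δ a) ^ 2 ≤ φ ^ 2 * p a ^ 2 + (2 * (X * D) + D ^ 2) := by
      linear_combination 2 * h3 + h2
    calc P a * (φ * p a + δ a) ^ 2 ≤ P a * (φ ^ 2 * p a ^ 2 + (2 * (X * D) + D ^ 2)) :=
          mul_le_mul_of_nonneg_left h4 (hP0 a)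
      _ = _ := by ring
  have I7 : -(T * N * D₂) ≤ ∑ a, P a * e a := by
    have := abs_sum_mul_le hP0 he
    rw [hPS] at this
    exact (abs_le.mp this).1
  set y := Y / X with hy
  have hYy : Y = y * X := by rw [hy]; field_simp
  -- Both the part f_i h_ki p_i and the part −T∂_k w of the differentiated equation have been
  -- reduced by the critical point condition; together they leave 2φ(TX² − F) as the main term.
  have J : (∑ a, P a * w₂ a) / X ^ 2 ≥ 2 * ν * T * y ^ 2 + 2 * φ * (T * X ^ 2 - F)
      - 2 * T * ((n + 1) * (X * D)) - 2 * T * (C₁ * X) - 2 * n * T * C₁ * (y + X)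
      - T * N * C₁ * (y + 1) := by
    rw [ge_iff_le, le_div_iff₀ (by positivity)]
    rw [hYy] at I1 I2
    linear_combination I1 + 2 * I2 + 2 * I3 + 2 * I4
  have hZ2 : φ ^ 2 * (ν * T * X ^ 2) ≤ φ ^ 2 * Z := mul_le_mul_of_nonneg_left hZX (sq_nonneg _)
  -- The term φ∑ P_a h_aa uses up one of the two copies of φ(TX² − F). The remaining copy is
  -- nonnegative and is discarded.
  have hφF : 0 ≤ φ * (T * X ^ 2 - F) := mul_nonneg hφp.le (by linarith)
  have hφI5 : φ * (F - T * X ^ 2 - T * (C₁ * X)) ≤ φ * ∑ a, P a * h a a :=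
    mul_le_mul_of_nonneg_left I5 hφp.le
  have hφC : φ * (T * (C₁ * X)) ≤ T * (C₁ * X) := by
    have : 0 ≤ T * (C₁ * X) := by positivity
    exact mul_le_of_le_one_left this hφ1
  -- The coefficient of Z is 2φ² from the second derivative of −½ log(L − v), less φ² from the
  -- square of the first order condition. All terms carry a factor T, which cancels.
  have main : T * (φ ^ 2 * ν * X ^ 2) ≤ T * (-(2 * ν * y ^ 2) + (2 * n * C₁ + N * C₁) * y
      + (2 * (n + 1) + 2 * N) * (X * D) + (3 * C₁ + 2 * n * C₁) * X + N * C₁ + N * D ^ 2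
      + N * D₂) := by
    linear_combination S + J + I6 + I7 + hφI5 + hφF + hφC + hZ2
  exact numeric_absorb hν hC₁ hφ₀ hφ hX hD hD₂ hN0 (le_of_mul_le_mul_left main hT0)

theorem sq_le_of_sq_le_mul {a b c Z : ℝ} (ha : 0 < a) (h : a * Z ^ 2 ≤ b * Z + c) :
    Z ^ 2 ≤ (b / a) ^ 2 + 2 * (c / a) := by
  have h1 : Z ^ 2 ≤ b / a * Z + c / a := by
    rw [div_mul_eq_mul_div, ← add_div, le_div_iff₀ ha]; linarith
  nlinarith [sq_nonneg (Z - b / a)]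

/-- In the variable Z = √η X, multiplication by η makes all errors at most linear in Z, since D√η ≤
√K and D₂η ≤ K. A quadratic inequality then bounds Z². -/
theorem cutoff_bound {a C K η X D D₂ : ℝ} (ha : 0 < a) (hC : 0 ≤ C) (hη : 0 < η)
    (hη1 : η ≤ 1) (hX : 0 ≤ X) (hDη : D ^ 2 * η ≤ K) (hD₂η : D₂ * η ≤ K)
    (h : a * X ^ 2 ≤ C * (X + X * D + D ^ 2 + D₂)) :
    η * X ^ 2 ≤ (C * (1 + √K) / a) ^ 2 + 2 * (C * (2 * K) / a) := by
  set r := √η with hr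
  have hr0 : 0 < r := Real.sqrt_pos.mpr hη
  have hr2 : r ^ 2 = η := Real.sq_sqrt hη.le
  have hr1 : r ≤ 1 := by rw [hr]; exact Real.sqrt_le_one.mpr hη1
  have hDr : D * r ≤ √K := by
    apply Real.le_sqrt_of_sq_le
    rw [mul_pow, hr2]; exact hDη
  have := sq_le_of_sq_le_mul (b := C * (1 + √K)) (c := C * (2 * K)) (Z := r * X) ha ?_
  · rwa [mul_pow, hr2] at this
  · have h1 : η * (X + X * D + D ^ 2 + D₂) ≤ (1 + √K) * (r * X) + 2 * K := by
      have e1 : η * X ≤ r * X := by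
        apply mul_le_mul_of_nonneg_right _ hX
        rw [← hr2]; nlinarith
      have e2 : η * (X * D) ≤ √K * (r * X) := by
        rw [← hr2]
        have := mul_le_mul_of_nonneg_right hDr (mul_nonneg hr0.le hX)
        linarith
      nlinarith
    calc a * (r * X) ^ 2 = η * (a * X ^ 2) := by rw [mul_pow, hr2]; ring
      _ ≤ η * (C * (X + X * D + D ^ 2 + D₂)) := mul_le_mul_of_nonneg_left h hη.le
      _ = C * (η * (X + X * D + D ^ 2 + D₂)) := by ring
      _ ≤ C * ((1 + √K) * (r * X) + 2 * K) := mul_le_mul_of_nonneg_left h1 hC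
      _ = _ := by ring

end Core


/-! ### Directional derivatives -/

section Directional

open Filter Topology

variable {V : Type*} [NormedAddCommGroup V] [NormedSpace ℝ V]

/-- The directional derivative. -/
noncomputable def dirD (u : V) (f : V → ℝ) (z : V) : ℝ := fderiv ℝ f z u

/-- `f` is differentiable at `z`, with derivative `f'` in the direction `u`. -/
def HasDir (u : V) (f : V → ℝ) (f' : ℝ) (z : V) : Prop :=
  DifferentiableAt ℝ f z ∧ dirD u f z = f'

variable {u u' : V} {f g : V → ℝ} {f' g' : ℝ} {z : V}

theorem hasDir_dirD (hf : DifferentiableAt ℝ f z) : HasDir u f (dirD u f z) z := ⟨hf, rfl⟩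

theorem HasDir.const (c : ℝ) : HasDir u (fun _ => c) 0 z :=
  ⟨differentiableAt_const c, by simp [dirD]⟩

theorem HasDir.add (hf : HasDir u f f' z) (hg : HasDir u g g' z) :
    HasDir u (fun z => f z + g z) (f' + g') z :=
  ⟨hf.1.fun_add hg.1, by rw [← hf.2, ← hg.2, dirD, fderiv_fun_add hf.1 hg.1]; rfl⟩

theorem HasDir.sub (hf : HasDir u f f' z) (hg : HasDir u g g' z) :
    HasDir u (fun z => f z - g z) (f' - g') z :=
  ⟨hf.1.fun_sub hg.1, by rw [← hf.2, ← hg.2, dirD, fderiv_fun_sub hf.1 hg.1]; rfl⟩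

theorem HasDir.mul (hf : HasDir u f f' z) (hg : HasDir u g g' z) :
    HasDir u (fun z => f z * g z) (f' * g z + f z * g') z := by
  refine ⟨hf.1.fun_mul hg.1, ?_⟩
  rw [← hf.2, ← hg.2, dirD, fderiv_fun_mul hf.1 hg.1]
  simp [dirD]; ring

theorem HasDir.sum {ι : Type*} {s : Finset ι} {f : ι → V → ℝ} {f' : ι → ℝ}
    (h : ∀ i ∈ s, HasDir u (f i) (f' i) z) :
    HasDir u (fun z => ∑ i ∈ s, f i z) (∑ i ∈ s, f' i) z := by
  refine ⟨DifferentiableAt.fun_sum fun i hi => (h i hi).1, ?_⟩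
  rw [dirD, fderiv_fun_sum fun i hi => (h i hi).1]
  simp only [FunLike.coe_sum, Finset.sum_apply]
  exact Finset.sum_congr rfl fun i hi => (h i hi).2

theorem HasDir.comp {φ : ℝ → ℝ} {φ' : ℝ} (hφ : HasDerivAt φ φ' (f z)) (hf : HasDir u f f' z) :
    HasDir u (fun z => φ (f z)) (φ' * f') z := by
  have h := hφ.comp_hasFDerivAt z hf.1.hasFDerivAt
  refine ⟨h.differentiableAt, ?_⟩
  rw [dirD, show (fun z => φ (f z)) = φ ∘ f from rfl, h.fderiv, ← hf.2]
  simp [dirD]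

theorem HasDir.log (hf : HasDir u f f' z) (h : f z ≠ 0) :
    HasDir u (fun z => Real.log (f z)) ((f z)⁻¹ * f') z :=
  HasDir.comp (Real.hasDerivAt_log h) hf

theorem HasDir.inv (hf : HasDir u f f' z) (h : f z ≠ 0) :
    HasDir u (fun z => (f z)⁻¹) (-(f z ^ 2)⁻¹ * f') z :=
  HasDir.comp (hasDerivAt_inv h) hf

theorem HasDir.hasDerivAt (hf : HasDir u f f' z) :
    HasDerivAt (fun s : ℝ => f (z + s • u)) f' 0 := by
  have h := hf.1.hasFDerivAt.hasLineDerivAt u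
  rw [HasLineDerivAt] at h
  rwa [show fderiv ℝ f z u = f' from hf.2] at h

theorem dirD_congr (h : f =ᶠ[𝓝 z] g) : dirD u f z = dirD u g z := by
  rw [dirD, dirD, h.fderiv_eq]

theorem contDiffAt_dirD {m k : WithTop ℕ∞} (hf : ContDiffAt ℝ k f z) (hmk : m + 1 ≤ k) :
    ContDiffAt ℝ m (dirD u f) z :=
  (hf.fderiv_right hmk).clm_apply contDiffAt_const

theorem dirD_comm (hf : ContDiffAt ℝ 2 f z) :
    dirD u (dirD u' f) z = dirD u' (dirD u f) z := by
  have hd : DifferentiableAt ℝ (fderiv ℝ f) z :=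
    (hf.fderiv_right (m := 1) (by norm_num)).differentiableAt (by norm_num)
  have e : ∀ a b : V, dirD a (dirD b f) z = fderiv ℝ (fderiv ℝ f) z a b := by
    intro a b
    have : dirD b f = fun x => fderiv ℝ f x b := rfl
    rw [this, dirD, fderiv_clm_apply hd (differentiableAt_const b)]
    simp
  rw [e, e]
  exact (hf.isSymmSndFDerivAt (by simp)).eq u u'

theorem dirD_eq_zero_of_isLocalMax (h : IsLocalMax f z) : dirD u f z = 0 := by
  rw [dirD, h.fderiv_eq_zero]; rfl

/-- If it were positive, the restriction to the line would have both a local minimum and a local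
maximum, hence be locally constant, and its second derivative would vanish. -/
theorem dirD_dirD_nonpos_of_isLocalMax (hf : ContDiffAt ℝ 2 f z) (h : IsLocalMax f z) :
    dirD u (dirD u f) z ≤ 0 := by
  by_contra! hpos
  set g : ℝ → ℝ := fun s => f (z + s • u) with hg
  have hline : Tendsto (fun s : ℝ => z + s • u) (𝓝 0) (𝓝 z) := by
    have : Continuous fun s : ℝ => z + s • u := by fun_prop
    simpa using this.tendsto 0
  have hd : ∀ᶠ x in 𝓝 z, DifferentiableAt ℝ f x := by
    filter_upwards [hf.eventually (by simp)] with x hx using hx.differentiableAt (by norm_num)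
  have hg1 : deriv g =ᶠ[𝓝 0] fun s => dirD u f (z + s • u) := by
    filter_upwards [hline.eventually hd] with s hs
    have h1 := (hasDir_dirD (u := u) hs).hasDerivAt
    have h2 : HasDerivAt g (dirD u f (z + s • u)) s := by
      have := HasDerivAt.comp_sub_const (x := s) (a := s) (f := fun r => f (z + s • u + r • u))
        (by simpa using h1)
      have e : (fun r : ℝ => f (z + s • u + (r - s) • u)) = g := by
        ext r
        simp only [hg, sub_smul]
        congr 1
        abel
      rwa [e] at this
    exact h2.deriv
  have hg2 : deriv (deriv g) 0 = dirD u (dirD u f) z := by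
    rw [hg1.deriv_eq]
    exact (hasDir_dirD (u := u) ((contDiffAt_dirD (m := 1) hf (by norm_num)).differentiableAt
      (by norm_num))).hasDerivAt.deriv
  have hmax : IsLocalMax g 0 := by
    have := hline.eventually h
    simpa [IsLocalMax, IsMaxFilter, hg] using this
  have hmin : IsLocalMin g 0 := by
    apply isLocalMin_of_deriv_deriv_pos (by rw [hg2]; exact hpos) hmax.deriv_eq_zero
    have h1 : ContinuousAt f (z + (0 : ℝ) • u) := by simpa using hf.continuousAt
    exact ContinuousAt.comp (f := fun s : ℝ => z + s • u) h1 (by fun_prop)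
  have hconst : g =ᶠ[𝓝 0] fun _ => g 0 := by
    filter_upwards [hmax, hmin] with s h1 h2 using le_antisymm h1 h2
  have h0 : deriv g =ᶠ[𝓝 0] fun _ => 0 := by
    filter_upwards [hconst.eventuallyEq_nhds] with s hs
    rw [hs.deriv_eq]; simp
  rw [← hg2, h0.deriv_eq] at hpos
  simp at hpos

/-- First and second order conditions at a maximum point of `(w η)² / (L - v)`. -/
theorem log_test {w v η : V → ℝ} {L : ℝ} (hw : ContDiffAt ℝ 2 w z) (hv : ContDiffAt ℝ 2 v z)
    (hη : ContDiffAt ℝ 2 η z) (hw0 : 0 < w z) (hη0 : 0 < η z) (hvL : v z < L)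
    (hmax : IsLocalMax (fun x => (w x * η x) ^ 2 / (L - v x)) z) (u : V) :
    dirD u w z / w z + 1 / (2 * (L - v z)) * dirD u v z + dirD u η z / η z = 0 ∧
    dirD u (dirD u w) z / w z - (dirD u w z / w z) ^ 2
      + 1 / (2 * (L - v z)) * dirD u (dirD u v) z
      + 2 * (1 / (2 * (L - v z))) ^ 2 * dirD u v z ^ 2
      + (dirD u (dirD u η) z / η z - (dirD u η z / η z) ^ 2) ≤ 0 := by
  -- Half the logarithm of the test function. The weight ½ makes the second derivative of −½ log(L −
  -- v) in v twice the square of the first; weight 1 would leave no surplus.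
  set ψ : V → ℝ := fun x => Real.log (w x) + Real.log (η x) - 1 / 2 * Real.log (L - v x) with hψ
  have ev : ∀ᶠ x in 𝓝 z, 0 < w x ∧ 0 < η x ∧ 0 < L - v x ∧ DifferentiableAt ℝ w x ∧
      DifferentiableAt ℝ v x ∧ DifferentiableAt ℝ η x := by
    have d {f : V → ℝ} (hf : ContDiffAt ℝ 2 f z) : ∀ᶠ x in 𝓝 z, DifferentiableAt ℝ f x := by
      filter_upwards [hf.eventually (by simp)] with x hx using hx.differentiableAt (by norm_num)
    have hvc : ContinuousAt (fun x => L - v x) z := continuousAt_const.sub hv.continuousAt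
    filter_upwards [hw.continuousAt.eventually (lt_mem_nhds hw0),
      hη.continuousAt.eventually (lt_mem_nhds hη0),
      hvc.eventually (lt_mem_nhds (sub_pos.mpr hvL)), d hw, d hv, d hη] with x h1 h2 h3 h4 h5 h6
    exact ⟨h1, h2, h3, h4, h5, h6⟩
  have hψmax : IsLocalMax ψ z := by
    have e : ∀ x, 0 < w x → 0 < η x → 0 < L - v x →
        ψ x = 1 / 2 * Real.log ((w x * η x) ^ 2 / (L - v x)) := by
      intro x h1 h2 h3
      rw [Real.log_div (by positivity) h3.ne', Real.log_pow, Real.log_mul h1.ne' h2.ne']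
      simp only [hψ]; push_cast; ring
    filter_upwards [ev, hmax] with x hx hx2
    obtain ⟨h1, h2, h3, -⟩ := hx
    rw [e x h1 h2 h3, e z hw0 hη0 (sub_pos.mpr hvL)]
    exact mul_le_mul_of_nonneg_left (Real.log_le_log (by positivity) hx2) (by norm_num)
  have hψ2 : ContDiffAt ℝ 2 ψ z :=
    ((hw.log hw0.ne').add (hη.log hη0.ne')).sub
      (contDiffAt_const.mul ((contDiffAt_const.sub hv).log (sub_pos.mpr hvL).ne'))
  have hψ1 : dirD u ψ =ᶠ[𝓝 z] fun x =>
      (w x)⁻¹ * dirD u w x + (η x)⁻¹ * dirD u η x - (0 * Real.log (L - v x) + 1 / 2 *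
        ((L - v x)⁻¹ * (0 - dirD u v x))) := by
    filter_upwards [ev] with x hx
    obtain ⟨h1, h2, h3, h4, h5, h6⟩ := hx
    exact ((((hasDir_dirD h4).log h1.ne').add ((hasDir_dirD h6).log h2.ne')).sub
      ((HasDir.const _).mul (((HasDir.const L).sub (hasDir_dirD h5)).log h3.ne'))).2
  obtain ⟨h1, h2, h3, h4, h5, h6⟩ := ev.self_of_nhds
  have dd {f : V → ℝ} (hf : ContDiffAt ℝ 2 f z) : DifferentiableAt ℝ (dirD u f) z :=
    (contDiffAt_dirD (m := 1) hf (by norm_num)).differentiableAt (by norm_num)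
  constructor
  · have := dirD_eq_zero_of_isLocalMax (u := u) hψmax
    rw [hψ1.self_of_nhds] at this
    rw [← this]
    field_simp
    ring
  · have h := dirD_dirD_nonpos_of_isLocalMax (u := u) hψ2 hψmax
    have hL := (HasDir.const (u := u) L).sub (hasDir_dirD h5)
    rw [dirD_congr hψ1, (((((hasDir_dirD h4).inv h1.ne').mul (hasDir_dirD (dd hw))).add
      (((hasDir_dirD h6).inv h2.ne').mul (hasDir_dirD (dd hη)))).sub
      (((HasDir.const 0).mul (hL.log h3.ne')).add ((HasDir.const (1 / 2)).mul
        ((hL.inv h3.ne').mul ((HasDir.const 0).sub (hasDir_dirD (dd hv))))))).2] at h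
    refine le_trans (le_of_eq ?_) h
    field_simp
    ring

end Directional


/-! ### The gradient estimate at a maximum point, in a frame -/

section Frame

open Finset Filter Topology

variable {n : ℕ} {V : Type*} [NormedAddCommGroup V] [NormedSpace ℝ V]

theorem HasDir.congr {u : V} {f g : V → ℝ} {f' : ℝ} {z : V} (hf : HasDir u f f' z)
    (h : g =ᶠ[𝓝 z] f) : HasDir u g f' z :=
  ⟨hf.1.congr_of_eventuallyEq h, by rw [dirD_congr h, hf.2]⟩

/-- `|∇v|²` in the constant frame `e`, with inverse metric `G`. -/
noncomputable def frameNormSq (e : Fin n → V) (G : Fin n → Fin n → V → ℝ) (v : V → ℝ) (z : V) : ℝ :=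
  ∑ k, ∑ l, G k l z * (dirD (e k) v z * dirD (e l) v z)

/-- The model for the matrix of `𝒲[v]` in the constant frame `e`: the terms of top order are
explicit, the remaining ones are affine in `dv` with coefficients `Λ`, `ρ`. -/
noncomputable def frameW (e : Fin n → V) (G : Fin n → Fin n → V → ℝ)
    (Λ : Fin n → Fin n → Fin n → V → ℝ) (ρ : Fin n → Fin n → V → ℝ) (ν : ℝ) (v : V → ℝ)
    (i j : Fin n) (z : V) : ℝ :=
  (∑ l, G i l z * (dirD (e l) (dirD (e j) v) z - dirD (e l) v z * dirD (e j) v z))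
    + (if i = j then (1 : ℝ) else 0) *
      (ν * (∑ k, ∑ l, G k l z * dirD (e k) (dirD (e l) v) z) + frameNormSq e G v z)
    + ((∑ m, Λ m i j z * dirD (e m) v z) + ρ i j z)

variable {e : Fin n → V} {G : Fin n → Fin n → V → ℝ} {v : V → ℝ} {y : V}
  {Λ : Fin n → Fin n → Fin n → V → ℝ} {ρ : Fin n → Fin n → V → ℝ} {ν : ℝ}

theorem hasDir_frameNormSq {z : V} (u : V) (hG : ∀ k l, DifferentiableAt ℝ (G k l) z)
    (hv : ∀ k, DifferentiableAt ℝ (dirD (e k) v) z) :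
    HasDir u (frameNormSq e G v)
      (∑ k, ∑ l, (dirD u (G k l) z * (dirD (e k) v z * dirD (e l) v z)
        + G k l z * (dirD u (dirD (e k) v) z * dirD (e l) v z
          + dirD (e k) v z * dirD u (dirD (e l) v) z))) z :=
  HasDir.sum fun k _ => HasDir.sum fun l _ =>
    (hasDir_dirD (hG k l)).mul ((hasDir_dirD (hv k)).mul (hasDir_dirD (hv l)))

theorem contDiffAt_frameNormSq (hG : ∀ k l, ContDiffAt ℝ 2 (G k l) y) (hv : ContDiffAt ℝ 3 v y) :
    ContDiffAt ℝ 2 (frameNormSq e G v) y := by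
  have hp : ∀ k, ContDiffAt ℝ 2 (dirD (e k) v) y := fun k => contDiffAt_dirD hv (by norm_num)
  exact ContDiffAt.sum fun k _ => ContDiffAt.sum fun l _ => (hG k l).mul ((hp k).mul (hp l))

theorem dirD_dirD_frameNormSq (u : V) (hG : ∀ k l, ContDiffAt ℝ 2 (G k l) y)
    (hv : ContDiffAt ℝ 3 v y) :
    dirD u (dirD u (frameNormSq e G v)) y
      = ∑ k, ∑ l, ((dirD u (dirD u (G k l)) y * (dirD (e k) v y * dirD (e l) v y)
          + dirD u (G k l) y * (dirD u (dirD (e k) v) y * dirD (e l) v y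
            + dirD (e k) v y * dirD u (dirD (e l) v) y))
        + (dirD u (G k l) y * (dirD u (dirD (e k) v) y * dirD (e l) v y
          + dirD (e k) v y * dirD u (dirD (e l) v) y)
          + G k l y * ((dirD u (dirD u (dirD (e k) v)) y * dirD (e l) v y
            + dirD u (dirD (e k) v) y * dirD u (dirD (e l) v) y)
            + (dirD u (dirD (e k) v) y * dirD u (dirD (e l) v) y
            + dirD (e k) v y * dirD u (dirD u (dirD (e l) v)) y)))) := by
  have hp : ∀ k, ContDiffAt ℝ 2 (dirD (e k) v) y := fun k => contDiffAt_dirD hv (by norm_num)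
  have d1 {f : V → ℝ} (hf : ContDiffAt ℝ 2 f y) : ∀ᶠ z in 𝓝 y, DifferentiableAt ℝ f z := by
    filter_upwards [hf.eventually (by simp)] with x hx using hx.differentiableAt (by norm_num)
  have d2 {f : V → ℝ} (hf : ContDiffAt ℝ 2 f y) : HasDir u (dirD u f) (dirD u (dirD u f) y) y :=
    hasDir_dirD ((contDiffAt_dirD (m := 1) hf (by norm_num)).differentiableAt (by norm_num))
  have d0 {f : V → ℝ} (hf : ContDiffAt ℝ 2 f y) : HasDir u f (dirD u f y) y :=
    hasDir_dirD (hf.differentiableAt (by norm_num))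
  have h1 : dirD u (frameNormSq e G v) =ᶠ[𝓝 y] fun z =>
      ∑ k, ∑ l, (dirD u (G k l) z * (dirD (e k) v z * dirD (e l) v z)
        + G k l z * (dirD u (dirD (e k) v) z * dirD (e l) v z
          + dirD (e k) v z * dirD u (dirD (e l) v) z)) := by
    have hGd : ∀ᶠ z in 𝓝 y, ∀ k l, DifferentiableAt ℝ (G k l) z := by
      simp only [eventually_all]; exact fun k l => d1 (hG k l)
    have hpd : ∀ᶠ z in 𝓝 y, ∀ k, DifferentiableAt ℝ (dirD (e k) v) z := by
      simp only [eventually_all]; exact fun k => d1 (hp k)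
    filter_upwards [hGd, hpd] with z h1 h2 using (hasDir_frameNormSq u h1 h2).2
  rw [dirD_congr h1]
  exact (HasDir.sum fun k _ => HasDir.sum fun l _ =>
    ((d2 (hG k l)).mul ((d0 (hp k)).mul (d0 (hp l)))).add
      ((d0 (hG k l)).mul (((d2 (hp k)).mul (d0 (hp l))).add ((d0 (hp k)).mul (d2 (hp l)))))).2

/-- The directions are constant vectors of the coordinate space, so no commutator and no curvature
term appears. -/
theorem dirD_dirD_dirD_comm (hv : ContDiffAt ℝ 3 v y) (a k : V) :
    dirD a (dirD a (dirD k v)) y = dirD k (dirD a (dirD a v)) y := by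
  have h2 : ContDiffAt ℝ 2 v y := hv.of_le (by norm_num)
  have h1 : dirD a (dirD k v) =ᶠ[𝓝 y] dirD k (dirD a v) := by
    filter_upwards [h2.eventually (by simp)] with z hz using dirD_comm hz
  rw [dirD_congr h1]
  exact dirD_comm (contDiffAt_dirD hv (by norm_num))

/-- Derivative of the model matrix in the direction `u`. -/
noncomputable def frameWDeriv (e : Fin n → V) (G : Fin n → Fin n → V → ℝ)
    (Λ : Fin n → Fin n → Fin n → V → ℝ) (ρ : Fin n → Fin n → V → ℝ) (ν : ℝ) (v : V → ℝ) (u : V)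
    (y : V) (i j : Fin n) : ℝ :=
  (∑ l, (dirD u (G i l) y * (dirD (e l) (dirD (e j) v) y - dirD (e l) v y * dirD (e j) v y)
      + G i l y * (dirD u (dirD (e l) (dirD (e j) v)) y
        - (dirD u (dirD (e l) v) y * dirD (e j) v y
          + dirD (e l) v y * dirD u (dirD (e j) v) y))))
    + (0 * (ν * (∑ k, ∑ l, G k l y * dirD (e k) (dirD (e l) v) y) + frameNormSq e G v y)
      + (if i = j then (1 : ℝ) else 0) *
        ((0 * (∑ k, ∑ l, G k l y * dirD (e k) (dirD (e l) v) y)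
          + ν * (∑ k, ∑ l, (dirD u (G k l) y * dirD (e k) (dirD (e l) v) y
            + G k l y * dirD u (dirD (e k) (dirD (e l) v)) y)))
        + dirD u (frameNormSq e G v) y))
    + ((∑ m, (dirD u (Λ m i j) y * dirD (e m) v y + Λ m i j y * dirD u (dirD (e m) v) y))
      + dirD u (ρ i j) y)

theorem hasDir_frameW (u : V) (hG : ∀ k l, ContDiffAt ℝ 2 (G k l) y) (hv : ContDiffAt ℝ 3 v y)
    (hΛ : ∀ m i j, DifferentiableAt ℝ (Λ m i j) y) (hρ : ∀ i j, DifferentiableAt ℝ (ρ i j) y)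
    (i j : Fin n) :
    HasDir u (frameW e G Λ ρ ν v i j) (frameWDeriv e G Λ ρ ν v u y i j) y := by
  have hp : ∀ k, ContDiffAt ℝ 2 (dirD (e k) v) y := fun k => contDiffAt_dirD hv (by norm_num)
  have hh : ∀ k l, HasDir u (dirD (e k) (dirD (e l) v))
      (dirD u (dirD (e k) (dirD (e l) v)) y) y := fun k l =>
    hasDir_dirD ((contDiffAt_dirD (m := 1) (hp l) (by norm_num)).differentiableAt (by norm_num))
  have dp : ∀ k, HasDir u (dirD (e k) v) (dirD u (dirD (e k) v) y) y := fun k =>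
    hasDir_dirD ((hp k).differentiableAt (by norm_num))
  have dG : ∀ k l, HasDir u (G k l) (dirD u (G k l) y) y := fun k l =>
    hasDir_dirD ((hG k l).differentiableAt (by norm_num))
  have dw : HasDir u (frameNormSq e G v) (dirD u (frameNormSq e G v) y) y :=
    hasDir_dirD ((contDiffAt_frameNormSq hG hv).differentiableAt (by norm_num))
  exact ((HasDir.sum fun l _ => (dG i l).mul ((hh l j).sub ((dp l).mul (dp j)))).add
    ((HasDir.const _).mul (((HasDir.const ν).mul (HasDir.sum fun k _ => HasDir.sum fun l _ =>
      (dG k l).mul (hh k l))).add dw))).add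
    ((HasDir.sum fun m _ => (hasDir_dirD (hΛ m i j)).mul (dp m)).add (hasDir_dirD (hρ i j)))

/-- The differentiated equation. -/
theorem differentiated_equation {m : ℕ} (hm : m + 2 ≤ n) {A : V → Matrix (Fin n) (Fin n) ℝ}
    {A' : Matrix (Fin n) (Fin n) ℝ} {lam : Fin n → ℝ} {β b : V → ℝ} {u : V}
    (hA : ∀ i j, HasDir u (fun z => A z i j) (A' i j) y) (hd : A y = Matrix.diagonal lam)
    (hβ : DifferentiableAt ℝ β y) (hb : DifferentiableAt ℝ b y)
    (heq : ∀ᶠ z in 𝓝 y, coeffSigma (m + 2) (A z) + β z * coeffSigma (m + 1) (A z) = b z) :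
    ∑ i, (esymErase lam i (m + 1) + β y * esymErase lam i m) * A' i i
      = dirD u b y - dirD u β y * esym lam (m + 1) := by
  have h0 : A (y + (0 : ℝ) • u) = Matrix.diagonal lam := by simpa using hd
  have hA' : ∀ i j, HasDerivAt (fun s : ℝ => A (y + s • u) i j) (A' i j) 0 := fun i j =>
    (hA i j).hasDerivAt
  have h1 := hasDerivAt_coeffSigma hA' h0 (j := m + 1) hm
  have h2 := hasDerivAt_coeffSigma hA' h0 (j := m) (by omega)
  have h3 := h1.add ((hasDir_dirD (u := u) hβ).hasDerivAt.mul h2)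
  have hline : Tendsto (fun s : ℝ => y + s • u) (𝓝 0) (𝓝 y) := by
    have : Continuous fun s : ℝ => y + s • u := by fun_prop
    simpa using this.tendsto 0
  have h4 := (hasDir_dirD (u := u) hb).hasDerivAt.congr_of_eventuallyEq (hline.eventually heq)
  have h5 := h3.unique h4
  rw [h0, coeffSigma_diagonal _ (by omega)] at h5
  rw [← h5]
  simp only [zero_smul, add_zero, add_mul, sum_add_distrib, mul_assoc, ← mul_sum]
  ring

/-- The remainder in the differentiated matrix. -/
noncomputable def frameWRem (e : Fin n → V) (G : Fin n → Fin n → V → ℝ)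
    (Λ : Fin n → Fin n → Fin n → V → ℝ) (ρ : Fin n → Fin n → V → ℝ) (ν : ℝ) (v : V → ℝ) (u : V)
    (y : V) (i : Fin n) : ℝ :=
  (∑ l, dirD u (G i l) y * (dirD (e l) (dirD (e i) v) y - dirD (e l) v y * dirD (e i) v y))
    + ν * (∑ k, ∑ l, dirD u (G k l) y * dirD (e k) (dirD (e l) v) y)
    + ((∑ m, (dirD u (Λ m i i) y * dirD (e m) v y + Λ m i i y * dirD u (dirD (e m) v) y))
      + dirD u (ρ i i) y)

/-- The differentiated equation sees only diagonal entries. This isolates the terms treated by the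
maximum principle from those containing derivatives of the coefficients. -/
theorem frameWDeriv_diag (hG1 : ∀ k l, G k l y = if k = l then 1 else 0) (u : V) (i : Fin n) :
    frameWDeriv e G Λ ρ ν v u y i i = dirD u (dirD (e i) (dirD (e i) v)) y
      + ν * ∑ k, dirD u (dirD (e k) (dirD (e k) v)) y
      - 2 * (dirD u (dirD (e i) v) y * dirD (e i) v y) + dirD u (frameNormSq e G v) y
      + frameWRem e G Λ ρ ν v u y i := by
  simp only [frameWDeriv, frameWRem, sum_add_distrib, hG1, ite_mul, one_mul, zero_mul,
    sum_ite_eq, mem_univ, if_true]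
  ring

/-- Each remainder term contains at most one Hessian factor or two gradient factors, and no third
derivative; hence the growth Y + X². -/
theorem abs_frameWRem_le {K X Y : ℝ} (hν : 0 ≤ ν) (hK : 0 ≤ K) (hX : 1 ≤ X) (hY : 0 ≤ Y) {u : V}
    (hp : ∀ i, |dirD (e i) v y| ≤ X) (hh : ∀ i j, |dirD (e i) (dirD (e j) v) y| ≤ Y)
    (hu : ∀ j, |dirD u (dirD (e j) v) y| ≤ Y)
    (hG : ∀ k l, |dirD u (G k l) y| ≤ K) (hΛ : ∀ m i j, |Λ m i j y| ≤ K)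
    (hΛ' : ∀ m i j, |dirD u (Λ m i j) y| ≤ K) (hρ : ∀ i j, |dirD u (ρ i j) y| ≤ K) (i : Fin n) :
    |frameWRem e G Λ ρ ν v u y i| ≤ K * (2 * n + ν * n ^ 2 + 1) * (Y + X ^ 2) := by
  have hX0 : 0 ≤ X := by linarith
  have b1 : |∑ l, dirD u (G i l) y * (dirD (e l) (dirD (e i) v) y
      - dirD (e l) v y * dirD (e i) v y)| ≤ n * (K * (Y + X ^ 2)) := by
    apply abs_sum_le_mul
    intro l
    rw [abs_mul]
    refine mul_le_mul (hG i l) ?_ (abs_nonneg _) hK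
    refine (abs_sub _ _).trans (add_le_add (hh l i) ?_)
    rw [abs_mul, sq]
    exact mul_le_mul (hp l) (hp i) (abs_nonneg _) hX0
  have b2 : |∑ k, ∑ l, dirD u (G k l) y * dirD (e k) (dirD (e l) v) y| ≤ n * (n * (K * Y)) := by
    apply abs_sum_le_mul
    intro k
    apply abs_sum_le_mul
    intro l
    rw [abs_mul]
    exact mul_le_mul (hG k l) (hh k l) (abs_nonneg _) hK
  have b3 : |∑ m, (dirD u (Λ m i i) y * dirD (e m) v y + Λ m i i y * dirD u (dirD (e m) v) y)|
      ≤ n * (K * X + K * Y) := by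
    apply abs_sum_le_mul
    intro m
    refine (abs_add_le _ _).trans (add_le_add ?_ ?_) <;> rw [abs_mul]
    · exact mul_le_mul (hΛ' m i i) (hp m) (abs_nonneg _) hK
    · exact mul_le_mul (hΛ m i i) (hu m) (abs_nonneg _) hK
  have b4 := hρ i i
  have b2' : |ν * ∑ k, ∑ l, dirD u (G k l) y * dirD (e k) (dirD (e l) v) y|
      ≤ ν * (n * (n * (K * Y))) := by
    rw [abs_mul, abs_of_nonneg hν]
    exact mul_le_mul_of_nonneg_left b2 hν
  rw [frameWRem]
  have := (abs_add_le _ _).trans (add_le_add ((abs_add_le _ _).trans (add_le_add b1 b2'))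
    ((abs_add_le _ _).trans (add_le_add b3 b4)))
  refine this.trans ?_
  have hXX : X ≤ X ^ 2 := by nlinarith
  have h1X : 1 ≤ X ^ 2 := by nlinarith
  have hn : (0 : ℝ) ≤ n := by positivity
  have c1 := mul_le_mul_of_nonneg_left hXX (mul_nonneg hn hK)
  have c2 := mul_le_mul_of_nonneg_left h1X hK
  have c3 : 0 ≤ ν * n ^ 2 * K * X ^ 2 := by positivity
  have c4 : 0 ≤ K * Y := by positivity
  linear_combination c1 + c2 + c3 + c4

end Frame


/-! ### Error bounds and the gradient estimate in an orthonormal diagonalizing frame. -/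

section FrameEstimate

open Finset Filter Topology

variable {n : ℕ} {V : Type*} [NormedAddCommGroup V] [NormedSpace ℝ V]

theorem sum_sum_delta (F : Fin n → Fin n → ℝ) :
    ∑ k, ∑ l, (if k = l then (1 : ℝ) else 0) * F k l = ∑ k, F k k := by
  simp [ite_mul]

theorem sum_sum_add_delta (F₁ F₂ : Fin n → Fin n → ℝ) :
    ∑ k, ∑ l, (F₁ k l + (if k = l then (1 : ℝ) else 0) * F₂ k l)
      = ∑ k, ∑ l, F₁ k l + ∑ k, F₂ k k := by
  simp only [sum_add_distrib, sum_sum_delta]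

variable {e : Fin n → V} {G : Fin n → Fin n → V → ℝ} {v : V → ℝ} {y : V}

theorem frameNormSq_eq (hG1 : ∀ k l, G k l y = if k = l then 1 else 0) :
    frameNormSq e G v y = ∑ k, dirD (e k) v y ^ 2 := by
  simp only [frameNormSq, hG1, sum_sum_delta, sq]

theorem abs_dirD_frameNormSq_sub_le {K X : ℝ} (hK : 0 ≤ K) (hX : 0 ≤ X) (u : V)
    (hG : ∀ k l, DifferentiableAt ℝ (G k l) y) (hv : ∀ k, DifferentiableAt ℝ (dirD (e k) v) y)
    (hG1 : ∀ k l, G k l y = if k = l then 1 else 0)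
    (hp : ∀ i, |dirD (e i) v y| ≤ X) (hG' : ∀ k l, |dirD u (G k l) y| ≤ K) :
    |dirD u (frameNormSq e G v) y - 2 * ∑ l, dirD u (dirD (e l) v) y * dirD (e l) v y|
      ≤ n * (n * (K * X ^ 2)) := by
  rw [(hasDir_frameNormSq u hG hv).2]
  have : (∑ k, ∑ l, (dirD u (G k l) y * (dirD (e k) v y * dirD (e l) v y)
        + G k l y * (dirD u (dirD (e k) v) y * dirD (e l) v y
          + dirD (e k) v y * dirD u (dirD (e l) v) y)))
      - 2 * ∑ l, dirD u (dirD (e l) v) y * dirD (e l) v y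
      = ∑ k, ∑ l, dirD u (G k l) y * (dirD (e k) v y * dirD (e l) v y) := by
    simp only [sum_add_distrib, hG1, sum_sum_delta, mul_sum]
    rw [add_sub_assoc, ← sum_add_distrib, ← sum_sub_distrib]
    rw [add_eq_left]
    exact sum_eq_zero fun i _ => by ring
  rw [this]
  apply abs_sum_le_mul
  intro k
  apply abs_sum_le_mul
  intro l
  rw [abs_mul, abs_mul, sq]
  exact mul_le_mul (hG' k l) (mul_le_mul (hp k) (hp l) (abs_nonneg _) hX) (by positivity) hK

/-- A Bochner identity in flat derivatives: the usual curvature and connection terms are replaced by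
errors in which at least one derivative falls on the inverse metric. -/
theorem abs_dirD_dirD_frameNormSq_sub_le {K X Y : ℝ} (hK : 0 ≤ K) (hX : 0 ≤ X) (u : V)
    (hG : ∀ k l, ContDiffAt ℝ 2 (G k l) y) (hv : ContDiffAt ℝ 3 v y)
    (hG1 : ∀ k l, G k l y = if k = l then 1 else 0)
    (hp : ∀ i, |dirD (e i) v y| ≤ X) (hh : ∀ j, |dirD u (dirD (e j) v) y| ≤ Y)
    (hG' : ∀ k l, |dirD u (G k l) y| ≤ K) (hG'' : ∀ k l, |dirD u (dirD u (G k l)) y| ≤ K) :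
    |dirD u (dirD u (frameNormSq e G v)) y - 2 * ∑ k, dirD u (dirD (e k) v) y ^ 2
      - 2 * ∑ k, dirD (e k) v y * dirD (e k) (dirD u (dirD u v)) y|
      ≤ n * (n * (K * (4 * (X * Y) + X ^ 2))) := by
  rw [dirD_dirD_frameNormSq u hG hv]
  have : ∀ k l, dirD u (dirD u (G k l)) y * (dirD (e k) v y * dirD (e l) v y)
          + dirD u (G k l) y * (dirD u (dirD (e k) v) y * dirD (e l) v y
            + dirD (e k) v y * dirD u (dirD (e l) v) y)
        + (dirD u (G k l) y * (dirD u (dirD (e k) v) y * dirD (e l) v y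
          + dirD (e k) v y * dirD u (dirD (e l) v) y)
          + G k l y * ((dirD u (dirD u (dirD (e k) v)) y * dirD (e l) v y
            + dirD u (dirD (e k) v) y * dirD u (dirD (e l) v) y)
            + (dirD u (dirD (e k) v) y * dirD u (dirD (e l) v) y
            + dirD (e k) v y * dirD u (dirD u (dirD (e l) v)) y)))
      = (dirD u (dirD u (G k l)) y * (dirD (e k) v y * dirD (e l) v y)
        + 2 * (dirD u (G k l) y * (dirD u (dirD (e k) v) y * dirD (e l) v y
            + dirD (e k) v y * dirD u (dirD (e l) v) y)))
        + (if k = l then (1 : ℝ) else 0) * ((dirD u (dirD u (dirD (e k) v)) y * dirD (e l) v y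
            + dirD u (dirD (e k) v) y * dirD u (dirD (e l) v) y)
            + (dirD u (dirD (e k) v) y * dirD u (dirD (e l) v) y
            + dirD (e k) v y * dirD u (dirD u (dirD (e l) v)) y)) := by
    intro k l; rw [hG1]; ring
  simp only [this]
  have h2 : (∑ k, ∑ l, ((dirD u (dirD u (G k l)) y * (dirD (e k) v y * dirD (e l) v y)
        + 2 * (dirD u (G k l) y * (dirD u (dirD (e k) v) y * dirD (e l) v y
            + dirD (e k) v y * dirD u (dirD (e l) v) y)))
        + (if k = l then (1 : ℝ) else 0) * ((dirD u (dirD u (dirD (e k) v)) y * dirD (e l) v y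
            + dirD u (dirD (e k) v) y * dirD u (dirD (e l) v) y)
            + (dirD u (dirD (e k) v) y * dirD u (dirD (e l) v) y
            + dirD (e k) v y * dirD u (dirD u (dirD (e l) v)) y))))
      - 2 * ∑ k, dirD u (dirD (e k) v) y ^ 2
      - 2 * ∑ k, dirD (e k) v y * dirD (e k) (dirD u (dirD u v)) y
      = ∑ k, ∑ l, (dirD u (dirD u (G k l)) y * (dirD (e k) v y * dirD (e l) v y)
        + 2 * (dirD u (G k l) y * (dirD u (dirD (e k) v) y * dirD (e l) v y
            + dirD (e k) v y * dirD u (dirD (e l) v) y))) := by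
    rw [sum_sum_add_delta, mul_sum, mul_sum, add_sub_assoc, add_sub_assoc, ← sum_sub_distrib,
      ← sum_sub_distrib, add_eq_left]
    refine sum_eq_zero fun k _ => ?_
    rw [dirD_dirD_dirD_comm hv]
    ring
  rw [h2]
  apply abs_sum_le_mul
  intro k
  apply abs_sum_le_mul
  intro l
  have b1 : |dirD u (dirD u (G k l)) y * (dirD (e k) v y * dirD (e l) v y)| ≤ K * (X * X) := by
    rw [abs_mul, abs_mul]
    exact mul_le_mul (hG'' k l) (mul_le_mul (hp k) (hp l) (abs_nonneg _) hX) (by positivity) hK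
  have hY : 0 ≤ Y := (abs_nonneg _).trans (hh k)
  have b2 : |dirD u (G k l) y * (dirD u (dirD (e k) v) y * dirD (e l) v y
            + dirD (e k) v y * dirD u (dirD (e l) v) y)| ≤ K * (Y * X + X * Y) := by
    rw [abs_mul]
    refine mul_le_mul (hG' k l) ((abs_add_le _ _).trans (add_le_add ?_ ?_)) (abs_nonneg _) hK <;>
      rw [abs_mul]
    · exact mul_le_mul (hh k) (hp l) (abs_nonneg _) hY
    · exact mul_le_mul (hp k) (hh l) (abs_nonneg _) hX
  refine (abs_add_le _ _).trans ?_
  rw [abs_mul 2, abs_two]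
  linarith

set_option maxHeartbeats 1000000 in
/-- Gradient estimate at a maximum point of `(|∇v|² η)² / (L - v)`, in a constant frame which is
orthonormal and diagonalizes the matrix of `𝒲[v]` at that point. -/
theorem frame_estimate (V : Type*) [NormedAddCommGroup V] [NormedSpace ℝ V] {m : ℕ}
    (hm : m + 2 ≤ n) {K φ₀ b₀ ν : ℝ} (hK : 0 ≤ K) (hφ₀ : 0 < φ₀)
    (hb₀ : 0 < b₀) (hν : 0 < ν) :
    ∃ C : ℝ, ∀ (e : Fin n → V) (G : Fin n → Fin n → V → ℝ) (Λ : Fin n → Fin n → Fin n → V → ℝ)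
      (ρ : Fin n → Fin n → V → ℝ) (v β b η : V → ℝ) (y : V) (A : V → Matrix (Fin n) (Fin n) ℝ)
      (lam : Fin n → ℝ) (L : ℝ),
      (∀ k l, ContDiffAt ℝ 2 (G k l) y) → ContDiffAt ℝ 3 v y →
      (∀ k i j, DifferentiableAt ℝ (Λ k i j) y) → (∀ i j, DifferentiableAt ℝ (ρ i j) y) →
      DifferentiableAt ℝ β y → DifferentiableAt ℝ b y → ContDiffAt ℝ 2 η y →
      (∀ k l, G k l y = if k = l then 1 else 0) →
      (∀ c k l, |dirD (e c) (G k l) y| ≤ K) →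
      (∀ c k l, |dirD (e c) (dirD (e c) (G k l)) y| ≤ K) →
      (∀ k i j, |Λ k i j y| ≤ K) → (∀ c k i j, |dirD (e c) (Λ k i j) y| ≤ K) →
      (∀ i j, |ρ i j y| ≤ K) → (∀ c i j, |dirD (e c) (ρ i j) y| ≤ K) →
      |β y| ≤ K → |b y| ≤ K →
      (∀ c, |dirD (e c) β y| ≤ K * (1 + √(frameNormSq e G v y))) →
      (∀ c, |dirD (e c) b y| ≤ K * (1 + √(frameNormSq e G v y))) →
      b₀ ≤ b y → v y < L → φ₀ ≤ 1 / (2 * (L - v y)) → 1 / (2 * (L - v y)) ≤ 1 →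
      0 < η y → η y ≤ 1 → (∀ c, dirD (e c) η y ^ 2 ≤ K * η y) →
      (∀ c, |dirD (e c) (dirD (e c) η) y| ≤ K) →
      (∀ᶠ z in 𝓝 y, ∀ i j, A z i j = frameW e G Λ ρ ν v i j z) →
      A y = Matrix.diagonal lam → (∀ j, 1 ≤ j → j ≤ m + 1 → 0 < esym lam j) →
      (∀ᶠ z in 𝓝 y, coeffSigma (m + 2) (A z) + β z * coeffSigma (m + 1) (A z) = b z) →
      IsLocalMax (fun z => (frameNormSq e G v z * η z) ^ 2 / (L - v z)) y →
      1 ≤ frameNormSq e G v y →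
      η y * frameNormSq e G v y ≤ C := by
  obtain ⟨c₀, hc₀, hell⟩ := ellipticity (n := n) hm hb₀
  -- One constant for all four error estimates below: remainder of the matrix, data of the equation,
  -- derivatives of w, and Euler's identity with its lower order terms.
  set C₁ : ℝ := K * (2 * n + ν * n ^ 2 + 1) + 2 * (K / c₀) + 4 * (n * (n * K))
    + (n * K / c₀ + K * (n + 1)) with hC₁
  have hC₁0 : 0 ≤ C₁ := by positivity
  set C₂ : ℝ := (2 * n * C₁ + (1 + n * ν) * C₁) ^ 2 / (8 * ν) + 2 * (n + 1) + 2 * (1 + n * ν)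
    + 3 * C₁ + 2 * n * C₁ + (1 + n * ν) * C₁ + (1 + n * ν) with hC₂
  have hC₂0 : 0 ≤ C₂ := by positivity
  refine ⟨(C₂ * (1 + √(2 * K)) / (φ₀ ^ 2 * ν)) ^ 2 + 2 * (C₂ * (2 * (2 * K)) / (φ₀ ^ 2 * ν)), ?_⟩
  intro e G Λ ρ v β b η y A lam L hG hv hΛ hρ hβ hb hη hG1 bG bG2 bΛ bΛ' bρ bρ' bβ bb bβ' bb' hb0
    hvL hφ hφ1 hη0 hη1 bη bη2 hA hAd hlam heq hmax hw1
  set w := frameNormSq e G v with hw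
  set X := √(w y) with hX
  have hX2 : X ^ 2 = w y := Real.sq_sqrt (by linarith)
  have hX1 : 1 ≤ X := by rw [hX]; exact Real.one_le_sqrt.mpr hw1
  have hX0 : 0 ≤ X := by linarith
  set h : Fin n → Fin n → ℝ := fun i j => dirD (e i) (dirD (e j) v) y with hh
  set p : Fin n → ℝ := fun i => dirD (e i) v y with hp
  set Y := √(∑ i, ∑ j, h i j ^ 2) with hY
  have hS0 : 0 ≤ ∑ i, ∑ j, h i j ^ 2 := sum_nonneg fun i _ => sum_nonneg fun j _ => sq_nonneg _
  have hY2 : ∑ i, ∑ j, h i j ^ 2 = Y ^ 2 := (Real.sq_sqrt hS0).symm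
  have hY0 : 0 ≤ Y := Real.sqrt_nonneg _
  have hsum : ∑ i, p i ^ 2 = X ^ 2 := by rw [hX2, hw, frameNormSq_eq hG1]
  have hpX : ∀ i, |p i| ≤ X := by
    intro i
    apply abs_le_of_sq_le_sq _ hX0
    rw [← hsum]
    exact single_le_sum (f := fun i => p i ^ 2) (fun i _ => sq_nonneg _) (mem_univ i)
  have hhY : ∀ i j, |h i j| ≤ Y := by
    intro i j
    apply abs_le_of_sq_le_sq _ hY0
    rw [← hY2]
    exact (single_le_sum (f := fun j => h i j ^ 2) (fun i _ => sq_nonneg _) (mem_univ j)).trans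
      (single_le_sum (f := fun i => ∑ j, h i j ^ 2)
        (fun i _ => sum_nonneg fun j _ => sq_nonneg _) (mem_univ i))
  have hhs : ∀ i j, h i j = h j i := fun i j => dirD_comm (hv.of_le (by norm_num))
  have hpd : ∀ k, DifferentiableAt ℝ (dirD (e k) v) y := fun k =>
    (contDiffAt_dirD (m := 2) hv (by norm_num)).differentiableAt (by norm_num)
  have hGd : ∀ k l, DifferentiableAt ℝ (G k l) y := fun k l =>
    (hG k l).differentiableAt (by norm_num)
  have heqy := heq.self_of_nhds
  rw [hAd, coeffSigma_diagonal _ (by omega), coeffSigma_diagonal _ (by omega)] at heqy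
  obtain ⟨hf, hT, hfl⟩ := hell lam (β y) (b y) hb0 hlam heqy
  set f : Fin n → ℝ := fun i => esymErase lam i (m + 1) + β y * esymErase lam i m with hfdef
  set s := esym lam (m + 1) with hs
  have hs0 : 0 < s := hlam _ (by omega) le_rfl
  set T := ∑ i, f i with hTdef
  have hT' : c₀ * (1 + s) ≤ T := hT
  have hT0 : 0 < T := lt_of_lt_of_le (by positivity) hT'
  -- Here the lower bound on T pays off: σ_{m+1}, which is not bounded a priori, becomes a multiple
  -- of T.
  have hsT : 1 + s ≤ T / c₀ := by rw [le_div_iff₀ hc₀]; linarith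
  set t : Fin n → Fin n → ℝ := fun c i => dirD (e c) (dirD (e i) (dirD (e i) v)) y with ht
  set φ := 1 / (2 * (L - v y)) with hφdef
  have hAev : ∀ i j, (fun z => A z i j) =ᶠ[𝓝 y] frameW e G Λ ρ ν v i j := fun i j => by
    filter_upwards [hA] with z hz using hz i j
  have hdiff : ∀ c, ∑ i, f i * frameWDeriv e G Λ ρ ν v (e c) y i i
      = dirD (e c) b y - dirD (e c) β y * s := fun c =>
    differentiated_equation hm
      (fun i j => (hasDir_frameW (e c) hG hv hΛ hρ i j).congr (hAev i j)) hAd hβ hb heq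
  have hnn : (0 : ℝ) ≤ n := by positivity
  have hXX : X ≤ X ^ 2 := by rw [sq]; exact le_mul_of_one_le_left hX0 hX1
  -- the error bounds
  have H1 : ∀ c, |∑ i, (f i + ν * T) * t c i - 2 * ∑ i, f i * (h c i * p i) + T * dirD (e c) w y|
      ≤ T * (C₁ * (Y + X ^ 2)) := by
    intro c
    have e1 : ∑ i, (f i + ν * T) * t c i - 2 * ∑ i, f i * (h c i * p i) + T * dirD (e c) w y
        = (dirD (e c) b y - dirD (e c) β y * s) - ∑ i, f i * frameWRem e G Λ ρ ν v (e c) y i := by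
      rw [← hdiff c]
      have e2 : ∀ i, f i * frameWDeriv e G Λ ρ ν v (e c) y i i
          = f i * t c i + f i * (ν * ∑ k, t c k) - 2 * (f i * (h c i * p i))
            + f i * dirD (e c) w y + f i * frameWRem e G Λ ρ ν v (e c) y i := by
        intro i
        rw [frameWDeriv_diag hG1]; ring
      simp only [e2, sum_add_distrib, sum_sub_distrib, add_mul, ← sum_mul, ← mul_sum, ← hTdef]
      ring
    rw [e1]
    have r1 := abs_sum_mul_le hf (abs_frameWRem_le (ρ := ρ) hν.le hK hX1 hY0 hpX hhY (hhY c)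
      (bG c) bΛ (bΛ' c) (bρ' c))
    have r2 : |dirD (e c) b y - dirD (e c) β y * s| ≤ K * (1 + X) * (1 + s) := by
      refine (abs_sub _ _).trans ?_
      rw [abs_mul, abs_of_pos hs0]
      linarith [bb' c, mul_le_mul_of_nonneg_right (bβ' c) hs0.le]
    have r3 : K * (1 + X) * (1 + s) ≤ K * (1 + X) * (T / c₀) :=
      mul_le_mul_of_nonneg_left hsT (by positivity)
    have r4 : K * (1 + X) * (T / c₀) ≤ T * (2 * (K / c₀) * (Y + X ^ 2)) := by
      have : K * (1 + X) * (T / c₀) = T * ((K / c₀) * (1 + X)) := by ring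
      rw [this]
      refine mul_le_mul_of_nonneg_left ?_ hT0.le
      have : K / c₀ * (1 + X) ≤ K / c₀ * (2 * (Y + X ^ 2)) :=
        mul_le_mul_of_nonneg_left (by linarith) (by positivity)
      linarith
    refine (abs_sub _ _).trans ?_
    have r5 : 0 ≤ T * ((4 * (n * (n * K)) + (n * K / c₀ + K * (n + 1))) * (Y + X ^ 2)) := by
      positivity
    calc _ ≤ T * (2 * (K / c₀) * (Y + X ^ 2))
          + T * (K * (2 * n + ν * n ^ 2 + 1) * (Y + X ^ 2)) := by linarith
      _ ≤ _ := by rw [hC₁]; linarith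
  have H2 : ∀ c, |dirD (e c) w y - 2 * ∑ l, h c l * p l| ≤ C₁ * X ^ 2 := by
    intro c
    refine (abs_dirD_frameNormSq_sub_le hK hX0 (e c) hGd hpd hG1 hpX (bG c)).trans ?_
    have : (n : ℝ) * (n * (K * X ^ 2)) = n * (n * K) * X ^ 2 := by ring
    rw [this]
    refine mul_le_mul_of_nonneg_right ?_ (sq_nonneg X)
    have h1 : 0 ≤ K * (2 * n + ν * n ^ 2 + 1) + 2 * (K / c₀) + 3 * (n * (n * K))
      + (n * K / c₀ + K * (n + 1)) := by positivity
    rw [hC₁]; linarith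
  have H3 : ∀ a, |dirD (e a) (dirD (e a) w) y - 2 * ∑ k, h a k ^ 2 - 2 * ∑ k, p k * t k a|
      ≤ C₁ * (X * Y + X ^ 2) := by
    intro a
    refine (abs_dirD_dirD_frameNormSq_sub_le hK hX0 (e a) hG hv hG1 hpX (hhY a) (bG a)
      (bG2 a)).trans ?_
    have h1 : 0 ≤ (K * (2 * n + ν * n ^ 2 + 1) + 2 * (K / c₀)
      + (n * K / c₀ + K * (n + 1))) * (X * Y + X ^ 2) := by positivity
    have h2 : 0 ≤ n * (n * K) * X ^ 2 := by positivity
    rw [hC₁]; linarith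
  have H4 : |∑ i, (f i + ν * T) * h i i - ∑ i, f i * p i ^ 2 + T * X ^ 2| ≤ T * (C₁ * X) := by
    have e1 : ∀ i, lam i = h i i - p i ^ 2 + ν * ∑ k, h k k + X ^ 2
        + ((∑ k, Λ k i i y * p k) + ρ i i y) := by
      intro i
      have h1 : lam i = A y i i := by rw [hAd, Matrix.diagonal_apply_eq]
      have h2 := hA.self_of_nhds i i
      rw [h1, h2, frameW, hX2]
      simp only [hG1, ite_mul, one_mul, zero_mul, sum_ite_eq, mem_univ, if_true]
      simp only [hh, hp]; ring
    have e2 : ∑ i, (f i + ν * T) * h i i - ∑ i, f i * p i ^ 2 + T * X ^ 2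
        = ∑ i, f i * lam i - ∑ i, f i * ((∑ k, Λ k i i y * p k) + ρ i i y) := by
      have e3 : ∀ i, f i * lam i = f i * h i i - f i * p i ^ 2 + f i * (ν * ∑ k, h k k)
          + f i * X ^ 2 + f i * ((∑ k, Λ k i i y * p k) + ρ i i y) := by
        intro i; rw [e1 i]; ring
      simp only [e3, sum_add_distrib, sum_sub_distrib, add_mul, ← sum_mul, ← mul_sum, ← hTdef]
      ring
    rw [e2]
    have r1 : |∑ i, f i * ((∑ k, Λ k i i y * p k) + ρ i i y)| ≤ T * (n * (K * X) + K) := by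
      refine abs_sum_mul_le hf fun i => (abs_add_le _ _).trans (add_le_add ?_ (bρ i i))
      apply abs_sum_le_mul
      intro k
      rw [abs_mul]
      exact mul_le_mul (bΛ k i i) (hpX k) (abs_nonneg _) hK
    -- Euler's identity gives ∑ f_i λ_i = (m + 2)b − βσ_{m+1}, so the individual eigenvalues need no
    -- bound.
    have r2 : |∑ i, f i * lam i| ≤ n * K / c₀ * T := by
      rw [hfl]
      refine (abs_sub _ _).trans ?_
      rw [abs_mul, abs_mul, abs_of_pos hs0, abs_of_nonneg (by positivity : (0 : ℝ) ≤ m + 2)]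
      have hmn : (m : ℝ) + 2 ≤ n := by exact_mod_cast hm
      have h1 : ((m : ℝ) + 2) * |b y| ≤ n * K := mul_le_mul hmn bb (abs_nonneg _) hnn
      have h2 : |β y| * s ≤ n * K * s := by
        refine mul_le_mul_of_nonneg_right (bβ.trans ?_) hs0.le
        have : (1 : ℝ) ≤ n := by
          have : (0 : ℝ) ≤ m := by positivity
          linarith
        exact le_mul_of_one_le_left hK this
      have h3 : n * K * (1 + s) ≤ n * K * (T / c₀) := mul_le_mul_of_nonneg_left hsT (by positivity)
      calc _ ≤ n * K * (1 + s) := by linarith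
        _ ≤ _ := h3
        _ = _ := by ring
    refine (abs_sub _ _).trans ((add_le_add r2 r1).trans ?_)
    have r3 : 0 ≤ (K * (2 * n + ν * n ^ 2 + 1) + 2 * (K / c₀) + 4 * (n * (n * K))) * X := by
      positivity
    have r4 : n * K / c₀ + (n * (K * X) + K) ≤ (n * K / c₀ + K * (n + 1)) * X := by
      have a1 : n * K / c₀ ≤ n * K / c₀ * X := le_mul_of_one_le_right (by positivity) hX1
      have a2 : K ≤ K * X := le_mul_of_one_le_right hK hX1
      linarith
    calc n * K / c₀ * T + T * (n * (K * X) + K) = T * (n * K / c₀ + (n * (K * X) + K)) := by ring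
      _ ≤ T * (C₁ * X) := mul_le_mul_of_nonneg_left (by rw [hC₁]; linarith) hT0.le
  -- the conditions at the maximum point
  have hw2 : ContDiffAt ℝ 2 w y := contDiffAt_frameNormSq hG hv
  have hwy : 0 < w y := by linarith
  have hlog := log_test hw2 (hv.of_le (by norm_num)) hη hwy hη0 hvL hmax
  set δ : Fin n → ℝ := fun a => dirD (e a) η y / η y with hδ
  have H5 : ∀ a, dirD (e a) w y = -X ^ 2 * (φ * p a + δ a) := by
    intro a
    have := (hlog (e a)).1
    have h2 : dirD (e a) w y / w y = -(φ * p a + δ a) := by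
      simp only [hφdef, hp, hδ]; linarith
    rw [div_eq_iff hwy.ne'] at h2
    rw [h2, hX2]; ring
  have H6 : ∀ a, dirD (e a) (dirD (e a) w) y / X ^ 2 - (φ * p a + δ a) ^ 2 + φ * h a a
      + 2 * φ ^ 2 * p a ^ 2 + (dirD (e a) (dirD (e a) η) y / η y - δ a ^ 2) ≤ 0 := by
    intro a
    have h1 := (hlog (e a)).2
    have h2 : dirD (e a) w y / w y = -(φ * p a + δ a) := by
      have := (hlog (e a)).1
      simp only [hφdef, hp, hδ]; linarith
    rw [h2] at h1
    rw [hX2]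
    have h3 : (-(φ * p a + δ a)) ^ 2 = (φ * p a + δ a) ^ 2 := by ring
    rw [h3] at h1
    exact h1
  have hδ2 : ∀ a, δ a ^ 2 ≤ K / η y := by
    intro a
    rw [hδ]
    simp only
    rw [div_pow, div_le_div_iff₀ (by positivity) hη0]
    calc dirD (e a) η y ^ 2 * η y ≤ K * η y * η y := mul_le_mul_of_nonneg_right (bη a) hη0.le
      _ = K * η y ^ 2 := by ring
  -- D bounds |∂η|/η by means of (∂η)² ≤ Kη, and D₂ bounds ∂²η/η − (∂η/η)².
  have hcore := gradient_core (f := f) (p := p) (w₁ := fun c => dirD (e c) w y)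
    (w₂ := fun a => dirD (e a) (dirD (e a) w) y) (Q := fun c => ∑ i, (f i + ν * T) * t c i)
    (δ := δ) (e := fun a => dirD (e a) (dirD (e a) η) y / η y - δ a ^ 2) (h := h) (t := t)
    (D := √(K / η y)) (D₂ := 2 * K / η y)
    hν hC₁0 hφ₀ hφ hφ1 hX1 (Real.sqrt_nonneg _) (by positivity) hf hTdef hT0 hsum hhs hY2
    (fun a => Real.abs_le_sqrt (hδ2 a))
    (fun a => by
      refine (abs_sub _ _).trans ?_
      rw [abs_div, abs_of_pos hη0, abs_of_nonneg (sq_nonneg (δ a))]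
      have h1 := div_le_div_of_nonneg_right (bη2 a) hη0.le
      have h2 := hδ2 a
      calc _ ≤ K / η y + K / η y := add_le_add h1 h2
        _ = _ := by ring)
    (fun c => rfl) H1 H2 H3 H4 H5 H6
  rw [← hX2]
  refine cutoff_bound (D := √(K / η y)) (D₂ := 2 * K / η y) (by positivity) hC₂0 hη0 hη1 hX0
    ?_ ?_ hcore
  · rw [Real.sq_sqrt (by positivity), div_mul_cancel₀ _ hη0.ne']; linarith
  · rw [div_mul_cancel₀ _ hη0.ne']

end FrameEstimate


/-! ### The gradient estimate at a maximum point, in coordinates -/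

section Coordinates

open Finset Filter Topology

variable {n : ℕ} {V : Type*} [NormedAddCommGroup V] [NormedSpace ℝ V]

/-- Linear combinations of the vectors `e` with coefficients given by the columns of `E`. -/
def changeFrame (e : Fin n → V) (E : Matrix (Fin n) (Fin n) ℝ) (a : Fin n) : V :=
  ∑ i, E i a • e i

variable {e : Fin n → V} {E F : Matrix (Fin n) (Fin n) ℝ} {f v : V → ℝ} {y : V}

theorem dirD_changeFrame (a : Fin n) (f : V → ℝ) (z : V) :
    dirD (changeFrame e E a) f z = ∑ i, E i a * dirD (e i) f z := by
  simp [dirD, changeFrame, map_sum]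

theorem dirD_dirD_changeFrame (a b : Fin n) (hf : ContDiffAt ℝ 2 f y) :
    dirD (changeFrame e E a) (dirD (changeFrame e E b) f) y
      = ∑ i, ∑ j, E i a * E j b * dirD (e i) (dirD (e j) f) y := by
  rw [dirD_changeFrame]
  refine sum_congr rfl fun i _ => ?_
  have h : dirD (changeFrame e E b) f = fun z => ∑ j, E j b * dirD (e j) f z :=
    funext fun z => dirD_changeFrame b f z
  rw [h, (HasDir.sum fun j _ => (HasDir.const (E j b)).mul (hasDir_dirD
    ((contDiffAt_dirD (m := 1) hf (by norm_num)).differentiableAt (by norm_num)))).2, mul_sum]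
  refine sum_congr rfl fun j _ => ?_
  ring

theorem abs_dirD_changeFrame_le {K B : ℝ} (hK : 0 ≤ K) (hE : ∀ i j, |E i j| ≤ K) (a : Fin n)
    (h : ∀ i, |dirD (e i) f y| ≤ B) : |dirD (changeFrame e E a) f y| ≤ n * (K * B) := by
  rw [dirD_changeFrame]
  apply abs_sum_le_mul
  intro i
  rw [abs_mul]
  exact mul_le_mul (hE i a) (h i) (abs_nonneg _) hK

theorem abs_dirD_dirD_changeFrame_le {K B : ℝ} (hK : 0 ≤ K) (hE : ∀ i j, |E i j| ≤ K)
    (a b : Fin n) (hf : ContDiffAt ℝ 2 f y) (h : ∀ i j, |dirD (e i) (dirD (e j) f) y| ≤ B) :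
    |dirD (changeFrame e E a) (dirD (changeFrame e E b) f) y| ≤ n * (n * (K * K * B)) := by
  rw [dirD_dirD_changeFrame a b hf]
  apply abs_sum_le_mul
  intro i
  apply abs_sum_le_mul
  intro j
  rw [abs_mul, abs_mul]
  exact mul_le_mul (mul_le_mul (hE i a) (hE j b) (abs_nonneg _) hK) (h i j) (abs_nonneg _)
    (by positivity)

section LinComb

variable {ι : Type*} [Fintype ι] {c : ι → ℝ} {φ : ι → V → ℝ}

theorem contDiffAt_linComb {k : WithTop ℕ∞} (c : ι → ℝ) (h : ∀ x, ContDiffAt ℝ k (φ x) y) :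
    ContDiffAt ℝ k (fun z => ∑ x, c x * φ x z) y :=
  ContDiffAt.sum fun x _ => contDiffAt_const.mul (h x)

theorem abs_linComb_le {Cc B : ℝ} {a : ι → ℝ} (hc : ∀ x, |c x| ≤ Cc) (hCc : 0 ≤ Cc)
    (ha : ∀ x, |a x| ≤ B) : |∑ x, c x * a x| ≤ Fintype.card ι * (Cc * B) := by
  refine (abs_sum_le_sum_abs _ _).trans ?_
  refine (sum_le_sum fun x _ => (?_ : _ ≤ Cc * B)).trans ?_
  · rw [abs_mul]; exact mul_le_mul (hc x) (ha x) (abs_nonneg _) hCc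
  · simp

theorem dirD_linComb (u : V) (c : ι → ℝ) (h : ∀ x, DifferentiableAt ℝ (φ x) y) :
    dirD u (fun z => ∑ x, c x * φ x z) y = ∑ x, c x * dirD u (φ x) y := by
  rw [(HasDir.sum fun x _ => (HasDir.const (c x)).mul (hasDir_dirD (h x))).2]
  simp

theorem dirD_dirD_linComb (u : V) (c : ι → ℝ) (h : ∀ x, ContDiffAt ℝ 2 (φ x) y) :
    dirD u (dirD u (fun z => ∑ x, c x * φ x z)) y = ∑ x, c x * dirD u (dirD u (φ x)) y := by
  have h1 : dirD u (fun z => ∑ x, c x * φ x z) =ᶠ[𝓝 y] fun z => ∑ x, c x * dirD u (φ x) z := by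
    have : ∀ᶠ z in 𝓝 y, ∀ x, DifferentiableAt ℝ (φ x) z := by
      rw [eventually_all]
      intro x
      filter_upwards [(h x).eventually (by simp)] with z hz using
        hz.differentiableAt (by norm_num)
    filter_upwards [this] with z hz using dirD_linComb u c hz
  rw [dirD_congr h1]
  exact dirD_linComb u c fun x =>
    (contDiffAt_dirD (m := 1) (h x) (by norm_num)).differentiableAt (by norm_num)

end LinComb

/-- The coefficients of the inverse metric in the new frame. -/
def changeG (F : Matrix (Fin n) (Fin n) ℝ) (G : Fin n → Fin n → V → ℝ) (a b : Fin n) (z : V) : ℝ :=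
  ∑ x : Fin n × Fin n, (F a x.1 * F b x.2) * G x.1 x.2 z

/-- The zeroth order coefficients in the new frame. -/
def changeρ (E F : Matrix (Fin n) (Fin n) ℝ) (ρ : Fin n → Fin n → V → ℝ) (a b : Fin n) (z : V) :
    ℝ :=
  ∑ x : Fin n × Fin n, (F a x.1 * E x.2 b) * ρ x.1 x.2 z

/-- The first order coefficients in the new frame. -/
def changeΛ (E F : Matrix (Fin n) (Fin n) ℝ) (Λ : Fin n → Fin n → Fin n → V → ℝ) (c a b : Fin n)
    (z : V) : ℝ :=
  ∑ x : Fin n × Fin n × Fin n, (F c x.1 * F a x.2.1 * E x.2.2 b) * Λ x.1 x.2.1 x.2.2 z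

theorem dirD_changeG (u : V) {G : Fin n → Fin n → V → ℝ} (k l : Fin n)
    (h : ∀ i j, DifferentiableAt ℝ (G i j) y) :
    dirD u (changeG F G k l) y
      = ∑ x : Fin n × Fin n, (F k x.1 * F l x.2) * dirD u (G x.1 x.2) y :=
  dirD_linComb (φ := fun x : Fin n × Fin n => G x.1 x.2) u _ fun x => h x.1 x.2

theorem dirD_dirD_changeG (u : V) {G : Fin n → Fin n → V → ℝ} (k l : Fin n)
    (h : ∀ i j, ContDiffAt ℝ 2 (G i j) y) :
    dirD u (dirD u (changeG F G k l)) y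
      = ∑ x : Fin n × Fin n, (F k x.1 * F l x.2) * dirD u (dirD u (G x.1 x.2)) y :=
  dirD_dirD_linComb (φ := fun x : Fin n × Fin n => G x.1 x.2) u _ fun x => h x.1 x.2

theorem dirD_changeρ (u : V) {ρ : Fin n → Fin n → V → ℝ} (k l : Fin n)
    (h : ∀ i j, DifferentiableAt ℝ (ρ i j) y) :
    dirD u (changeρ E F ρ k l) y
      = ∑ x : Fin n × Fin n, (F k x.1 * E x.2 l) * dirD u (ρ x.1 x.2) y :=
  dirD_linComb (φ := fun x : Fin n × Fin n => ρ x.1 x.2) u _ fun x => h x.1 x.2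

theorem dirD_changeΛ (u : V) {Λ : Fin n → Fin n → Fin n → V → ℝ} (c k l : Fin n)
    (h : ∀ m i j, DifferentiableAt ℝ (Λ m i j) y) :
    dirD u (changeΛ E F Λ c k l) y = ∑ x : Fin n × Fin n × Fin n,
      (F c x.1 * F k x.2.1 * E x.2.2 l) * dirD u (Λ x.1 x.2.1 x.2.2) y :=
  dirD_linComb (φ := fun x : Fin n × Fin n × Fin n => Λ x.1 x.2.1 x.2.2) u _
    fun x => h x.1 x.2.1 x.2.2

omit [NormedAddCommGroup V] [NormedSpace ℝ V] in
theorem changeG_eq (G : Fin n → Fin n → V → ℝ) (z : V) :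
    Matrix.of (fun a b => changeG F G a b z) = F * Matrix.of (fun i j => G i j z) * F.transpose := by
  ext a b
  simp only [Matrix.of_apply, changeG, Matrix.mul_apply, Fintype.sum_prod_type, sum_mul,
    Matrix.transpose_apply]
  rw [sum_comm]
  exact sum_congr rfl fun i _ => sum_congr rfl fun j _ => by ring

omit [NormedAddCommGroup V] [NormedSpace ℝ V] in
theorem changeρ_eq (ρ : Fin n → Fin n → V → ℝ) (z : V) :
    Matrix.of (fun a b => changeρ E F ρ a b z) = F * Matrix.of (fun i j => ρ i j z) * E := by
  ext a b
  simp only [Matrix.of_apply, changeρ, Matrix.mul_apply, Fintype.sum_prod_type, sum_mul]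
  rw [sum_comm]
  exact sum_congr rfl fun i _ => sum_congr rfl fun j _ => by ring

omit [NormedAddCommGroup V] [NormedSpace ℝ V] in
theorem changeΛ_eq (Λ : Fin n → Fin n → Fin n → V → ℝ) (c : Fin n) (z : V) :
    Matrix.of (fun a b => changeΛ E F Λ c a b z)
      = ∑ m, F c m • (F * Matrix.of (fun i j => Λ m i j z) * E) := by
  ext a b
  simp only [Matrix.of_apply, changeΛ, Matrix.sum_apply, Matrix.smul_apply, Matrix.mul_apply,
    Fintype.sum_prod_type, sum_mul, smul_eq_mul, mul_sum]
  refine sum_congr rfl fun m _ => ?_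
  rw [sum_comm]
  exact sum_congr rfl fun i _ => sum_congr rfl fun j _ => by ring

/-- The Hessian matrix in the frame `e`. -/
noncomputable def frameHess (e : Fin n → V) (v : V → ℝ) (z : V) : Matrix (Fin n) (Fin n) ℝ :=
  Matrix.of fun i j => dirD (e i) (dirD (e j) v) z

theorem frameHess_changeFrame (hv : ContDiffAt ℝ 2 v y) :
    frameHess (changeFrame e E) v y = E.transpose * frameHess e v y * E := by
  ext a b
  simp only [frameHess, Matrix.of_apply, dirD_dirD_changeFrame a b hv, Matrix.mul_apply, sum_mul,
    Matrix.transpose_apply]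
  rw [sum_comm]
  exact sum_congr rfl fun i _ => sum_congr rfl fun j _ => by ring

theorem dirD_changeFrame_eq_mulVec (z : V) :
    (fun a => dirD (changeFrame e E a) v z) = E.transpose.mulVec fun i => dirD (e i) v z := by
  ext a
  rw [dirD_changeFrame]; rfl

theorem frameNormSq_eq_dotProduct (G : Fin n → Fin n → V → ℝ) (z : V) :
    frameNormSq e G v z = (fun i => dirD (e i) v z) ⬝ᵥ
      (Matrix.of (fun i j => G i j z)).mulVec fun i => dirD (e i) v z := by
  simp only [frameNormSq, dotProduct, Matrix.mulVec, Matrix.of_apply, mul_sum]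
  exact sum_congr rfl fun i _ => sum_congr rfl fun j _ => by ring

/-- The differential transforms by Eᵀ and the inverse metric by F on both sides; the factors cancel
because FᵀEᵀ = 1. -/
theorem frameNormSq_changeFrame (hEF : E * F = 1) (G : Fin n → Fin n → V → ℝ) (z : V) :
    frameNormSq (changeFrame e E) (changeG F G) v z = frameNormSq e G v z := by
  have h : F.transpose * E.transpose = 1 := by rw [← Matrix.transpose_mul, hEF, Matrix.transpose_one]
  rw [frameNormSq_eq_dotProduct, frameNormSq_eq_dotProduct, changeG_eq, dirD_changeFrame_eq_mulVec,
    ← Matrix.mulVec_mulVec, ← Matrix.mulVec_mulVec, Matrix.mulVec_mulVec (M := F.transpose), h,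
    Matrix.one_mulVec, Matrix.dotProduct_mulVec, Matrix.vecMul_mulVec, Matrix.transpose_transpose,
    hEF, Matrix.vecMul_one]

/-- `frameW` in matrix form. -/
theorem frameW_eq_matrix (G : Fin n → Fin n → V → ℝ) (Λ : Fin n → Fin n → Fin n → V → ℝ)
    (ρ : Fin n → Fin n → V → ℝ) (ν : ℝ) (v : V → ℝ) (z : V) :
    Matrix.of (fun i j => frameW e G Λ ρ ν v i j z)
      = Matrix.of (fun i j => G i j z) * (frameHess e v z
          - Matrix.vecMulVec (fun i => dirD (e i) v z) fun i => dirD (e i) v z)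
        + (ν * ((Matrix.of fun i j => G i j z).transpose * frameHess e v z).trace
          + frameNormSq e G v z) • (1 : Matrix (Fin n) (Fin n) ℝ)
        + (∑ m, dirD (e m) v z • Matrix.of (fun i j => Λ m i j z))
        + Matrix.of (fun i j => ρ i j z) := by
  ext i j
  have ht : ((Matrix.of fun i j => G i j z).transpose * frameHess e v z).trace
      = ∑ k, ∑ l, G k l z * dirD (e k) (dirD (e l) v) z := by
    simp only [Matrix.trace, Matrix.diag, Matrix.mul_apply, Matrix.transpose_apply,
      Matrix.of_apply, frameHess]
    rw [sum_comm]
  rw [ht]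
  simp only [frameW, Matrix.of_apply, Matrix.add_apply, Matrix.mul_apply, Matrix.sub_apply,
    frameHess, Matrix.vecMulVec_apply, Matrix.smul_apply, Matrix.one_apply, Matrix.sum_apply,
    smul_eq_mul]
  rw [add_assoc (_ + _), mul_comm (ite _ _ _)]
  congr 2
  exact sum_congr rfl fun m _ => mul_comm _ _

/-- A constant change of frame creates no derivative of E: the Hessian and dv ⊗ dv transform as
bilinear forms, the trace and the norm are invariant, and Λ, ρ were transformed accordingly. So the
matrix is merely conjugated. -/
theorem frameW_changeFrame (hEF : E * F = 1) (G : Fin n → Fin n → V → ℝ)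
    (Λ : Fin n → Fin n → Fin n → V → ℝ) (ρ : Fin n → Fin n → V → ℝ) (ν : ℝ)
    (hv : ContDiffAt ℝ 2 v y) :
    Matrix.of (fun i j => frameW (changeFrame e E) (changeG F G) (changeΛ E F Λ) (changeρ E F ρ)
        ν v i j y)
      = F * Matrix.of (fun i j => frameW e G Λ ρ ν v i j y) * E := by
  have hFE : F * E = 1 := mul_eq_one_comm.mp hEF
  have h : F.transpose * E.transpose = 1 := by
    rw [← Matrix.transpose_mul, hEF, Matrix.transpose_one]
  rw [frameW_eq_matrix, frameW_eq_matrix, changeG_eq, frameHess_changeFrame hv,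
    frameNormSq_changeFrame hEF, changeρ_eq]
  set G₀ := Matrix.of (fun i j => G i j y)
  set H := frameHess e v y
  have hvec : Matrix.vecMulVec (fun i => dirD (changeFrame e E i) v y)
      (fun i => dirD (changeFrame e E i) v y)
      = E.transpose * Matrix.vecMulVec (fun i => dirD (e i) v y) (fun i => dirD (e i) v y) * E := by
    rw [dirD_changeFrame_eq_mulVec, Matrix.mul_vecMulVec, Matrix.vecMulVec_mul,
      Matrix.mulVec_transpose]
  rw [hvec]
  set W := Matrix.vecMulVec (fun i => dirD (e i) v y) (fun i => dirD (e i) v y)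
  have h1 : F * G₀ * F.transpose * (E.transpose * H * E - E.transpose * W * E)
      = F * (G₀ * (H - W)) * E := by
    calc _ = F * G₀ * (F.transpose * E.transpose) * (H - W) * E := by noncomm_ring
      _ = _ := by rw [h]; noncomm_ring
  have h2 : ((F * G₀ * F.transpose).transpose * (E.transpose * H * E)).trace
      = (G₀.transpose * H).trace := by
    rw [Matrix.transpose_mul, Matrix.transpose_mul, Matrix.transpose_transpose]
    calc _ = (F * (G₀.transpose * (F.transpose * E.transpose) * H * E)).trace := by
          congr 1; noncomm_ring
      _ = (G₀.transpose * H * (E * F)).trace := by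
          rw [h, Matrix.trace_mul_comm, Matrix.mul_one]
          congr 1; noncomm_ring
      _ = _ := by rw [hEF, Matrix.mul_one]
  have h3 : ∑ c, dirD (changeFrame e E c) v y • Matrix.of (fun a b => changeΛ E F Λ c a b y)
      = F * (∑ m, dirD (e m) v y • Matrix.of (fun i j => Λ m i j y)) * E := by
    simp only [changeΛ_eq, smul_sum, smul_smul]
    rw [sum_comm, Matrix.mul_sum, Matrix.sum_mul]
    refine sum_congr rfl fun m _ => ?_
    rw [← sum_smul, Matrix.mul_smul, Matrix.smul_mul]
    congr 1
    have := congrFun (congrArg (fun M : Matrix (Fin n) (Fin n) ℝ =>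
      M.mulVec fun i => dirD (e i) v y) h) m
    simp only [← Matrix.mulVec_mulVec, Matrix.one_mulVec] at this
    rw [← this, ← dirD_changeFrame_eq_mulVec]
    simp only [Matrix.mulVec, dotProduct, Matrix.transpose_apply]
    exact sum_congr rfl fun c _ => mul_comm _ _
  rw [h1, h2, h3]
  simp only [Matrix.mul_add, Matrix.add_mul, Matrix.mul_smul, Matrix.smul_mul, Matrix.mul_one, hFE]

end Coordinates


/-! ### Passing from the diagonalizing frame to arbitrary coordinates. -/

section CoordinateEstimate

open Finset Filter Topology

variable {n : ℕ}

theorem abs_entry_le_of_sum_sq {K : ℝ} (hK : 1 ≤ K) {x : Fin n → ℝ} (h : ∑ a, x a * x a ≤ K)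
    (a : Fin n) : |x a| ≤ K := by
  apply abs_le_of_sq_le_sq _ (by linarith)
  have h1 : x a * x a ≤ ∑ a, x a * x a :=
    single_le_sum (f := fun a => x a * x a) (fun i _ => mul_self_nonneg _) (mem_univ a)
  nlinarith

theorem hasDerivAt_exp_div_pow (c : ℝ) (q : ℕ) (s : ℝ) :
    HasDerivAt (fun s => (Real.exp (2 * s) / c) ^ q) (2 * q * (Real.exp (2 * s) / c) ^ q) s := by
  have h1 : HasDerivAt (fun s => Real.exp (2 * s) / c) (Real.exp (2 * s) * 2 / c) s := by
    have := ((hasDerivAt_id s).const_mul 2).exp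
    simpa using this.div_const c
  have h2 := h1.pow q
  refine h2.congr_deriv ?_
  rcases q with _ | q
  · simp
  · simp only [Nat.add_sub_cancel]; push_cast; ring

theorem exp_div_pow_bounds {c K v : ℝ} (hc : 1 ≤ c) (hv : |v| ≤ K) {q r : ℕ} (hqr : q ≤ r) :
    (Real.exp (2 * v) / c) ^ q ≤ Real.exp (2 * K) ^ r := by
  have h1 : Real.exp (2 * v) / c ≤ Real.exp (2 * K) :=
    (div_le_self (Real.exp_pos _).le hc).trans (Real.exp_le_exp.mpr (by linarith [(abs_le.mp hv).2]))
  have hK : 0 ≤ K := (abs_nonneg _).trans hv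
  calc _ ≤ Real.exp (2 * K) ^ q := pow_le_pow_left₀ (by positivity) h1 q
    _ ≤ _ := pow_le_pow_right₀ (Real.one_le_exp (by positivity)) hqr

theorem abs_dirD_mul_exp_le {V : Type*} [NormedAddCommGroup V] [NormedSpace ℝ V] {c K M X : ℝ}
    (hc : 1 ≤ c) (hX : 0 ≤ X) {α v : V → ℝ} {y u : V} {q r : ℕ} (hqr : q ≤ r)
    (hα : DifferentiableAt ℝ α y) (hv : DifferentiableAt ℝ v y) (hvK : |v y| ≤ K)
    (hM : M = Real.exp (2 * K) ^ r) (hαK : |α y| ≤ K) (hα' : |dirD u α y| ≤ K)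
    (hp : |dirD u v y| ≤ X) :
    |dirD u (fun z => α z * (Real.exp (2 * v z) / c) ^ q) y| ≤ (1 + 2 * r) * (K * M) * (1 + X) := by
  have h := ((hasDir_dirD (u := u) hα).mul
    (HasDir.comp (hasDerivAt_exp_div_pow c q (v y)) (hasDir_dirD (u := u) hv))).2
  rw [h]
  set ε := (Real.exp (2 * v y) / c) ^ q with hε
  have hK : 0 ≤ K := (abs_nonneg _).trans hvK
  have hε0 : 0 ≤ ε := by positivity
  have hεM : ε ≤ M := by rw [hM]; exact exp_div_pow_bounds hc hvK hqr
  have hM0 : 0 ≤ M := hε0.trans hεM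
  have hqr' : (q : ℝ) ≤ r := by exact_mod_cast hqr
  have h1 : |dirD u α y * ε| ≤ K * M := by
    rw [abs_mul, abs_of_nonneg hε0]; exact mul_le_mul hα' hεM hε0 hK
  have h2 : |α y * (2 * q * ε * dirD u v y)| ≤ K * (2 * r * M * X) := by
    rw [abs_mul, abs_mul, abs_of_nonneg (by positivity : 0 ≤ 2 * q * ε)]
    refine mul_le_mul hαK ?_ (by positivity) hK
    refine mul_le_mul ?_ hp (abs_nonneg _) (by positivity)
    exact mul_le_mul (by linarith) hεM hε0 (by positivity)
  refine (abs_add_le _ _).trans ((add_le_add h1 h2).trans ?_)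
  have h3 : 0 ≤ K * M * X := by positivity
  have h4 : 0 ≤ 2 * r * (K * M) := by positivity
  linarith

set_option maxHeartbeats 1000000 in
/-- Gradient estimate at a maximum point of `(|∇v|² η)² / (L - v)`, in coordinates. -/
theorem coordinate_estimate (V : Type*) [NormedAddCommGroup V] [NormedSpace ℝ V] (hn : 3 ≤ n)
    {m : ℕ} (hm : m + 2 ≤ n) {K a₀ : ℝ} (hK : 1 ≤ K) (ha₀ : 0 < a₀) :
    ∃ C : ℝ, ∀ (e : Fin n → V) (g S : V → Matrix (Fin n) (Fin n) ℝ)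
      (Λ : Fin n → Fin n → Fin n → V → ℝ) (ρ : Fin n → Fin n → V → ℝ) (v α α₀ η : V → ℝ) (y : V)
      (G : Fin n → Fin n → V → ℝ), (G = fun i j z => (g z)⁻¹ i j) →
      (∀ᶠ z in 𝓝 y, (g z).PosDef) → (∀ᶠ z in 𝓝 y, (S z).transpose = S z) →
      (∀ k l, ContDiffAt ℝ 2 (G k l) y) → ContDiffAt ℝ 3 v y →
      (∀ k i j, DifferentiableAt ℝ (Λ k i j) y) → (∀ i j, DifferentiableAt ℝ (ρ i j) y) →
      DifferentiableAt ℝ α y → DifferentiableAt ℝ α₀ y → ContDiffAt ℝ 2 η y →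
      (∀ᶠ z in 𝓝 y, (g z)⁻¹ * S z
        = Matrix.of fun i j => frameW e G Λ ρ (1 / ((n : ℝ) - 2)) v i j z) →
      (∀ᶠ z in 𝓝 y,
        sigma (m + 2) ((((n : ℝ) - 2) * Real.exp (-2 * v z)) • ((g z)⁻¹ * S z))
          + α z * sigma (m + 1) ((((n : ℝ) - 2) * Real.exp (-2 * v z)) • ((g z)⁻¹ * S z))
          = α₀ z) →
      eigenvalues ((g y)⁻¹ * S y) ∈ gardingCone (m + 1) →
      (∀ i, g y i i ≤ K) → (∀ i, (g y)⁻¹ i i ≤ K) →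
      (∀ c k l, |dirD (e c) (G k l) y| ≤ K) →
      (∀ c d k l, |dirD (e c) (dirD (e d) (G k l)) y| ≤ K) →
      (∀ k i j, |Λ k i j y| ≤ K) → (∀ c k i j, |dirD (e c) (Λ k i j) y| ≤ K) →
      (∀ i j, |ρ i j y| ≤ K) → (∀ c i j, |dirD (e c) (ρ i j) y| ≤ K) →
      |v y| ≤ K → |α y| ≤ K → |α₀ y| ≤ K →
      frameNormSq e G α y ≤ K ^ 2 → frameNormSq e G α₀ y ≤ K ^ 2 → a₀ ≤ α₀ y →
      0 < η y → η y ≤ 1 → (∀ c, dirD (e c) η y ^ 2 ≤ K * η y) →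
      (∀ c d, |dirD (e c) (dirD (e d) η) y| ≤ K) →
      IsLocalMax (fun z => (frameNormSq e G v z * η z) ^ 2 / (K + 1 - v z)) y →
      1 ≤ frameNormSq e G v y →
      η y * frameNormSq e G v y ≤ C := by
  have hK0 : 0 < K := by linarith
  have hn3 : (3 : ℝ) ≤ n := by exact_mod_cast hn
  set c : ℝ := (n : ℝ) - 2 with hc
  have hc1 : 1 ≤ c := by linarith
  have hc0 : 0 < c := by linarith
  set M := Real.exp (2 * K) ^ (m + 2) with hM
  have hM1 : 1 ≤ M := one_le_pow₀ (Real.one_le_exp (by positivity))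
  -- The first summand dominates every coefficient after the frame change, which costs at most four
  -- sums over n indices and five factors K. The second controls α and α₀ multiplied by powers of
  -- e^{2v}/(n − 2), and their derivatives.
  set K' : ℝ := n ^ 4 * K ^ 5 + (1 + 2 * ((m + 2 : ℕ) : ℝ)) * (K * M) with hK'
  have hK'0 : 0 ≤ K' := by positivity
  -- The right side of the normalized equation is smallest when α₀ = a₀ and v = −K. Below, φ₀ comes
  -- from L − v ≤ 2K + 1 with L = K + 1.
  set b₀ := a₀ * (Real.exp (2 * -K) / c) ^ (m + 2) with hb₀
  obtain ⟨C, hC⟩ := frame_estimate V hm (K := K') (φ₀ := 1 / (2 * (2 * K + 1))) (b₀ := b₀)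
    (ν := 1 / c) hK'0 (by positivity) (by positivity) (by positivity)
  refine ⟨C, ?_⟩
  intro e g S Λ ρ v α α₀ η y G hGdef hg hS hG hv hΛ hρ hα hα₀ hη hW heq hcone bg bgi bG bG2 bΛ bΛ' bρ
    bρ' bv bα bα₀ bα' bα₀' ha hη0 hη1 bη bη2 hmax hw1
  obtain ⟨E, F, lam, hEF, hFE, hE1, hE2⟩ := exists_frame hg.self_of_nhds hS.self_of_nhds
  have hgi := inv_eq_of_frame hEF hE1
  -- Since g⁻¹ = EEᵀ and g = FᵀF, diagonal entries of g⁻¹ and g are sums of squares of entries of E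
  -- and F. Bounds on the metric therefore control the frame uniformly.
  have hEK : ∀ i j, |E i j| ≤ K := by
    intro i j
    refine abs_entry_le_of_sum_sq hK (x := fun a => E i a) ?_ j
    have := bgi i
    rwa [hgi, Matrix.mul_apply] at this
  have hFt : g y = F.transpose * F := by
    have h2 : F.transpose * E.transpose = 1 := by
      rw [← Matrix.transpose_mul, hEF, Matrix.transpose_one]
    calc g y = (F.transpose * E.transpose) * g y * (E * F) := by
          rw [h2, hEF, Matrix.one_mul, Matrix.mul_one]
      _ = F.transpose * (E.transpose * g y * E) * F := by noncomm_ring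
      _ = _ := by rw [hE1, Matrix.mul_one]
  have hFK : ∀ i j, |F i j| ≤ K := by
    intro i j
    refine abs_entry_le_of_sum_sq hK (x := fun a => F a j) ?_ i
    have := bg j
    rwa [hFt, Matrix.mul_apply] at this
  -- equation for the normalized coefficients
  have hlamch := charpoly_inv_mul hEF hE1 hE2
  have heq' : ∀ᶠ z in 𝓝 y, coeffSigma (m + 2) (F * ((g z)⁻¹ * S z) * E)
      + α z * (Real.exp (2 * v z) / c) ^ 1 * coeffSigma (m + 1) (F * ((g z)⁻¹ * S z) * E)
      = α₀ z * (Real.exp (2 * v z) / c) ^ (m + 2) := by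
    filter_upwards [hg, hS, heq] with z hz1 hz2 hz3
    rw [sigma_smul hz1 hz2, sigma_smul hz1 hz2, sigma_eq_coeffSigma hz1 hz2 (by omega),
      sigma_eq_coeffSigma hz1 hz2 (by omega)] at hz3
    rw [coeffSigma_conj hEF, coeffSigma_conj hEF, ← hz3]
    have h1 : c * Real.exp (-2 * v z) * (Real.exp (2 * v z) / c) = 1 := by
      rw [show -2 * v z = -(2 * v z) by ring, Real.exp_neg]
      field_simp
    set κ := c * Real.exp (-2 * v z)
    set ε := Real.exp (2 * v z) / c
    have h2 : κ ^ (m + 2) * ε ^ (m + 2) = 1 := by rw [← mul_pow, h1, one_pow]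
    have h3 : κ ^ (m + 1) * ε ^ (m + 1) = 1 := by rw [← mul_pow, h1, one_pow]
    linear_combination (-coeffSigma (m + 2) ((g z)⁻¹ * S z)) * h2
      - α z * ε * coeffSigma (m + 1) ((g z)⁻¹ * S z) * h3
  have hpos : ∀ j, 1 ≤ j → j ≤ m + 1 → 0 < esym lam j := by
    rw [eigenvalues_of_charpoly_eq hlamch] at hcone
    exact hcone
  -- the frame is orthonormal
  have hG1 : ∀ k l, changeG F G k l y = if k = l then 1 else 0 := by
    intro k l
    have h1 := congrFun (congrFun (changeG_eq (F := F) G y) k) l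
    have h2 : Matrix.of (fun i j => G i j y) = E * E.transpose := by rw [← hgi, hGdef]; rfl
    rw [h2] at h1
    have h3 : F * (E * E.transpose) * F.transpose = 1 := by
      calc _ = (F * E) * (F * E).transpose := by rw [Matrix.transpose_mul]; noncomm_ring
        _ = 1 := by rw [hFE]; simp
    rw [h3] at h1
    exact h1
  have hnorm : ∀ (f : V → ℝ) (z : V),
      frameNormSq (changeFrame e E) (changeG F G) f z = frameNormSq e G f z := fun f z =>
    frameNormSq_changeFrame hEF G z
  have hcomp : ∀ {f : V → ℝ} {B : ℝ}, 0 ≤ B → frameNormSq e G f y ≤ B ^ 2 →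
      ∀ a, |dirD (changeFrame e E a) f y| ≤ B := by
    intro f B hB hf a
    rw [← hnorm, frameNormSq_eq hG1] at hf
    apply abs_le_of_sq_le_sq _ hB
    exact (single_le_sum (f := fun a => dirD (changeFrame e E a) f y ^ 2)
      (fun i _ => sq_nonneg _) (mem_univ a)).trans hf
  have hn1 : (1 : ℝ) ≤ n := by linarith
  have hpow : ∀ {i j : ℕ}, i ≤ 4 → j ≤ 5 → (n : ℝ) ^ i * K ^ j ≤ K' := by
    intro i j hi hj
    have h1 : (n : ℝ) ^ i * K ^ j ≤ n ^ 4 * K ^ 5 :=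
      mul_le_mul (pow_le_pow_right₀ hn1 hi) (pow_le_pow_right₀ hK hj) (by positivity)
        (by positivity)
    have h2 : 0 ≤ (1 + 2 * ((m + 2 : ℕ) : ℝ)) * (K * M) := by positivity
    linarith
  have cFF : ∀ a b, ∀ x : Fin n × Fin n, |F a x.1 * F b x.2| ≤ K * K := fun a b x => by
    rw [abs_mul]; exact mul_le_mul (hFK _ _) (hFK _ _) (abs_nonneg _) hK0.le
  have cFE : ∀ a b, ∀ x : Fin n × Fin n, |F a x.1 * E x.2 b| ≤ K * K := fun a b x => by
    rw [abs_mul]; exact mul_le_mul (hFK _ _) (hEK _ _) (abs_nonneg _) hK0.le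
  have cFFE : ∀ c a b, ∀ x : Fin n × Fin n × Fin n, |F c x.1 * F a x.2.1 * E x.2.2 b| ≤ K * K * K :=
    fun c a b x => by
      rw [abs_mul, abs_mul]
      exact mul_le_mul (mul_le_mul (hFK _ _) (hFK _ _) (abs_nonneg _) hK0.le) (hEK _ _)
        (abs_nonneg _) (by positivity)
  have card2 : (Fintype.card (Fin n × Fin n) : ℝ) = n * n := by simp
  have card3 : (Fintype.card (Fin n × Fin n × Fin n) : ℝ) = n * (n * n) := by simp
  have hKK : 0 ≤ K * K := by positivity
  have hKKK : 0 ≤ K * K * K := by positivity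
  have hvd : DifferentiableAt ℝ v y := hv.differentiableAt (by norm_num)
  have hwX : frameNormSq e G v y = √(frameNormSq e G v y) ^ 2 := (Real.sq_sqrt (by linarith)).symm
  have hpX := hcomp (Real.sqrt_nonneg _) hwX.le
  have hKM : K * M ≤ K' := by
    have h1 : 0 ≤ (n : ℝ) ^ 4 * K ^ 5 := by positivity
    have h2 : 0 ≤ 2 * ((m + 2 : ℕ) : ℝ) * (K * M) := by positivity
    linarith
  have hKM' : (1 + 2 * ((m + 2 : ℕ) : ℝ)) * (K * M) ≤ K' := by
    have h1 : 0 ≤ (n : ℝ) ^ 4 * K ^ 5 := by positivity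
    linarith
  have bval : ∀ {f : V → ℝ} {q : ℕ}, q ≤ m + 2 → |f y| ≤ K →
      |f y * (Real.exp (2 * v y) / c) ^ q| ≤ K' := by
    intro f q hq hf
    rw [abs_mul, abs_of_nonneg (by positivity : 0 ≤ (Real.exp (2 * v y) / c) ^ q)]
    exact (mul_le_mul hf (exp_div_pow_bounds hc1 bv hq) (by positivity) hK0.le).trans hKM
  have bder : ∀ {f : V → ℝ} {q : ℕ}, q ≤ m + 2 → DifferentiableAt ℝ f y → |f y| ≤ K →
      frameNormSq e G f y ≤ K ^ 2 → ∀ a,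
      |dirD (changeFrame e E a) (fun z => f z * (Real.exp (2 * v z) / c) ^ q) y|
        ≤ K' * (1 + √(frameNormSq e G v y)) := by
    intro f q hq hfd hf hf' a
    exact (abs_dirD_mul_exp_le hc1 (Real.sqrt_nonneg _) hq hfd hvd bv hM hf
      (hcomp hK0.le hf' a) (hpX a)).trans
      (mul_le_mul_of_nonneg_right hKM' (by positivity))
  have hexpd : ∀ q : ℕ, DifferentiableAt ℝ (fun z => (Real.exp (2 * v z) / c) ^ q) y := fun q =>
    (HasDir.comp (u := 0) (hasDerivAt_exp_div_pow c q (v y)) (hasDir_dirD hvd)).1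
  have hL : v y < K + 1 := by linarith [(abs_le.mp bv).2]
  have hfinal := hC (changeFrame e E) (changeG F G) (changeΛ E F Λ) (changeρ E F ρ) v
    (fun z => α z * (Real.exp (2 * v z) / c) ^ 1)
    (fun z => α₀ z * (Real.exp (2 * v z) / c) ^ (m + 2)) η y
    (fun z => F * ((g z)⁻¹ * S z) * E) lam (K + 1)
    (fun k l => contDiffAt_linComb _ fun x => hG _ _) hv
    (fun k i j => (HasDir.sum (u := 0) fun x _ => (HasDir.const _).mul
      (hasDir_dirD (hΛ x.1 x.2.1 x.2.2))).1)
    (fun i j => (HasDir.sum (u := 0) fun x _ => (HasDir.const _).mul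
      (hasDir_dirD (hρ x.1 x.2))).1)
    (hα.fun_mul (hexpd 1)) (hα₀.fun_mul (hexpd _)) hη hG1
  rw [hnorm] at hfinal
  have hGd : ∀ i j, DifferentiableAt ℝ (G i j) y := fun i j =>
    (hG i j).differentiableAt (by norm_num)
  refine hfinal ?_ ?_ ?_ ?_ ?_ ?_ (bval (q := 1) (by omega) bα) (bval le_rfl bα₀)
    (bder (q := 1) (by omega) hα bα bα') (bder le_rfl hα₀ bα₀ bα₀') ?_ hL ?_ ?_ hη0 hη1 ?_ ?_ ?_
    (conj_frame hEF hE1 hE2) hpos heq' ?_ hw1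
  · intro a k l
    rw [dirD_changeG _ _ _ hGd]
    refine (abs_linComb_le (cFF k l) hKK fun x =>
      abs_dirD_changeFrame_le hK0.le hEK a fun i => bG i x.1 x.2).trans ?_
    rw [card2]
    exact le_trans (le_of_eq (by ring)) (hpow (i := 3) (j := 4) (by norm_num) (by norm_num))
  · intro a k l
    rw [dirD_dirD_changeG _ _ _ hG]
    refine (abs_linComb_le (cFF k l) hKK fun x =>
      abs_dirD_dirD_changeFrame_le hK0.le hEK a a (hG x.1 x.2)
        fun i j => bG2 i j x.1 x.2).trans ?_
    rw [card2]
    exact le_trans (le_of_eq (by ring)) (hpow (i := 4) (j := 5) (by norm_num) (by norm_num))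
  · intro k i j
    refine (abs_linComb_le (cFFE k i j) hKKK fun x => bΛ x.1 x.2.1 x.2.2).trans ?_
    rw [card3]
    exact le_trans (le_of_eq (by ring)) (hpow (i := 3) (j := 4) (by norm_num) (by norm_num))
  · intro a k i j
    rw [dirD_changeΛ _ _ _ _ hΛ]
    refine (abs_linComb_le (cFFE k i j) hKKK fun x =>
      abs_dirD_changeFrame_le hK0.le hEK a fun i => bΛ' i x.1 x.2.1 x.2.2).trans ?_
    rw [card3]
    exact le_trans (le_of_eq (by ring)) (hpow (i := 4) (j := 5) (by norm_num) (by norm_num))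
  · intro i j
    refine (abs_linComb_le (cFE i j) hKK fun x => bρ x.1 x.2).trans ?_
    rw [card2]
    exact le_trans (le_of_eq (by ring)) (hpow (i := 2) (j := 3) (by norm_num) (by norm_num))
  · intro a i j
    rw [dirD_changeρ _ _ _ hρ]
    refine (abs_linComb_le (cFE i j) hKK fun x =>
      abs_dirD_changeFrame_le hK0.le hEK a fun i => bρ' i x.1 x.2).trans ?_
    rw [card2]
    exact le_trans (le_of_eq (by ring)) (hpow (i := 3) (j := 4) (by norm_num) (by norm_num))
  · have h1 : Real.exp (2 * -K) / c ≤ Real.exp (2 * v y) / c :=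
      div_le_div_of_nonneg_right (Real.exp_le_exp.mpr (by linarith [(abs_le.mp bv).1])) hc0.le
    exact mul_le_mul ha (pow_le_pow_left₀ (by positivity) h1 _) (by positivity) (by linarith)
  · have h1 := (abs_le.mp bv).1
    exact one_div_le_one_div_of_le (by linarith) (by linarith)
  · have h1 := (abs_le.mp bv).2
    rw [div_le_one (by linarith)]
    linarith
  · intro a
    have h1 : |dirD (changeFrame e E a) η y| ≤ n * (K * √(K * η y)) :=
      abs_dirD_changeFrame_le hK0.le hEK a fun i => Real.abs_le_sqrt (bη i)
    calc dirD (changeFrame e E a) η y ^ 2 = |dirD (changeFrame e E a) η y| ^ 2 := (sq_abs _).symm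
      _ ≤ (n * (K * √(K * η y))) ^ 2 := pow_le_pow_left₀ (abs_nonneg _) h1 2
      _ = n ^ 2 * K ^ 2 * √(K * η y) ^ 2 := by ring
      _ = n ^ 2 * K ^ 3 * η y := by rw [Real.sq_sqrt (by positivity)]; ring
      _ ≤ K' * η y := mul_le_mul_of_nonneg_right (hpow (by norm_num) (by norm_num)) hη0.le
  · intro a
    refine (abs_dirD_dirD_changeFrame_le hK0.le hEK a a hη fun i j => bη2 i j).trans ?_
    exact le_trans (le_of_eq (by ring)) (hpow (i := 2) (j := 3) (by norm_num) (by norm_num))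
  · have hv2 : ∀ᶠ z in 𝓝 y, ContDiffAt ℝ 2 v z :=
      (hv.of_le (by norm_num : (2 : WithTop ℕ∞) ≤ 3)).eventually (by simp)
    filter_upwards [hW, hv2] with z hz1 hz2 i j
    rw [hz1]
    exact (congrFun (congrFun (frameW_changeFrame hEF G Λ ρ (1 / c) hz2) i) j).symm
  · simpa only [hnorm] using hmax

end CoordinateEstimate


/-! ### The metric and the gradient norm read in a chart. -/

theorem contMDiff_constant_section {E : Type*} [NormedAddCommGroup E] [NormedSpace ℝ E] (w : E) :
    ContMDiff 𝓘(ℝ, E) 𝓘(ℝ, E).tangent ∞ (fun y => (⟨y, w⟩ : TangentBundle 𝓘(ℝ, E) E)) := by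
  intro y
  exact contMDiffAt_vectorSpace_iff_contDiffAt.2 (contDiffAt_const (c := w))

section ChartMetric

variable {n : ℕ} {H : Type*} [TopologicalSpace H]
  (I : ModelWithCorners ℝ (EuclideanSpace ℝ (Fin n)) H)
  {M : Type*} [TopologicalSpace M] [ChartedSpace H M] [IsManifold I ∞ M]

theorem contMDiffOn_coordVec (c : M) (i : Fin n) :
    ContMDiffOn 𝓘(ℝ, EuclideanSpace ℝ (Fin n)) I.tangent ∞
      (fun y => (⟨(extChartAt I c).symm y, coordVec I c y i⟩ : TangentBundle I M))
      (extChartAt I c).target := by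
  have h1 := (contMDiffOn_extChartAt_symm (I := I) (n := ∞) c).contMDiffOn_tangentMapWithin
    (m := ∞) (by simp) (uniqueDiffOn_extChartAt_target c).uniqueMDiffOn
  have h2 := contMDiff_constant_section
    (EuclideanSpace.single i (1 : ℝ) : EuclideanSpace ℝ (Fin n))
  refine (h1.comp h2.contMDiffOn (fun y hy => hy)).congr fun y hy => ?_
  simp only [Function.comp, tangentMapWithin, coordVec]
  -- The tangent map is taken within the target, `coordVec` within the range of the model; near a
  -- point of the target these sets agree.
  rw [mfderivWithin_congr_set (extChartAt_target_eventuallyEq_of_mem (I := I) hy)]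

theorem linearIndependent_coordVec (c : M) {y} (hy : y ∈ (extChartAt I c).target) :
    LinearIndependent ℝ (coordVec I c y) := by
  have h := (isInvertible_mfderivWithin_extChartAt_symm (I := I) hy).injective
  have h3 := (EuclideanSpace.basisFun (Fin n) ℝ).toBasis.linearIndependent.map'
    (mfderivWithin 𝓘(ℝ, EuclideanSpace ℝ (Fin n)) I (extChartAt I c).symm (Set.range I)
      y).toLinearMap (LinearMap.ker_eq_bot.2 h)
  convert! h3 using 1
  ext i
  simp only [coordVec, Function.comp, OrthonormalBasis.coe_toBasis, EuclideanSpace.basisFun_apply]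
  rfl

variable [RiemannianBundle (fun x : M => TangentSpace I x)]

section
variable [IsContMDiffRiemannianBundle I ∞ (EuclideanSpace ℝ (Fin n)) (fun x : M => TangentSpace I x)]

theorem contDiffOn_metric (c : M) (i j : Fin n) :
    ContDiffOn ℝ ∞ (fun y => metric I c y i j) (extChartAt I c).target := by
  rw [← contMDiffOn_iff_contDiffOn]
  exact ContMDiffOn.inner_bundle (contMDiffOn_coordVec I c i) (contMDiffOn_coordVec I c j)

end

theorem posDef_metric (c : M) {y} (hy : y ∈ (extChartAt I c).target) :
    (metric I c y).PosDef :=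
  Matrix.posDef_gram_of_linearIndependent (linearIndependent_coordVec I c hy)

/-- The Riesz representative of φ has coefficients g⁻¹(φ(b_j)) in the basis b, and its squared norm
is φ evaluated on it. -/
theorem norm_sq_eq_of_basis {T : Type*} [NormedAddCommGroup T] [InnerProductSpace ℝ T]
    [FiniteDimensional ℝ T] {ι : Type*} [Fintype ι] [DecidableEq ι] (b : Module.Basis ι ℝ T)
    (φ : T →L[ℝ] ℝ) :
    ‖φ‖ ^ 2 = ∑ i, ∑ j, (Matrix.of fun i j => inner ℝ (b i) (b j))⁻¹ i j * (φ (b i) * φ (b j)) := by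
  set g : Matrix ι ι ℝ := Matrix.of fun i j => inner ℝ (b i) (b j) with hg
  have hpd : g.PosDef := Matrix.posDef_gram_of_linearIndependent b.linearIndependent
  set u : T := (InnerProductSpace.toDual ℝ T).symm φ with hu
  have hφ : ∀ x, φ x = inner ℝ u x := fun x => by simp [hu]
  have hn : ‖φ‖ ^ 2 = inner ℝ u u := by
    rw [real_inner_self_eq_norm_sq, hu, LinearIsometryEquiv.norm_map]
  set c : ι → ℝ := fun i => b.repr u i with hc
  have hsum : u = ∑ i, c i • b i := (b.sum_repr u).symm
  have hp : ∀ j, φ (b j) = g.mulVec c j := by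
    intro j
    rw [hφ]
    conv_lhs => rw [hsum]
    rw [sum_inner]
    simp only [Matrix.mulVec, dotProduct, hg, Matrix.of_apply, inner_smul_left]
    refine Finset.sum_congr rfl fun i _ => ?_
    rw [real_inner_comm]; simp [mul_comm]
  have hp' : (fun j => φ (b j)) = g.mulVec c := funext hp
  have h1 : g⁻¹.mulVec (fun j => φ (b j)) = c := by
    rw [hp', Matrix.mulVec_mulVec, Matrix.nonsing_inv_mul _ ((Matrix.isUnit_iff_isUnit_det _).1 hpd.isUnit), Matrix.one_mulVec]
  have h2 : ∑ i, ∑ j, g⁻¹ i j * (φ (b i) * φ (b j))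
      = ∑ i, φ (b i) * g⁻¹.mulVec (fun j => φ (b j)) i := by
    refine Finset.sum_congr rfl fun i _ => ?_
    rw [Matrix.mulVec, dotProduct, Finset.mul_sum]
    exact Finset.sum_congr rfl fun j _ => by ring
  rw [hn, h2, h1]
  conv_lhs => rw [← hφ, hsum]
  rw [map_sum]
  exact Finset.sum_congr rfl fun i _ => by simp [mul_comm]

/-- Derivatives are taken within the range of the model, so the formula also holds at boundary
points; continuity of |∇v| on all of the manifold rests on this. -/
theorem gradNorm_sq_eq (hpos : 0 < n) (c : M) {v : M → ℝ} {y : EuclideanSpace ℝ (Fin n)}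
    (hy : y ∈ (extChartAt I c).target)
    (hv : MDifferentiableAt I 𝓘(ℝ, ℝ) v ((extChartAt I c).symm y)) :
    gradNorm I v ((extChartAt I c).symm y) ^ 2 = ∑ i, ∑ j, (metric I c y)⁻¹ i j *
      (fderivWithin ℝ (inChart I c v) (Set.range I) y (EuclideanSpace.single i 1) *
       fderivWithin ℝ (inChart I c v) (Set.range I) y (EuclideanSpace.single j 1)) := by
  have hli := linearIndependent_coordVec I c hy
  have hfin : Module.finrank ℝ (TangentSpace I ((extChartAt I c).symm y)) = n :=
    finrank_euclideanSpace_fin (𝕜 := ℝ) (n := n)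
  have : FiniteDimensional ℝ (TangentSpace I ((extChartAt I c).symm y)) :=
    inferInstanceAs (FiniteDimensional ℝ (EuclideanSpace ℝ (Fin n)))
  have : Nonempty (Fin n) := ⟨⟨0, hpos⟩⟩
  let b := basisOfLinearIndependentOfCardEqFinrank hli (by rw [Fintype.card_fin, hfin])
  have hb : ∀ i, b i = coordVec I c y i := fun i =>
    congrFun (coe_basisOfLinearIndependentOfCardEqFinrank hli _) i
  have key : ∀ i, mvfderiv I v ((extChartAt I c).symm y) (coordVec I c y i) =
      fderivWithin ℝ (inChart I c v) (Set.range I) y (EuclideanSpace.single i 1) := by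
    intro i
    have hs : MDifferentiableWithinAt 𝓘(ℝ, EuclideanSpace ℝ (Fin n)) I (extChartAt I c).symm
        (Set.range I) y :=
      (contMDiffWithinAt_extChartAt_symm_range (n := ∞) c hy).mdifferentiableWithinAt (by simp)
    have hu : UniqueMDiffWithinAt 𝓘(ℝ, EuclideanSpace ℝ (Fin n)) (Set.range I) y :=
      (I.uniqueDiffOn _ (extChartAt_target_subset_range c hy)).uniqueMDiffWithinAt
    have h := mvfderiv_comp_mfderivWithin y hv hs hu
    have h2 := congrArg (fun L => L (EuclideanSpace.single i (1:ℝ))) h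
    have h3 : mvfderivWithin 𝓘(ℝ, EuclideanSpace ℝ (Fin n)) (v ∘ (extChartAt I c).symm)
       (Set.range I) y (EuclideanSpace.single i (1:ℝ)) =
        fderivWithin ℝ (inChart I c v) (Set.range I) y (EuclideanSpace.single i 1) := by
      rw [← mfderivWithin_eq_fderivWithin]; rfl
    rw [← h3]
    exact h2.symm
  have := norm_sq_eq_of_basis b (mvfderiv I v ((extChartAt I c).symm y))
  simp only [hb, key] at this
  exact this

end ChartMetric

/-! ### Functions whose interior values extend smoothly to the boundary. -/

section SmoothUpTo

open Filter Topology

variable {V : Type*} [NormedAddCommGroup V] [NormedSpace ℝ V]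

/-- `F` agrees on the interior of `s` with a function that is smooth on `s`. -/
def SmoothUpTo (s : Set V) (F : V → ℝ) : Prop :=
  ∃ F' : V → ℝ, ContDiffOn ℝ ∞ F' s ∧ Set.EqOn F F' (interior s)

namespace SmoothUpTo

variable {s : Set V} {F F₁ F₂ : V → ℝ}

theorem of_contDiffOn (h : ContDiffOn ℝ ∞ F s) : SmoothUpTo s F := ⟨F, h, fun _ _ => rfl⟩

theorem const (c : ℝ) : SmoothUpTo s (fun _ => c) := of_contDiffOn contDiffOn_const

theorem add (h₁ : SmoothUpTo s F₁) (h₂ : SmoothUpTo s F₂) :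
    SmoothUpTo s (fun z => F₁ z + F₂ z) := by
  obtain ⟨A, hA, hA'⟩ := h₁
  obtain ⟨B, hB, hB'⟩ := h₂
  exact ⟨fun z => A z + B z, hA.add hB, fun z hz => by simp only [hA' hz, hB' hz]⟩

theorem mul (h₁ : SmoothUpTo s F₁) (h₂ : SmoothUpTo s F₂) :
    SmoothUpTo s (fun z => F₁ z * F₂ z) := by
  obtain ⟨A, hA, hA'⟩ := h₁
  obtain ⟨B, hB, hB'⟩ := h₂
  exact ⟨fun z => A z * B z, hA.mul hB, fun z hz => by simp only [hA' hz, hB' hz]⟩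

theorem neg (h : SmoothUpTo s F) : SmoothUpTo s (fun z => -F z) := by
  simpa using (const (-1)).mul h

theorem sub (h₁ : SmoothUpTo s F₁) (h₂ : SmoothUpTo s F₂) :
    SmoothUpTo s (fun z => F₁ z - F₂ z) := by
  simpa [sub_eq_add_neg] using h₁.add h₂.neg

theorem sum {ι : Type*} {t : Finset ι} {F : ι → V → ℝ} (h : ∀ i ∈ t, SmoothUpTo s (F i)) :
    SmoothUpTo s (fun z => ∑ i ∈ t, F i z) := by
  classical
  induction t using Finset.induction_on with
  | empty => simpa using const 0
  | insert a t ha ih =>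
    simp only [Finset.sum_insert ha]
    exact (h a (Finset.mem_insert_self a t)).add
      (ih fun i hi => h i (Finset.mem_insert_of_mem hi))

theorem contDiffAt (h : SmoothUpTo s F) {y : V} (hy : y ∈ interior s) : ContDiffAt ℝ ∞ F y := by
  obtain ⟨A, hA, hA'⟩ := h
  refine ((hA y (interior_subset hy)).contDiffAt (mem_interior_iff_mem_nhds.1 hy)).congr_of_eventuallyEq ?_
  filter_upwards [isOpen_interior.mem_nhds hy] with z hz using hA' hz

/-- The unrestricted derivative is reliable only in the interior, where it coincides with the
derivative of the extension within s; the latter is smooth on all of s. -/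
theorem dirD (hs : UniqueDiffOn ℝ s) (h : SmoothUpTo s F) (u : V) : SmoothUpTo s (dirD u F) := by
  obtain ⟨A, hA, hA'⟩ := h
  refine ⟨fun z => fderivWithin ℝ A s z u, (hA.fderivWithin hs (by simp)).clm_apply contDiffOn_const,
    fun y hy => ?_⟩
  have h1 : F =ᶠ[𝓝 y] A := by
    filter_upwards [isOpen_interior.mem_nhds hy] with z hz using hA' hz
  simp only [ConformalRicci.dirD]
  rw [h1.fderiv_eq, fderivWithin_of_mem_nhds (mem_interior_iff_mem_nhds.1 hy)]

/-- The extension is continuous at y even when y lies on the boundary. This is how coefficient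
bounds reach up to the boundary although the coefficients are used only inside. -/
theorem eventually_abs_le (h : SmoothUpTo s F) {y : V} (hy : y ∈ s) :
    ∃ K : ℝ, ∀ᶠ z in 𝓝[interior s] y, |F z| ≤ K := by
  obtain ⟨A, hA, hA'⟩ := h
  refine ⟨|A y| + 1, ?_⟩
  have h1 : ∀ᶠ z in 𝓝[s] y, |A z| < |A y| + 1 :=
    (hA.continuousOn y hy).abs.eventually (gt_mem_nhds (lt_add_one _))
  filter_upwards [h1.filter_mono (nhdsWithin_mono y interior_subset), self_mem_nhdsWithin]
    with z hz hz'
  rw [hA' hz']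
  exact hz.le

theorem eventually_abs_le_forall {ι : Type*} [Finite ι] {F : ι → V → ℝ}
    (h : ∀ i, SmoothUpTo s (F i)) {y : V} (hy : y ∈ s) :
    ∃ K : ℝ, ∀ᶠ z in 𝓝[interior s] y, ∀ i, |F i z| ≤ K := by
  have := Fintype.ofFinite ι
  choose K hK using fun i => (h i).eventually_abs_le hy
  refine ⟨∑ i, |K i|, ?_⟩
  rw [eventually_all]
  intro i
  filter_upwards [hK i] with z hz
  exact hz.trans ((le_abs_self _).trans
    (Finset.single_le_sum (f := fun i => |K i|) (fun i _ => abs_nonneg _) (Finset.mem_univ i)))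

end SmoothUpTo

theorem contDiffOn_matrix_det {ι : Type*} [Fintype ι] [DecidableEq ι] {s : Set V}
    {g : V → Matrix ι ι ℝ} (hg : ∀ i j, ContDiffOn ℝ ∞ (fun z => g z i j) s) :
    ContDiffOn ℝ ∞ (fun z => (g z).det) s := by
  simp only [Matrix.det_apply]
  refine ContDiffOn.sum fun σ _ => ContDiffOn.const_smul _ ?_
  exact contDiffOn_prod fun i _ => hg _ _

theorem contDiffOn_matrix_inv {ι : Type*} [Fintype ι] [DecidableEq ι] {s : Set V}
    {g : V → Matrix ι ι ℝ} (hg : ∀ i j, ContDiffOn ℝ ∞ (fun z => g z i j) s)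
    (h0 : ∀ z ∈ s, (g z).det ≠ 0) (i j : ι) :
    ContDiffOn ℝ ∞ (fun z => (g z)⁻¹ i j) s := by
  simp only [Matrix.inv_def, Ring.inverse_eq_inv', Matrix.smul_apply, smul_eq_mul,
    Matrix.adjugate_apply]
  refine ((contDiffOn_matrix_det hg).inv h0).mul (contDiffOn_matrix_det fun a b => ?_)
  by_cases h : a = j
  · subst h; simpa using contDiffOn_const
  · simpa [Matrix.updateRow_apply, h] using hg a b

end SmoothUpTo


/-! ### Christoffel symbols and the symmetry of the Ricci tensor. -/

section ChartGeometry

open Filter Topology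

variable {n : ℕ} {H : Type*} [TopologicalSpace H]
  (I : ModelWithCorners ℝ (EuclideanSpace ℝ (Fin n)) H)
  {M : Type*} [TopologicalSpace M] [ChartedSpace H M]
  [RiemannianBundle (fun x : M => TangentSpace I x)]

/-- The `i`-th coordinate vector of `ℝⁿ`. -/
noncomputable abbrev stdVec (i : Fin n) : EuclideanSpace ℝ (Fin n) := EuclideanSpace.single i 1

theorem metric_symm (c : M) (z : EuclideanSpace ℝ (Fin n)) (i j : Fin n) :
    metric I c z i j = metric I c z j i := by
  simp only [metric, Matrix.of_apply]
  exact real_inner_comm _ _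

theorem metric_transpose (c : M) (z : EuclideanSpace ℝ (Fin n)) :
    (metric I c z).transpose = metric I c z := by
  ext i j; exact metric_symm I c z j i

theorem metric_inv_symm (c : M) (z : EuclideanSpace ℝ (Fin n)) (i j : Fin n) :
    (metric I c z)⁻¹ i j = (metric I c z)⁻¹ j i := by
  have h := Matrix.transpose_nonsing_inv (metric I c z)
  rw [metric_transpose] at h
  exact (congrFun (congrFun h j) i)

theorem christoffel_symm (c : M) (k i j : Fin n) : christoffel I c k i j = christoffel I c k j i := by
  funext z
  simp only [christoffel]
  congr 1
  refine Finset.sum_congr rfl fun l _ => ?_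
  have : (fun z => metric I c z i j) = fun z => metric I c z j i :=
    funext fun z => metric_symm I c z i j
  rw [this]; ring

/-- The trace `Γ^k_ik` of the Christoffel symbols is `½ g^{kl} ∂_i g_kl`. -/
theorem sum_christoffel (c : M) (i : Fin n) (z : EuclideanSpace ℝ (Fin n)) :
    ∑ k, christoffel I c k i k z =
      (1 / 2) * ∑ k, ∑ l, (metric I c z)⁻¹ k l * dirD (stdVec i) (fun z => metric I c z k l) z := by
  simp only [christoffel, ← Finset.mul_sum]
  congr 1
  have h : ∑ k, ∑ l, (metric I c z)⁻¹ k l * pderiv k (fun z => metric I c z i l) z =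
      ∑ k, ∑ l, (metric I c z)⁻¹ k l * pderiv l (fun z => metric I c z i k) z := by
    rw [Finset.sum_comm]
    refine Finset.sum_congr rfl fun k _ => Finset.sum_congr rfl fun l _ => ?_
    rw [metric_inv_symm]
  simp only [mul_sub, mul_add, Finset.sum_sub_distrib, Finset.sum_add_distrib]
  rw [h, add_sub_cancel_right]
  rfl

variable [IsManifold I ∞ M]
  [IsContMDiffRiemannianBundle I ∞ (EuclideanSpace ℝ (Fin n)) (fun x : M => TangentSpace I x)]

theorem contDiffOn_metric_inv (c : M) (i j : Fin n) :
    ContDiffOn ℝ ∞ (fun z => (metric I c z)⁻¹ i j) (extChartAt I c).target :=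
  contDiffOn_matrix_inv (contDiffOn_metric I c)
    (fun _ hz => (posDef_metric I c hz).det_pos.ne') i j

theorem smoothUpTo_christoffel (c : M) (k i j : Fin n) :
    SmoothUpTo (extChartAt I c).target (christoffel I c k i j) := by
  have hs := uniqueDiffOn_extChartAt_target (I := I) c
  have hg : ∀ i j l, SmoothUpTo (extChartAt I c).target (pderiv l fun z => metric I c z i j) :=
    fun i j l => (SmoothUpTo.of_contDiffOn (contDiffOn_metric I c i j)).dirD hs (stdVec l)
  exact (SmoothUpTo.const _).mul (SmoothUpTo.sum fun l _ =>
    (SmoothUpTo.of_contDiffOn (contDiffOn_metric_inv I c k l)).mul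
      (((hg j l i).add (hg i l j)).sub (hg i j l)))

theorem smoothUpTo_ricci (c : M) (i j : Fin n) :
    SmoothUpTo (extChartAt I c).target (fun z => ricci I c z i j) := by
  have hs := uniqueDiffOn_extChartAt_target (I := I) c
  have hΓ := smoothUpTo_christoffel I c
  have hd : ∀ k i j l, SmoothUpTo (extChartAt I c).target (pderiv l (christoffel I c k i j)) :=
    fun k i j l => (hΓ k i j).dirD hs (stdVec l)
  exact (SmoothUpTo.sum fun k _ => (hd k i j k).sub (hd k i k j)).add
    (SmoothUpTo.sum fun k _ => SmoothUpTo.sum fun l _ =>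
      ((hΓ k k l).mul (hΓ l i j)).sub ((hΓ k j l).mul (hΓ l i k)))

theorem contDiffAt_metric (c : M) {y} (hy : y ∈ interior (extChartAt I c).target) (i j : Fin n) :
    ContDiffAt ℝ ∞ (fun z => metric I c z i j) y :=
  (SmoothUpTo.of_contDiffOn (contDiffOn_metric I c i j)).contDiffAt hy

theorem contDiffAt_metric_inv (c : M) {y} (hy : y ∈ interior (extChartAt I c).target)
    (i j : Fin n) : ContDiffAt ℝ ∞ (fun z => (metric I c z)⁻¹ i j) y :=
  (SmoothUpTo.of_contDiffOn (contDiffOn_metric_inv I c i j)).contDiffAt hy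

/-- `∂ g⁻¹ = - g⁻¹ (∂ g) g⁻¹`. -/
theorem dirD_metric_inv (c : M) {y} (hy : y ∈ interior (extChartAt I c).target)
    (u : EuclideanSpace ℝ (Fin n)) :
    (Matrix.of fun k l => dirD u (fun z => (metric I c z)⁻¹ k l) y) =
      -((metric I c y)⁻¹ * (Matrix.of fun k l => dirD u (fun z => metric I c z k l) y)
        * (metric I c y)⁻¹) := by
  set D := (Matrix.of fun k l => dirD u (fun z => (metric I c z)⁻¹ k l) y)
  set d := (Matrix.of fun k l => dirD u (fun z => metric I c z k l) y)
  have hunit : ∀ z ∈ (extChartAt I c).target, IsUnit (metric I c z).det := fun z hz =>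
    (posDef_metric I c hz).det_pos.ne'.isUnit
  have h1 : d * (metric I c y)⁻¹ + metric I c y * D = 0 := by
    ext a b
    have h2 : HasDir u (fun z => ∑ k, metric I c z a k * (metric I c z)⁻¹ k b)
        (∑ k, (d a k * (metric I c y)⁻¹ k b + metric I c y a k * D k b)) y :=
      HasDir.sum fun k _ =>
        (hasDir_dirD ((contDiffAt_metric I c hy a k).differentiableAt (by simp))).mul
        (hasDir_dirD ((contDiffAt_metric_inv I c hy k b).differentiableAt (by simp)))
    have h3 : (fun z => ∑ k, metric I c z a k * (metric I c z)⁻¹ k b) =ᶠ[𝓝 y]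
        fun _ => (1 : Matrix (Fin n) (Fin n) ℝ) a b := by
      filter_upwards [isOpen_interior.mem_nhds hy] with z hz
      rw [← Matrix.mul_nonsing_inv _ (hunit z (interior_subset hz)), Matrix.mul_apply]
    have h4 := h2.2
    rw [dirD_congr h3, (HasDir.const (u := u) (z := y) _).2] at h4
    simp only [Matrix.add_apply, Matrix.mul_apply, Matrix.zero_apply, ← Finset.sum_add_distrib]
    exact h4.symm
  have h5 : (metric I c y)⁻¹ * (d * (metric I c y)⁻¹ + metric I c y * D) = 0 := by rw [h1, mul_zero]
  rw [mul_add, ← mul_assoc, ← mul_assoc, Matrix.nonsing_inv_mul _ (hunit y (interior_subset hy)),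
    one_mul] at h5
  exact eq_neg_of_add_eq_zero_right h5

theorem dirD_sum_christoffel (c : M) {y} (hy : y ∈ interior (extChartAt I c).target) (i j : Fin n) :
    ∑ k, pderiv j (christoffel I c k i k) y =
      (1 / 2) * (∑ k, ∑ l, (dirD (stdVec j) (fun z => (metric I c z)⁻¹ k l) y
          * dirD (stdVec i) (fun z => metric I c z k l) y
        + (metric I c y)⁻¹ k l *
          dirD (stdVec j) (dirD (stdVec i) (fun z => metric I c z k l)) y)) := by
  have h1 : HasDir (stdVec j) (fun z => ∑ k, christoffel I c k i k z)
      (∑ k, pderiv j (christoffel I c k i k) y) y :=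
    HasDir.sum fun k _ => hasDir_dirD
      (((smoothUpTo_christoffel I c k i k).contDiffAt hy).differentiableAt (by simp))
  rw [← h1.2, funext (sum_christoffel I c i)]
  have hg : ∀ k l, HasDir (stdVec j) (dirD (stdVec i) (fun z => metric I c z k l))
      (dirD (stdVec j) (dirD (stdVec i) (fun z => metric I c z k l)) y) y := fun k l =>
    hasDir_dirD ((contDiffAt_dirD (m := 1) (contDiffAt_metric I c hy k l)
      (by norm_cast)).differentiableAt (by simp))
  have h2 := (HasDir.const (u := stdVec j) (z := y) (1 / 2)).mul
    (HasDir.sum fun k (_ : k ∈ Finset.univ) => HasDir.sum fun l (_ : l ∈ Finset.univ) =>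
      (hasDir_dirD (u := stdVec j) ((contDiffAt_metric_inv I c hy k l).differentiableAt
        (by simp))).mul (hg k l))
  rw [h2.2]; ring

/-- Morally Γ^k_ik = ∂_i log √det g, and second derivatives commute. Without the determinant: ∂g⁻¹ =
−g⁻¹(∂g)g⁻¹ turns the product terms into a trace, symmetric in i and j by cyclicity. -/
theorem dirD_sum_christoffel_comm (c : M) {y} (hy : y ∈ interior (extChartAt I c).target)
    (i j : Fin n) :
    ∑ k, pderiv j (christoffel I c k i k) y = ∑ k, pderiv i (christoffel I c k j k) y := by
  rw [dirD_sum_christoffel I c hy, dirD_sum_christoffel I c hy]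
  congr 1
  simp only [Finset.sum_add_distrib]
  congr 1
  · have key : ∀ a b : Fin n, ∑ k, ∑ l, dirD (stdVec a) (fun z => (metric I c z)⁻¹ k l) y
          * dirD (stdVec b) (fun z => metric I c z k l) y =
        -Matrix.trace ((metric I c y)⁻¹
          * (Matrix.of fun k l => dirD (stdVec a) (fun z => metric I c z k l) y)
          * (metric I c y)⁻¹
          * (Matrix.of fun k l => dirD (stdVec b) (fun z => metric I c z k l) y)) := by
      intro a b
      have h := dirD_metric_inv I c hy (stdVec a)
      rw [← Matrix.trace_neg, ← neg_mul, ← h]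
      simp only [Matrix.trace, Matrix.diag, Matrix.mul_apply, Matrix.of_apply]
      refine Finset.sum_congr rfl fun k _ => Finset.sum_congr rfl fun l _ => ?_
      rw [show (fun z => metric I c z k l) = fun z => metric I c z l k from
        funext fun z => metric_symm I c z k l]
    rw [key, key, mul_assoc, Matrix.trace_mul_comm, ← mul_assoc]
  · refine Finset.sum_congr rfl fun k _ => Finset.sum_congr rfl fun l _ => ?_
    rw [dirD_comm ((contDiffAt_metric I c hy k l).of_le (by norm_cast))]

theorem ricci_symm (c : M) {y} (hy : y ∈ interior (extChartAt I c).target) (i j : Fin n) :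
    ricci I c y i j = ricci I c y j i := by
  simp only [ricci, Matrix.of_apply, Finset.sum_sub_distrib]
  rw [dirD_sum_christoffel_comm I c hy i j]
  have h1 : ∀ k, christoffel I c k i j = christoffel I c k j i := fun k => christoffel_symm I c k i j
  simp only [h1]
  congr 2
  rw [Finset.sum_comm]
  refine Finset.sum_congr rfl fun k _ => Finset.sum_congr rfl fun l _ => ?_
  rw [mul_comm]

end ChartGeometry


/-! ### 𝒲[v] in a chart as an instance of the model matrix `frameW`. -/

section ChartEquation

open Filter Topology

variable {n : ℕ} {H : Type*} [TopologicalSpace H]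
  (I : ModelWithCorners ℝ (EuclideanSpace ℝ (Fin n)) H)
  {M : Type*} [TopologicalSpace M] [ChartedSpace H M]
  [RiemannianBundle (fun x : M => TangentSpace I x)]

/-- The coefficients of `∂_m v` in the matrix of `𝒲[v]`. -/
noncomputable def firstOrderCoeff (c : M) (m i j : Fin n) (z : EuclideanSpace ℝ (Fin n)) : ℝ :=
  -(∑ l, (metric I c z)⁻¹ i l * christoffel I c m l j z)
    - (if i = j then (1 : ℝ) else 0) * (1 / ((n : ℝ) - 2) *
      ∑ k, ∑ l, (metric I c z)⁻¹ k l * christoffel I c m k l z)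

/-- The coefficients of order zero in the matrix of `𝒲[v]`. -/
noncomputable def zeroOrderCoeff (c : M) (i j : Fin n) (z : EuclideanSpace ℝ (Fin n)) : ℝ :=
  -(1 / ((n : ℝ) - 2) * ∑ l, (metric I c z)⁻¹ i l * ricci I c z l j)

/-- The symmetric bilinear form associated with `𝒲[v]`. -/
noncomputable def formW (c : M) (v : M → ℝ) (y : EuclideanSpace ℝ (Fin n)) :
    Matrix (Fin n) (Fin n) ℝ :=
  hessian I c v y
      - Matrix.of (fun i j => pderiv i (inChart I c v) y * pderiv j (inChart I c v) y)
      + (laplacian I c v y / ((n : ℝ) - 2) + gradNorm I v ((extChartAt I c).symm y) ^ 2) •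
        metric I c y
      - (1 / ((n : ℝ) - 2)) • ricci I c y

theorem calW_symm_eq (c : M) (v : M → ℝ) {y : EuclideanSpace ℝ (Fin n)}
    (hy : y ∈ (extChartAt I c).target) :
    calW I c v ((extChartAt I c).symm y) = (metric I c y)⁻¹ * formW I c v y := by
  simp only [calW, formW, (extChartAt I c).right_inv hy]

variable [IsManifold I ∞ M]

theorem gradNorm_sq_eq_frameNormSq (hpos : 0 < n) (c : M) {v : M → ℝ}
    {y : EuclideanSpace ℝ (Fin n)} (hy : y ∈ interior (extChartAt I c).target)
    (hv : MDifferentiableAt I 𝓘(ℝ, ℝ) v ((extChartAt I c).symm y)) :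
    gradNorm I v ((extChartAt I c).symm y) ^ 2 =
      frameNormSq stdVec (fun i j z => (metric I c z)⁻¹ i j) (inChart I c v) y := by
  rw [gradNorm_sq_eq I hpos c (interior_subset hy) hv, frameNormSq,
    fderivWithin_of_mem_nhds (mem_of_superset (mem_interior_iff_mem_nhds.1 hy)
      (extChartAt_target_subset_range c))]
  rfl

omit [IsManifold I ∞ M] in
-- Christoffel symbols multiply only first derivatives of v, in the Hessian and in the Laplacian,
-- and are collected in `firstOrderCoeff`; the Ricci term is of order zero.
theorem metric_inv_mul_formW (c : M) {v : M → ℝ} {y : EuclideanSpace ℝ (Fin n)}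
    (hdet : IsUnit (metric I c y).det)
    (hgrad : gradNorm I v ((extChartAt I c).symm y) ^ 2 =
      frameNormSq stdVec (fun i j z => (metric I c z)⁻¹ i j) (inChart I c v) y) :
    (metric I c y)⁻¹ * formW I c v y = Matrix.of fun i j =>
      frameW stdVec (fun i j z => (metric I c z)⁻¹ i j) (firstOrderCoeff I c) (zeroOrderCoeff I c)
        (1 / ((n : ℝ) - 2)) (inChart I c v) i j y := by
  rw [formW, mul_sub, mul_add, mul_sub, Matrix.mul_smul, Matrix.mul_smul,
    Matrix.nonsing_inv_mul _ hdet, hgrad]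
  ext i j
  have h1 : laplacian I c v y = ∑ k, ∑ l, (metric I c y)⁻¹ k l *
        dirD (stdVec k) (dirD (stdVec l) (inChart I c v)) y
      - ∑ m, (∑ k, ∑ l, (metric I c y)⁻¹ k l * christoffel I c m k l y) *
        dirD (stdVec m) (inChart I c v) y := by
    simp only [laplacian, hessian, Matrix.of_apply, mul_sub, Finset.sum_sub_distrib]
    congr 1
    simp only [Finset.sum_mul, Finset.mul_sum]
    conv_rhs => rw [Finset.sum_comm]
    refine Finset.sum_congr rfl fun k _ => ?_
    rw [Finset.sum_comm]
    exact Finset.sum_congr rfl fun m _ => Finset.sum_congr rfl fun l _ => by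
      rw [mul_assoc]; rfl
  have h2 : ((metric I c y)⁻¹ * hessian I c v y) i j = ∑ l, (metric I c y)⁻¹ i l *
        dirD (stdVec l) (dirD (stdVec j) (inChart I c v)) y
      - ∑ m, (∑ l, (metric I c y)⁻¹ i l * christoffel I c m l j y) *
        dirD (stdVec m) (inChart I c v) y := by
    simp only [Matrix.mul_apply, hessian, Matrix.of_apply, mul_sub, Finset.sum_sub_distrib]
    congr 1
    simp only [Finset.sum_mul, Finset.mul_sum]
    rw [Finset.sum_comm]
    exact Finset.sum_congr rfl fun m _ => Finset.sum_congr rfl fun l _ => by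
      rw [mul_assoc]; rfl
  have h3 : ∑ m, firstOrderCoeff I c m i j y * dirD (stdVec m) (inChart I c v) y =
      -(∑ m, (∑ l, (metric I c y)⁻¹ i l * christoffel I c m l j y) *
        dirD (stdVec m) (inChart I c v) y) - (if i = j then (1 : ℝ) else 0) *
        (1 / ((n : ℝ) - 2) * ∑ m, (∑ k, ∑ l, (metric I c y)⁻¹ k l * christoffel I c m k l y) *
        dirD (stdVec m) (inChart I c v) y) := by
    simp only [firstOrderCoeff, sub_mul, neg_mul, Finset.sum_sub_distrib, Finset.sum_neg_distrib]
    congr 1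
    rw [Finset.mul_sum, Finset.mul_sum]
    exact Finset.sum_congr rfl fun m _ => by ring
  simp only [Matrix.sub_apply, Matrix.add_apply, Matrix.smul_apply, smul_eq_mul, h2,
    Matrix.of_apply, frameW, h3, Matrix.one_apply, h1, zeroOrderCoeff, mul_sub,
    Finset.sum_sub_distrib, Matrix.mul_apply, pderiv]
  simp only [dirD]
  ring

end ChartEquation


/-! ### Bounded geometry and the estimate at a maximum point in a chart. -/

section ChartEstimate

open Filter Topology

variable {n : ℕ} {H : Type*} [TopologicalSpace H]
  (I : ModelWithCorners ℝ (EuclideanSpace ℝ (Fin n)) H)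
  {M : Type*} [TopologicalSpace M] [ChartedSpace H M]

theorem tendsto_extChartAt_symm (c : M) {y : EuclideanSpace ℝ (Fin n)}
    (hy : y ∈ interior (extChartAt I c).target) :
    Tendsto (extChartAt I c).symm (𝓝 y) (𝓝 ((extChartAt I c).symm y)) :=
  (continuousOn_extChartAt_symm c).continuousAt (mem_interior_iff_mem_nhds.1 hy)

section
variable [IsManifold I ∞ M]

theorem contDiffAt_inChart (c : M) {y : EuclideanSpace ℝ (Fin n)}
    (hy : y ∈ interior (extChartAt I c).target) {m : WithTop ℕ∞} (hm : m ≤ (∞ : ℕ∞ω)) {f : M → ℝ}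
    (hf : ContMDiffAt I 𝓘(ℝ, ℝ) m f ((extChartAt I c).symm y)) :
    ContDiffAt ℝ m (inChart I c f) y := by
  have h1 : ContMDiffWithinAt 𝓘(ℝ, EuclideanSpace ℝ (Fin n)) I m (extChartAt I c).symm
      (extChartAt I c).target y :=
    (contMDiffWithinAt_extChartAt_symm_target (n := ∞) c (interior_subset hy)).of_le hm
  have h2 := hf.comp_contMDiffWithinAt y h1
  exact (contMDiffWithinAt_iff_contDiffWithinAt.1 h2).contDiffAt (mem_interior_iff_mem_nhds.1 hy)

end

variable [RiemannianBundle (fun x : M => TangentSpace I x)]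

theorem gradNorm_nonneg (f : M → ℝ) (x : M) : 0 ≤ gradNorm I f x := by
  exact norm_nonneg (mvfderiv I f x)

/-- The coefficients of the metric, of its inverse and of the lower order terms of `𝒲` in the chart
around `c` are bounded by `K` at the point with coordinates `y`. -/
structure BoundedGeometry (c : M) (K : ℝ) (y : EuclideanSpace ℝ (Fin n)) : Prop where
  metric_le : ∀ i, metric I c y i i ≤ K
  inv_le : ∀ i, (metric I c y)⁻¹ i i ≤ K
  dirD_inv_le : ∀ a k l, |dirD (stdVec a) (fun z => (metric I c z)⁻¹ k l) y| ≤ K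
  dirD_dirD_inv_le : ∀ a b k l,
    |dirD (stdVec a) (dirD (stdVec b) (fun z => (metric I c z)⁻¹ k l)) y| ≤ K
  first_le : ∀ k i j, |firstOrderCoeff I c k i j y| ≤ K
  dirD_first_le : ∀ a k i j, |dirD (stdVec a) (firstOrderCoeff I c k i j) y| ≤ K
  zero_le : ∀ i j, |zeroOrderCoeff I c i j y| ≤ K
  dirD_zero_le : ∀ a i j, |dirD (stdVec a) (zeroOrderCoeff I c i j) y| ≤ K

variable {I} in
theorem BoundedGeometry.mono {c : M} {K K' : ℝ} {y : EuclideanSpace ℝ (Fin n)}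
    (h : BoundedGeometry I c K y) (hK : K ≤ K') : BoundedGeometry I c K' y :=
  ⟨fun i => (h.1 i).trans hK, fun i => (h.2 i).trans hK, fun a k l => (h.3 a k l).trans hK,
    fun a b k l => (h.4 a b k l).trans hK, fun k i j => (h.5 k i j).trans hK,
    fun a k i j => (h.6 a k i j).trans hK, fun i j => (h.7 i j).trans hK,
    fun a i j => (h.8 a i j).trans hK⟩

variable [IsManifold I ∞ M]
  [IsContMDiffRiemannianBundle I ∞ (EuclideanSpace ℝ (Fin n)) (fun x : M => TangentSpace I x)]

theorem smoothUpTo_firstOrderCoeff (c : M) (m i j : Fin n) :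
    SmoothUpTo (extChartAt I c).target (firstOrderCoeff I c m i j) :=
  have hG := fun k l => SmoothUpTo.of_contDiffOn (contDiffOn_metric_inv I c k l)
  have hΓ := smoothUpTo_christoffel I c
  (SmoothUpTo.sum fun l _ => (hG i l).mul (hΓ m l j)).neg.sub ((SmoothUpTo.const _).mul
    ((SmoothUpTo.const _).mul
      (SmoothUpTo.sum fun k _ => SmoothUpTo.sum fun l _ => (hG k l).mul (hΓ m k l))))

theorem smoothUpTo_zeroOrderCoeff (c : M) (i j : Fin n) :
    SmoothUpTo (extChartAt I c).target (zeroOrderCoeff I c i j) :=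
  ((SmoothUpTo.const _).mul (SmoothUpTo.sum fun l _ =>
    (SmoothUpTo.of_contDiffOn (contDiffOn_metric_inv I c i l)).mul (smoothUpTo_ricci I c l j))).neg

/-- All coefficients are smooth up to the boundary, so the base point may be a boundary point while
the bound is asserted only at nearby interior points. -/
theorem exists_boundedGeometry (c : M) {y₀ : EuclideanSpace ℝ (Fin n)}
    (hy₀ : y₀ ∈ (extChartAt I c).target) :
    ∃ K, ∀ᶠ y in 𝓝[interior (extChartAt I c).target] y₀, BoundedGeometry I c K y := by
  have hs := uniqueDiffOn_extChartAt_target (I := I) c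
  have hg := fun k l => SmoothUpTo.of_contDiffOn (contDiffOn_metric I c k l)
  have hG := fun k l => SmoothUpTo.of_contDiffOn (contDiffOn_metric_inv I c k l)
  have hΛ := smoothUpTo_firstOrderCoeff I c
  have hρ := smoothUpTo_zeroOrderCoeff I c
  obtain ⟨K₁, h₁⟩ := SmoothUpTo.eventually_abs_le_forall (fun i => hg i i) hy₀
  obtain ⟨K₂, h₂⟩ := SmoothUpTo.eventually_abs_le_forall (fun i => hG i i) hy₀
  obtain ⟨K₃, h₃⟩ := SmoothUpTo.eventually_abs_le_forall
    (fun i : Fin n × Fin n × Fin n => (hG i.2.1 i.2.2).dirD hs (stdVec i.1)) hy₀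
  obtain ⟨K₄, h₄⟩ := SmoothUpTo.eventually_abs_le_forall
    (fun i : Fin n × Fin n × Fin n × Fin n =>
      ((hG i.2.2.1 i.2.2.2).dirD hs (stdVec i.2.1)).dirD hs (stdVec i.1)) hy₀
  obtain ⟨K₅, h₅⟩ := SmoothUpTo.eventually_abs_le_forall
    (fun i : Fin n × Fin n × Fin n => hΛ i.1 i.2.1 i.2.2) hy₀
  obtain ⟨K₆, h₆⟩ := SmoothUpTo.eventually_abs_le_forall
    (fun i : Fin n × Fin n × Fin n × Fin n =>
      (hΛ i.2.1 i.2.2.1 i.2.2.2).dirD hs (stdVec i.1)) hy₀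
  obtain ⟨K₇, h₇⟩ := SmoothUpTo.eventually_abs_le_forall
    (fun i : Fin n × Fin n => hρ i.1 i.2) hy₀
  obtain ⟨K₈, h₈⟩ := SmoothUpTo.eventually_abs_le_forall
    (fun i : Fin n × Fin n × Fin n => (hρ i.2.1 i.2.2).dirD hs (stdVec i.1)) hy₀
  refine ⟨|K₁| + |K₂| + |K₃| + |K₄| + |K₅| + |K₆| + |K₇| + |K₈|, ?_⟩
  filter_upwards [h₁, h₂, h₃, h₄, h₅, h₆, h₇, h₈] with y b₁ b₂ b₃ b₄ b₅ b₆ b₇ b₈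
  have p₁ := abs_nonneg K₁
  have p₂ := abs_nonneg K₂
  have p₃ := abs_nonneg K₃
  have p₄ := abs_nonneg K₄
  have p₅ := abs_nonneg K₅
  have p₆ := abs_nonneg K₆
  have p₇ := abs_nonneg K₇
  have p₈ := abs_nonneg K₈
  exact ⟨fun i => by linarith [le_abs_self (metric I c y i i), b₁ i, le_abs_self K₁],
    fun i => by linarith [le_abs_self ((metric I c y)⁻¹ i i), b₂ i, le_abs_self K₂],
    fun a k l => by linarith [b₃ (a, k, l), le_abs_self K₃],
    fun a b k l => by linarith [b₄ (a, b, k, l), le_abs_self K₄],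
    fun k i j => by linarith [b₅ (k, i, j), le_abs_self K₅],
    fun a k i j => by linarith [b₆ (a, k, i, j), le_abs_self K₆],
    fun i j => by linarith [b₇ (i, j), le_abs_self K₇],
    fun a i j => by linarith [b₈ (a, i, j), le_abs_self K₈]⟩

/-- Symmetry makes g⁻¹ times this form diagonalizable with real eigenvalues, as the spectral lemmas
require. -/
theorem formW_transpose (c : M) {v : M → ℝ} {y : EuclideanSpace ℝ (Fin n)}
    (hy : y ∈ interior (extChartAt I c).target) (hv : ContDiffAt ℝ 2 (inChart I c v) y) :
    (formW I c v y).transpose = formW I c v y := by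
  ext i j
  have h1 : pderiv j (pderiv i (inChart I c v)) y = pderiv i (pderiv j (inChart I c v)) y :=
    dirD_comm hv
  simp only [Matrix.transpose_apply, formW, Matrix.sub_apply, Matrix.add_apply, Matrix.smul_apply,
    hessian, Matrix.of_apply, h1, christoffel_symm I c _ j i, metric_symm I c y j i,
    ricci_symm I c hy j i, mul_comm (pderiv j (inChart I c v) y)]

/-- The hypotheses of the gradient estimate on the open set `U`, with all norms bounded by `K`. -/
structure ControlledSolution (m : ℕ) (K a₀ : ℝ) (v α α₀ : M → ℝ) (U : Set M) : Prop where
  isOpen : IsOpen U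
  smooth : ContMDiffOn I 𝓘(ℝ, ℝ) 3 v U
  smooth_left : ContMDiffOn I 𝓘(ℝ, ℝ) 1 α U
  smooth_right : ContMDiffOn I 𝓘(ℝ, ℝ) 1 α₀ U
  abs_le : ∀ x ∈ U, |v x| ≤ K
  abs_left_le : ∀ x ∈ U, |α x| ≤ K
  abs_right_le : ∀ x ∈ U, |α₀ x| ≤ K
  gradNorm_left_le : ∀ x ∈ U, gradNorm I α x ≤ K
  gradNorm_right_le : ∀ x ∈ U, gradNorm I α₀ x ≤ K
  le_right : ∀ x ∈ U, a₀ ≤ α₀ x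
  admissible : IsAdmissibleOn I (m + 1) v U
  solution : IsSolutionOn I (m + 2) α α₀ v U

/-- The estimate at a point of maximum of the test function, with respect to the chart around
`c`. -/
theorem chart_estimate (hn : 3 ≤ n) {m : ℕ} (hm : m + 2 ≤ n) {K a₀ : ℝ} (hK : 1 ≤ K)
    (ha₀ : 0 < a₀) :
    ∃ C : ℝ, ∀ (c : M) (y : EuclideanSpace ℝ (Fin n)), y ∈ interior (extChartAt I c).target →
      BoundedGeometry I c K y → ∀ U : Set M, (extChartAt I c).symm y ∈ U →
      ∀ (v α α₀ : M → ℝ) (η : EuclideanSpace ℝ (Fin n) → ℝ),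
      ControlledSolution I m K a₀ v α α₀ U →
      ContDiffAt ℝ 2 η y → 0 < η y → η y ≤ 1 → (∀ a, dirD (stdVec a) η y ^ 2 ≤ K * η y) →
      (∀ a b, |dirD (stdVec a) (dirD (stdVec b) η) y| ≤ K) →
      IsLocalMax (fun z => (gradNorm I v ((extChartAt I c).symm z) ^ 2 * η z) ^ 2
        / (K + 1 - v ((extChartAt I c).symm z))) y →
      1 ≤ gradNorm I v ((extChartAt I c).symm y) ^ 2 →
      η y * gradNorm I v ((extChartAt I c).symm y) ^ 2 ≤ C := by
  obtain ⟨C, hC⟩ := coordinate_estimate (EuclideanSpace ℝ (Fin n)) hn hm hK ha₀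
  refine ⟨C, fun c y hy hgeo U hyU v α α₀ η ⟨hU, hv, hα, hα₀, bv, bα, bα₀, gα, gα₀, hlow, hadm, hsol⟩
    hη hη0 hη1 hη' hη'' hmax h1 => ?_⟩
  have hpos : 0 < n := by omega
  have hnear : ∀ᶠ z in 𝓝 y, z ∈ interior (extChartAt I c).target ∧ (extChartAt I c).symm z ∈ U :=
    (isOpen_interior.eventually_mem hy).and (tendsto_extChartAt_symm I c hy (hU.mem_nhds hyU))
  have smooth : ∀ {k : WithTop ℕ∞} {f : M → ℝ}, k ≤ (∞ : ℕ∞ω) → ContMDiffOn I 𝓘(ℝ, ℝ) k f U →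
      ∀ z, z ∈ interior (extChartAt I c).target → (extChartAt I c).symm z ∈ U →
      ContDiffAt ℝ k (inChart I c f) z := fun hk hf z hz hzU =>
    contDiffAt_inChart I c hz hk (hf.contMDiffAt (hU.mem_nhds hzU))
  have grad : ∀ {k : WithTop ℕ∞} {f : M → ℝ}, k ≠ 0 → ContMDiffOn I 𝓘(ℝ, ℝ) k f U →
      ∀ z, z ∈ interior (extChartAt I c).target → (extChartAt I c).symm z ∈ U →
      gradNorm I f ((extChartAt I c).symm z) ^ 2 =
      frameNormSq stdVec (fun i j z => (metric I c z)⁻¹ i j) (inChart I c f) z :=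
    fun hk hf z hz hzU => gradNorm_sq_eq_frameNormSq I hpos c hz
      ((hf.contMDiffAt (hU.mem_nhds hzU)).mdifferentiableAt hk)
  have hcalW : ∀ z ∈ interior (extChartAt I c).target, calW I c v ((extChartAt I c).symm z) =
      (metric I c z)⁻¹ * formW I c v z := fun z hz => calW_symm_eq I c v (interior_subset hz)
  have hsource : ∀ z ∈ interior (extChartAt I c).target,
      (extChartAt I c).symm z ∈ (extChartAt I c).source := fun z hz =>
    (extChartAt I c).map_target (interior_subset hz)
  rw [grad (by norm_num) hv y hy hyU] at h1 ⊢
  refine hC stdVec (metric I c) (formW I c v) (firstOrderCoeff I c) (zeroOrderCoeff I c)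
    (inChart I c v) (inChart I c α) (inChart I c α₀) η y _ rfl ?_ ?_ ?_
    (smooth (by norm_cast) hv y hy hyU) ?_ ?_
    ((smooth (by norm_cast) hα y hy hyU).differentiableAt (by norm_num))
    ((smooth (by norm_cast) hα₀ y hy hyU).differentiableAt (by norm_num)) hη ?_ ?_ ?_
    hgeo.metric_le hgeo.inv_le hgeo.dirD_inv_le hgeo.dirD_dirD_inv_le hgeo.first_le
    hgeo.dirD_first_le hgeo.zero_le hgeo.dirD_zero_le (bv _ hyU) (bα _ hyU) (bα₀ _ hyU)
    ?_ ?_ (hlow _ hyU) hη0 hη1 hη' hη'' ?_ h1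
  · filter_upwards [hnear] with z hz using posDef_metric I c (interior_subset hz.1)
  · filter_upwards [hnear] with z hz using
      formW_transpose I c hz.1 ((smooth (by norm_cast) hv z hz.1 hz.2).of_le (by norm_cast))
  · exact fun k l => (contDiffAt_metric_inv I c hy k l).of_le (by norm_cast)
  · exact fun k i j =>
      ((smoothUpTo_firstOrderCoeff I c k i j).contDiffAt hy).differentiableAt (by simp)
  · exact fun i j => ((smoothUpTo_zeroOrderCoeff I c i j).contDiffAt hy).differentiableAt (by simp)
  · filter_upwards [hnear] with z hz using metric_inv_mul_formW I c
      (posDef_metric I c (interior_subset hz.1)).det_pos.ne'.isUnit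
      (grad (by norm_num) hv z hz.1 hz.2)
  · filter_upwards [hnear] with z hz
    have h := hsol _ hz.2 c (hsource z hz.1)
    rw [hcalW z hz.1] at h
    exact h
  · have h := hadm _ hyU c (hsource y hy)
    rwa [hcalW y hy] at h
  · rw [← grad (by norm_num) hα y hy hyU]
    exact pow_le_pow_left₀ (gradNorm_nonneg I _ _) (gα _ hyU) 2
  · rw [← grad (by norm_num) hα₀ y hy hyU]
    exact pow_le_pow_left₀ (gradNorm_nonneg I _ _) (gα₀ _ hyU) 2
  · refine hmax.congr ?_
    filter_upwards [hnear] with z hz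
    rw [grad (by norm_num) hv z hz.1 hz.2]
    rfl

end ChartEstimate


/-! ### The Euclidean cutoff function and its derivatives. -/

section Cutoff

open scoped RealInnerProductSpace

variable {V : Type*} [NormedAddCommGroup V] [InnerProductSpace ℝ V] (y₀ : V) (r : ℝ)

theorem hasDir_inner_sub (u w z : V) : HasDir u (fun z => ⟪z - y₀, w⟫) ⟪u, w⟫ z := by
  have h : HasFDerivAt (fun z => ⟪z - y₀, w⟫) (innerSL ℝ w) z := by
    have h1 := ((innerSL ℝ w).hasFDerivAt (x := z - y₀)).comp z ((hasFDerivAt_id z).sub_const y₀)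
    refine (h1.congr_fderiv (by ext; rfl)).congr_of_eventuallyEq (Filter.Eventually.of_forall ?_)
    intro x
    simp [real_inner_comm]
  exact ⟨h.differentiableAt, by rw [dirD, h.fderiv]; simp [real_inner_comm]⟩

theorem hasDir_radius_sub (u z : V) :
    HasDir u (fun z => r ^ 2 - ‖z - y₀‖ ^ 2) (-2 * ⟪z - y₀, u⟫) z := by
  have h : HasFDerivAt (fun z => r ^ 2 - ‖z - y₀‖ ^ 2) (-(2 • innerSL ℝ (z - y₀))) z := by
    have h1 := (((hasFDerivAt_id z).sub_const y₀).norm_sq).const_sub (r ^ 2)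
    exact h1.congr_fderiv (by ext; simp)
  exact ⟨h.differentiableAt, by rw [dirD, h.fderiv]; simp [two_mul, inner_sub_left]⟩

/-- The cutoff function of the ball of radius `r` around `y₀`. -/
noncomputable def cutoff (y₀ : V) (r : ℝ) (z : V) : ℝ := (r ^ 2 - ‖z - y₀‖ ^ 2) * (r ^ 2 - ‖z - y₀‖ ^ 2)

theorem contDiff_cutoff : ContDiff ℝ 2 (cutoff y₀ r) := by
  have h : ContDiff ℝ 2 fun z : V => r ^ 2 - ‖z - y₀‖ ^ 2 :=
    contDiff_const.sub ((contDiff_id.sub contDiff_const).norm_sq ℝ)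
  exact h.mul h

theorem dirD_cutoff (u : V) :
    dirD u (cutoff y₀ r) = fun z => -4 * ((r ^ 2 - ‖z - y₀‖ ^ 2) * ⟪z - y₀, u⟫) := by
  funext z
  rw [show dirD u (cutoff y₀ r) z = _ from
    ((hasDir_radius_sub y₀ r u z).mul (hasDir_radius_sub y₀ r u z)).2]
  ring

variable {y₀ r} {z : V}

omit [InnerProductSpace ℝ V] in
theorem radius_sub_mem (hr0 : 0 ≤ r) (hr : r ≤ 1) (hz : ‖z - y₀‖ ≤ r) :
    0 ≤ r ^ 2 - ‖z - y₀‖ ^ 2 ∧ r ^ 2 - ‖z - y₀‖ ^ 2 ≤ 1 := by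
  have := norm_nonneg (z - y₀)
  constructor <;> nlinarith

omit [InnerProductSpace ℝ V] in
theorem cutoff_mem (hr0 : 0 ≤ r) (hr : r ≤ 1) (hz : ‖z - y₀‖ ≤ r) :
    0 ≤ cutoff y₀ r z ∧ cutoff y₀ r z ≤ 1 := by
  obtain ⟨h0, h1⟩ := radius_sub_mem hr0 hr hz
  exact ⟨mul_nonneg h0 h0, mul_le_one₀ h1 h0 h1⟩

theorem abs_inner_le_one {u : V} (hu : ‖u‖ = 1) (hr : r ≤ 1) (hz : ‖z - y₀‖ ≤ r) :
    |⟪z - y₀, u⟫| ≤ 1 :=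
  (abs_real_inner_le_norm _ _).trans (by rw [hu, mul_one]; exact hz.trans hr)

/-- The cutoff is the square of r² − |z − y₀|², so its gradient is a multiple of its square root;
the first power would not give this. -/
theorem dirD_cutoff_sq_le {u : V} (hu : ‖u‖ = 1) (hr : r ≤ 1) (hz : ‖z - y₀‖ ≤ r) :
    dirD u (cutoff y₀ r) z ^ 2 ≤ 16 * cutoff y₀ r z := by
  have h := abs_le.1 (abs_inner_le_one hu hr hz)
  have h2 : ⟪z - y₀, u⟫ ^ 2 ≤ 1 := by nlinarith
  rw [dirD_cutoff, cutoff]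
  nlinarith [mul_le_mul_of_nonneg_left h2 (sq_nonneg (r ^ 2 - ‖z - y₀‖ ^ 2))]

theorem abs_dirD_dirD_cutoff_le {u w : V} (hu : ‖u‖ = 1) (hw : ‖w‖ = 1) (hr0 : 0 ≤ r) (hr : r ≤ 1)
    (hz : ‖z - y₀‖ ≤ r) : |dirD w (dirD u (cutoff y₀ r)) z| ≤ 16 := by
  rw [dirD_cutoff, ((HasDir.const (-4)).mul ((hasDir_radius_sub y₀ r w z).mul
    (hasDir_inner_sub y₀ w u z))).2]
  have h1 := abs_inner_le_one hu hr hz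
  have h2 := abs_inner_le_one hw hr hz
  have h3 : |⟪w, u⟫| ≤ 1 := (abs_real_inner_le_norm _ _).trans (by simp [hu, hw])
  obtain ⟨h4, h5⟩ := radius_sub_mem hr0 hr hz
  have h6 : |⟪z - y₀, w⟫ * ⟪z - y₀, u⟫| ≤ 1 := by
    rw [abs_mul]; exact mul_le_one₀ h2 (abs_nonneg _) h1
  have h7 : |(r ^ 2 - ‖z - y₀‖ ^ 2) * ⟪w, u⟫| ≤ 1 := by
    rw [abs_mul, abs_of_nonneg h4]; exact mul_le_one₀ h5 (abs_nonneg _) h3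
  rw [abs_le] at h6 h7 ⊢
  constructor <;> nlinarith

end Cutoff

/-! ### Pointwise bounds extracted from the norms. -/

section Norms

variable {n : ℕ} {H : Type*} [TopologicalSpace H]
  (I : ModelWithCorners ℝ (EuclideanSpace ℝ (Fin n)) H)
  {M : Type*} [TopologicalSpace M] [ChartedSpace H M]

theorem abs_le_of_c0Norm_le {M : Type*} {f : M → ℝ} {S : Set M} {A : ℝ≥0} (h : c0Norm f S ≤ A)
    {x : M} (hx : x ∈ S) : |f x| ≤ A := by
  have h1 : ENNReal.ofReal |f x| ≤ A := (le_iSup₂_of_le x hx le_rfl).trans h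
  rwa [ENNReal.ofReal_le_iff_le_toReal ENNReal.coe_ne_top] at h1

variable [RiemannianBundle (fun x : M => TangentSpace I x)]

theorem abs_le_of_c1Norm_le {f : M → ℝ} {S : Set M} {A : ℝ≥0} (h : c1Norm I f S ≤ A)
    {x : M} (hx : x ∈ S) : |f x| ≤ A :=
  abs_le_of_c0Norm_le (le_self_add.trans h) hx

theorem gradNorm_le_of_c1Norm_le {f : M → ℝ} {S : Set M} {A : ℝ≥0} (h : c1Norm I f S ≤ A)
    {x : M} (hx : x ∈ S) : gradNorm I f x ≤ A :=
  (le_abs_self _).trans (abs_le_of_c0Norm_le (le_add_self.trans h) hx)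

/-- A common bound for the norms in the hypotheses of the gradient estimate. -/
theorem controlledSolution_of_norm_le {m : ℕ} {K a₀ : ℝ} {v α α₀ : M → ℝ} {U : Set M}
    {V A A₀ : ℝ≥0} (hU : IsOpen U) (hV : V ≤ K) (hA : A ≤ K) (hA₀ : A₀ ≤ K)
    (hv : ContMDiffOn I 𝓘(ℝ, ℝ) 3 v U) (hα : ContMDiffOn I 𝓘(ℝ, ℝ) 1 α U)
    (hα₀ : ContMDiffOn I 𝓘(ℝ, ℝ) 1 α₀ U) (bv : c0Norm v U ≤ V) (bα : c1Norm I α U ≤ A)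
    (bα₀ : c1Norm I α₀ U ≤ A₀) (hlow : ∀ x ∈ U, a₀ ≤ α₀ x) (hadm : IsAdmissibleOn I (m + 1) v U)
    (hsol : IsSolutionOn I (m + 2) α α₀ v U) : ControlledSolution I m K a₀ v α α₀ U where
  isOpen := hU
  smooth := hv
  smooth_left := hα
  smooth_right := hα₀
  abs_le _ hx := (abs_le_of_c0Norm_le bv hx).trans hV
  abs_left_le _ hx := (abs_le_of_c1Norm_le I bα hx).trans hA
  abs_right_le _ hx := (abs_le_of_c1Norm_le I bα₀ hx).trans hA₀
  gradNorm_left_le _ hx := (gradNorm_le_of_c1Norm_le I bα hx).trans hA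
  gradNorm_right_le _ hx := (gradNorm_le_of_c1Norm_le I bα₀ hx).trans hA₀
  le_right := hlow
  admissible := hadm
  solution := hsol

end Norms


/-! ### Local interior estimate and continuity of the gradient norm. -/

section Estimates

open Filter Topology

/-- Transfers the bound from the maximum point of the test function to an arbitrary point; the
denominators lie between 1 and 2K + 1. -/
theorem le_of_test_le {K C' e W E Wmax Emax d dmax : ℝ} (hK : 1 ≤ K) (he : 0 < e)
    (hW : 0 ≤ W) (heE : e ≤ E) (hd : d ≤ 2 * K + 1) (hd0 : 0 < d) (hdmax : 1 ≤ dmax) (hC' : 0 ≤ C')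
    (h0 : 0 ≤ Emax * Wmax) (hC : Emax * Wmax ≤ C')
    (h : (W * E) ^ 2 / d ≤ (Wmax * Emax) ^ 2 / dmax) : W ≤ (2 * K + 1) * C' / e := by
  have h1 : (Wmax * Emax) ^ 2 / dmax ≤ C' ^ 2 := by
    refine (div_le_self (sq_nonneg _) hdmax).trans ?_
    rw [mul_comm Wmax]
    exact pow_le_pow_left₀ h0 hC 2
  have h2 : (W * E) ^ 2 ≤ C' ^ 2 * (2 * K + 1) :=
    ((div_le_iff₀ hd0).1 (h.trans h1)).trans (mul_le_mul_of_nonneg_left hd (sq_nonneg _))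
  have h3 : W * e ≤ (2 * K + 1) * C' := by
    have h4 : W * e ≤ W * E := mul_le_mul_of_nonneg_left heE hW
    refine h4.trans (le_of_sq_le_sq ?_ (by positivity))
    refine h2.trans ?_
    nlinarith [mul_nonneg (sq_nonneg C') (by positivity : 0 ≤ (2 * K + 1) * (2 * K))]
  exact (le_div_iff₀ he).2 h3

variable {n : ℕ} {H : Type*} [TopologicalSpace H]
  (I : ModelWithCorners ℝ (EuclideanSpace ℝ (Fin n)) H)

section Interior

variable {M : Type*} [TopologicalSpace M] [ChartedSpace H M] [IsManifold I ∞ M]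
  [RiemannianBundle (fun x : M => TangentSpace I x)]
  [IsContMDiffRiemannianBundle I ∞ (EuclideanSpace ℝ (Fin n)) (fun x : M => TangentSpace I x)]

/-- Maximize the test function over a closed coordinate ball whose image lies in N, with the cutoff
vanishing on its boundary sphere. The solution is assumed controlled for every K ≥ K₀ because the K
actually used also depends on the geometry of the chart. -/
theorem interior_chart_estimate (hn : 3 ≤ n) {m : ℕ} (hm : m + 2 ≤ n) (K₀ : ℝ) {a₀ : ℝ}
    (ha₀ : 0 < a₀) {x₀ : M} (hx₀ : x₀ ∈ I.interior M) {N : Set M} (hN : N ∈ 𝓝 x₀) :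
    ∃ C : ℝ, ∀ᶠ x in 𝓝 x₀, ∀ (U : Set M) (v α α₀ : M → ℝ), N ⊆ U →
      (∀ K, K₀ ≤ K → ControlledSolution I m K a₀ v α α₀ U) → gradNorm I v x ≤ C := by
  set s := (extChartAt I x₀).target with hs
  set y₀ := extChartAt I x₀ x₀ with hy₀
  have hy₀s : y₀ ∈ interior s := I.isInteriorPoint_iff.1 hx₀
  obtain ⟨K₁, hK₁⟩ := exists_boundedGeometry I x₀ (interior_subset hy₀s)
  rw [isOpen_interior.nhdsWithin_eq hy₀s] at hK₁
  set K := |K₀| + |K₁| + 16 with hKdef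
  have hK : 1 ≤ K := by linarith [abs_nonneg K₀, abs_nonneg K₁]
  have hK16 : 16 ≤ K := by linarith [abs_nonneg K₀, abs_nonneg K₁]
  have hKK₀ : K₀ ≤ K := by linarith [le_abs_self K₀, abs_nonneg K₁]
  have hKK₁ : K₁ ≤ K := by linarith [abs_nonneg K₀, le_abs_self K₁]
  obtain ⟨C, hC⟩ := chart_estimate I (M := M) hn hm hK ha₀
  have hsymm : Tendsto (extChartAt I x₀).symm (𝓝 y₀) (𝓝 x₀) := by
    simpa [y₀] using tendsto_extChartAt_symm I x₀ hy₀s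
  have hgood : ∀ᶠ z in 𝓝 y₀, z ∈ interior s ∧ BoundedGeometry I x₀ K z ∧
      (extChartAt I x₀).symm z ∈ N := by
    filter_upwards [isOpen_interior.eventually_mem hy₀s, hK₁, hsymm hN] with z h1 h2 h3
    exact ⟨h1, h2.mono hKK₁, h3⟩
  obtain ⟨r', hr', hball⟩ := Metric.eventually_nhds_iff_ball.1 hgood
  set r := min (r' / 2) 1 with hr
  have hr0 : 0 < r := by positivity
  have hr1 : r ≤ 1 := min_le_right _ _
  have hsub : ∀ z ∈ Metric.closedBall y₀ r, z ∈ interior s ∧ BoundedGeometry I x₀ K z ∧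
      (extChartAt I x₀).symm z ∈ N := fun z hz => hball z (by
    rw [Metric.mem_closedBall] at hz
    rw [Metric.mem_ball]
    linarith [min_le_left (r' / 2) 1])
  set C' := max C 1 with hC'
  -- The value of the cutoff at distance r/2 from the centre: (r² − r²/4)².
  set e := 9 / 16 * r ^ 4 with he
  have he0 : 0 < e := by positivity
  refine ⟨1 + (2 * K + 1) * C' / e, ?_⟩
  have hev : ∀ᶠ x in 𝓝 x₀, x ∈ (extChartAt I x₀).source ∧
      extChartAt I x₀ x ∈ Metric.closedBall y₀ (r / 2) :=
    (eventually_mem_set.2 (extChartAt_source_mem_nhds (I := I) x₀)).and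
      ((continuousAt_extChartAt (I := I) x₀) (Metric.closedBall_mem_nhds _ (by positivity)))
  filter_upwards [hev] with x hx U v α α₀ hNU hsolK
  have hsol := hsolK K hKK₀
  set w : EuclideanSpace ℝ (Fin n) → ℝ := fun z => gradNorm I v ((extChartAt I x₀).symm z) ^ 2
    with hw
  set Q : EuclideanSpace ℝ (Fin n) → ℝ := fun z =>
    (w z * cutoff y₀ r z) ^ 2 / (K + 1 - v ((extChartAt I x₀).symm z)) with hQ
  have hden : ∀ z ∈ Metric.closedBall y₀ r, 1 ≤ K + 1 - v ((extChartAt I x₀).symm z) ∧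
      K + 1 - v ((extChartAt I x₀).symm z) ≤ 2 * K + 1 := fun z hz => by
    have := abs_le.1 (hsol.abs_le _ (hNU (hsub z hz).2.2))
    constructor <;> linarith [this.1, this.2]
  have hsm : ∀ z ∈ Metric.closedBall y₀ r, ContMDiffAt I 𝓘(ℝ, ℝ) 3 v ((extChartAt I x₀).symm z) :=
    fun z hz => hsol.smooth.contMDiffAt (hsol.isOpen.mem_nhds (hNU (hsub z hz).2.2))
  have hcont : ContinuousOn Q (Metric.closedBall y₀ r) := by
    have h1 : ContinuousOn w (Metric.closedBall y₀ r) := by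
      have h2 : ContinuousOn (frameNormSq stdVec (fun i j z => (metric I x₀ z)⁻¹ i j)
          (inChart I x₀ v)) (Metric.closedBall y₀ r) := fun z hz =>
        (contDiffAt_frameNormSq
          (fun k l => (contDiffAt_metric_inv I x₀ (hsub z hz).1 k l).of_le (by norm_cast))
          (contDiffAt_inChart I x₀ (hsub z hz).1 (by norm_cast)
            (hsm z hz))).continuousAt.continuousWithinAt
      exact h2.congr fun z hz => gradNorm_sq_eq_frameNormSq I (by omega) x₀ (hsub z hz).1
        ((hsm z hz).mdifferentiableAt (by norm_num))
    have h3 : ContinuousOn (fun z => v ((extChartAt I x₀).symm z)) (Metric.closedBall y₀ r) :=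
      fun z hz => (contDiffAt_inChart I x₀ (hsub z hz).1 (by norm_cast)
        (hsm z hz)).continuousAt.continuousWithinAt
    exact ((h1.mul (contDiff_cutoff y₀ r).continuous.continuousOn).pow 2).div
      (continuousOn_const.sub h3) fun z hz => by linarith [(hden z hz).1]
  obtain ⟨z₁, hz₁, hmax⟩ := (isCompact_closedBall y₀ r).exists_isMaxOn
    (Metric.nonempty_closedBall.2 hr0.le) hcont
  have hnorm : ∀ z ∈ Metric.closedBall y₀ r, ‖z - y₀‖ ≤ r := fun z hz => by
    rwa [← dist_eq_norm]
  have hunit : ∀ i : Fin n, ‖stdVec i‖ = 1 := fun i => by simp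
  have hη := cutoff_mem hr0.le hr1 (hnorm z₁ hz₁)
  have hw0 : ∀ z, 0 ≤ w z := fun z => sq_nonneg _
  -- The maximum principle is needed only where w ≥ 1 and the cutoff is positive. Positivity
  -- excludes the boundary sphere, so the maximum over the closed ball is a local one.
  have hbound : cutoff y₀ r z₁ * w z₁ ≤ C' := by
    rcases lt_or_ge (w z₁) 1 with hlt | hge
    · exact (mul_le_one₀ hη.2 (hw0 _) hlt.le).trans (le_max_right _ _)
    rcases hη.1.eq_or_lt with h0 | hpos
    · rw [← h0, zero_mul]; exact zero_le_one.trans (le_max_right _ _)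
    have hin : z₁ ∈ Metric.ball y₀ r := by
      rw [Metric.mem_ball, dist_eq_norm]
      refine (hnorm z₁ hz₁).lt_of_ne fun h => ?_
      rw [cutoff, h] at hpos
      simp at hpos
    have hloc : IsLocalMax Q z₁ := hmax.isLocalMax
      (mem_of_superset (Metric.isOpen_ball.mem_nhds hin) Metric.ball_subset_closedBall)
    refine (hC x₀ z₁ (hsub z₁ hz₁).1 (hsub z₁ hz₁).2.1 U (hNU (hsub z₁ hz₁).2.2) v α α₀
      (cutoff y₀ r) hsol (contDiff_cutoff y₀ r).contDiffAt hpos hη.2 ?_ ?_ hloc hge).trans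
      (le_max_left _ _)
    · intro a
      exact (dirD_cutoff_sq_le (hunit a) hr1 (hnorm z₁ hz₁)).trans
        (mul_le_mul_of_nonneg_right hK16 hη.1)
    · intro a b
      exact (abs_dirD_dirD_cutoff_le (hunit b) (hunit a) hr0.le hr1 (hnorm z₁ hz₁)).trans hK16
  set z := extChartAt I x₀ x with hz
  have hzb : z ∈ Metric.closedBall y₀ r := Metric.closedBall_subset_closedBall (by linarith) hx.2
  have hxz : (extChartAt I x₀).symm z = x := (extChartAt I x₀).left_inv hx.1
  have hE : e ≤ cutoff y₀ r z := by
    have h1 : ‖z - y₀‖ ≤ r / 2 := by rw [← dist_eq_norm]; exact hx.2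
    have h2 : 3 / 4 * r ^ 2 ≤ r ^ 2 - ‖z - y₀‖ ^ 2 := by nlinarith [norm_nonneg (z - y₀)]
    calc e = (3 / 4 * r ^ 2) * (3 / 4 * r ^ 2) := by rw [he]; ring
      _ ≤ _ := mul_le_mul h2 h2 (by positivity) (le_trans (by positivity) h2)
  have hfin : w z ≤ (2 * K + 1) * C' / e := le_of_test_le hK he0 (hw0 z) hE (hden z hzb).2
    (by linarith [(hden z hzb).1]) (hden z₁ hz₁).1 (zero_le_one.trans (le_max_right _ _))
    (mul_nonneg hη.1 (hw0 _)) hbound (hmax hzb)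
  rw [hw] at hfin
  simp only [hxz] at hfin
  -- From t² ≤ B one gets t ≤ 1 + B, because t ≤ 1 + t².
  nlinarith [sq_nonneg (gradNorm I v x - 1), gradNorm_nonneg I v x]

/-- Continuity up to the boundary, with v only C¹ there, is what makes the test function attain its
maximum in the global estimate. -/
theorem continuous_gradNorm_sq (hpos : 0 < n) {v : M → ℝ} (hv : ContMDiff I 𝓘(ℝ, ℝ) 1 v) :
    Continuous fun x => gradNorm I v x ^ 2 := by
  rw [continuous_iff_continuousAt]
  intro x₀
  set s := (extChartAt I x₀).target with hs
  have hq : ∀ i : Fin n, ContinuousOn (fun z =>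
      fderivWithin ℝ (inChart I x₀ v) (Set.range I) z (EuclideanSpace.single i 1)) s := by
    intro i
    have h1 : ContDiffOn ℝ 1 (inChart I x₀ v) s := by
      rw [← contMDiffOn_iff_contDiffOn]
      exact hv.comp_contMDiffOn (contMDiffOn_extChartAt_symm (n := ∞) x₀ |>.of_le (by norm_cast))
    have h2 := h1.continuousOn_fderivWithin (uniqueDiffOn_extChartAt_target x₀) le_rfl
    refine (h2.clm_apply (continuousOn_const (c := stdVec i))).congr fun z hz => ?_
    simp only [hs, fderivWithin_congr_set (extChartAt_target_eventuallyEq_of_mem (I := I) hz)]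
  have h : ContinuousOn (fun z => ∑ i, ∑ j, (metric I x₀ z)⁻¹ i j *
      (fderivWithin ℝ (inChart I x₀ v) (Set.range I) z (EuclideanSpace.single i 1) *
       fderivWithin ℝ (inChart I x₀ v) (Set.range I) z (EuclideanSpace.single j 1))) s :=
    continuousOn_finsetSum _ fun i _ => continuousOn_finsetSum _ fun j _ =>
      (contDiffOn_metric_inv I x₀ i j).continuousOn.mul ((hq i).mul (hq j))
  have h3 : ContinuousOn (fun x => gradNorm I v x ^ 2) (extChartAt I x₀).source :=
    (h.comp (continuousOn_extChartAt (I := I) x₀) (extChartAt I x₀).mapsTo).congr fun x hx => by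
      have h4 := gradNorm_sq_eq I hpos x₀ ((extChartAt I x₀).map_source hx)
        (hv.mdifferentiableAt one_ne_zero)
      rw [(extChartAt I x₀).left_inv hx] at h4
      exact h4
  exact h3.continuousAt (extChartAt_source_mem_nhds x₀)

end Interior

end Estimates


/-! ### Uniform constants by compactness. -/

section Compactness

open Filter Topology

theorem exists_forall_of_eventually_nhds {X : Type*} [TopologicalSpace X] [CompactSpace X]
    {P : X → ℝ → Prop} (hmono : ∀ x C C', C ≤ C' → P x C → P x C')
    (h : ∀ x₀, ∃ C, ∀ᶠ x in 𝓝 x₀, P x C) : ∃ C, ∀ x, P x C := by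
  choose C hC using h
  obtain ⟨t, -, ht⟩ := isCompact_univ.elim_nhds_subcover (fun x₀ => {x | P x (C x₀)})
    (fun x₀ _ => hC x₀)
  refine ⟨∑ x₀ ∈ t, |C x₀|, fun x => ?_⟩
  obtain ⟨x₀, hx₀, hx⟩ := Set.mem_iUnion₂.1 (ht (Set.mem_univ x))
  exact hmono x _ _ ((le_abs_self _).trans
    (Finset.single_le_sum (f := fun x => |C x|) (fun _ _ => abs_nonneg _) hx₀)) hx

variable {n : ℕ} {H : Type*} [TopologicalSpace H]
  (I : ModelWithCorners ℝ (EuclideanSpace ℝ (Fin n)) H)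

/-- The radius ρ is fixed in advance, so for x close to x₀ the ball of radius ρ around x contains a
fixed ball around x₀, and the local constant at x₀ serves all such x. -/
theorem interior_gradient_estimate (hn : 3 ≤ n) {m : ℕ} (hm : m + 2 ≤ n)
    {M : Type*} [EMetricSpace M] [CompactSpace M] [ChartedSpace H M] [IsManifold I ∞ M]
    [RiemannianBundle (fun x : M => TangentSpace I x)]
    [IsContMDiffRiemannianBundle I ∞ (EuclideanSpace ℝ (Fin n)) (fun x : M => TangentSpace I x)]
    (K₀ : ℝ) {a₀ : ℝ} (ha₀ : 0 < a₀) {ρ : ℝ≥0∞} (hρ : 0 < ρ) :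
    ∃ C : ℝ, ∀ (x : M) (U : Set M) (v α α₀ : M → ℝ), Metric.eball x ρ ⊆ U → U ⊆ I.interior M →
      (∀ K, K₀ ≤ K → ControlledSolution I m K a₀ v α α₀ U) → gradNorm I v x ≤ C := by
  refine exists_forall_of_eventually_nhds
    (fun x C C' hC h U v α α₀ hU hUi hsol => (h U v α α₀ hU hUi hsol).trans hC) fun x₀ => ?_
  have hρ2 : 0 < ρ / 2 := ENNReal.half_pos hρ.ne'
  have hnear : ∀ᶠ x in 𝓝 x₀, edist x x₀ < ρ / 2 := Metric.eball_mem_nhds x₀ hρ2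
  by_cases hx₀ : x₀ ∈ I.interior M
  · obtain ⟨C, hC⟩ := interior_chart_estimate I hn hm K₀ ha₀ hx₀ (Metric.eball_mem_nhds x₀ hρ2)
    refine ⟨C, ?_⟩
    filter_upwards [hC, hnear] with x hx hxx₀ U v α α₀ hU _ hsol
    refine hx U v α α₀ (Set.Subset.trans (fun z hz => ?_) hU) hsol
    calc edist z x ≤ edist z x₀ + edist x₀ x := edist_triangle _ _ _
      _ < ρ / 2 + ρ / 2 := ENNReal.add_lt_add hz (by rwa [edist_comm])
      _ = ρ := ENNReal.add_halves ρ
  -- Near a boundary point there is nothing to prove: the ball around x would contain x₀ and could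
  -- not lie in the interior.
  · refine ⟨0, ?_⟩
    filter_upwards [hnear] with x hx U v α α₀ hU hUi _
    refine absurd (hUi (hU ?_)) hx₀
    rw [Metric.mem_eball, edist_comm]
    exact hx.trans_le ENNReal.half_le_self

/-- No cutoff is needed: the maximum over the compact manifold is either on the boundary, where the
gradient is bounded by assumption, or in the interior, where the chart estimate applies with η = 1.
-/
theorem global_gradient_estimate (hn : 3 ≤ n) {m : ℕ} (hm : m + 2 ≤ n)
    {M : Type*} [TopologicalSpace M] [CompactSpace M] [ChartedSpace H M] [IsManifold I ∞ M]
    [RiemannianBundle (fun x : M => TangentSpace I x)]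
    [IsContMDiffRiemannianBundle I ∞ (EuclideanSpace ℝ (Fin n)) (fun x : M => TangentSpace I x)]
    (K₀ B : ℝ) {a₀ : ℝ} (ha₀ : 0 < a₀) :
    ∃ C : ℝ, ∀ v α α₀ : M → ℝ, ContMDiff I 𝓘(ℝ, ℝ) 1 v → (∀ x, |v x| ≤ K₀) →
      (∀ x ∈ I.boundary M, gradNorm I v x ≤ B) →
      (∀ K, K₀ ≤ K → ControlledSolution I m K a₀ v α α₀ (I.interior M)) →
      ∀ x, gradNorm I v x ≤ C := by
  -- The location of the maximum point is unknown and may be arbitrarily close to the boundary, so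
  -- each point is given some chart whose geometry bound is uniform up to the boundary.
  obtain ⟨K₁, hK₁⟩ := exists_forall_of_eventually_nhds (X := M)
    (P := fun x K => ∃ c : M, x ∈ (extChartAt I c).source ∧
      (extChartAt I c x ∈ interior (extChartAt I c).target →
        BoundedGeometry I c K (extChartAt I c x)))
    (fun x C C' hC ⟨c, hc, h⟩ => ⟨c, hc, fun hx => (h hx).mono hC⟩) (fun x₀ => by
      obtain ⟨K, hK⟩ := exists_boundedGeometry I x₀ (mem_extChartAt_target (I := I) x₀)
      rw [eventually_nhdsWithin_iff] at hK
      refine ⟨K, ?_⟩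
      filter_upwards [extChartAt_source_mem_nhds (I := I) x₀,
        (continuousAt_extChartAt (I := I) x₀).eventually hK] with x hx hx'
      exact ⟨x₀, hx, hx'⟩)
  set K := |K₀| + |K₁| + 1 with hKdef
  have hK : 1 ≤ K := by linarith [abs_nonneg K₀, abs_nonneg K₁]
  have hKK₀ : K₀ ≤ K := by linarith [le_abs_self K₀, abs_nonneg K₁]
  have hKK₁ : K₁ ≤ K := by linarith [abs_nonneg K₀, le_abs_self K₁]
  obtain ⟨C, hC⟩ := chart_estimate I (M := M) hn hm hK ha₀
  set C' := max (max C 1) (B ^ 2) with hC'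
  refine ⟨1 + (2 * K + 1) * C' / 1, fun v α α₀ hv hvK hB hsolK x => ?_⟩
  have hsol := hsolK K hKK₀
  have hden : ∀ x, 1 ≤ K + 1 - v x ∧ K + 1 - v x ≤ 2 * K + 1 := fun x => by
    have := abs_le.1 (hvK x)
    constructor <;> linarith [this.1, this.2]
  set Q : M → ℝ := fun x => (gradNorm I v x ^ 2 * 1) ^ 2 / (K + 1 - v x) with hQ
  have hcont : Continuous Q :=
    (((continuous_gradNorm_sq I (by omega) hv).mul continuous_const).pow 2).div
      (continuous_const.sub hv.continuous) fun x => by linarith [(hden x).1]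
  obtain ⟨x₁, -, hmax⟩ := isCompact_univ.exists_isMaxOn ⟨x, Set.mem_univ x⟩ hcont.continuousOn
  have hw0 : ∀ x, 0 ≤ gradNorm I v x ^ 2 := fun _ => sq_nonneg _
  have hbound : 1 * gradNorm I v x₁ ^ 2 ≤ C' := by
    rcases lt_or_ge (gradNorm I v x₁ ^ 2) 1 with hlt | hge
    · rw [one_mul]
      exact hlt.le.trans ((le_max_right _ _).trans (le_max_left _ _))
    by_cases hx₁ : x₁ ∈ I.interior M
    · obtain ⟨c, hc, hgeo⟩ := hK₁ x₁
      have hsrc : x₁ ∈ (chartAt H c).source := by rwa [← extChartAt_source I c]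
      -- The chart around c need not be the preferred chart at x₁; being an interior point does not
      -- depend on the chart.
      have hint : extChartAt I c x₁ ∈ interior (extChartAt I c).target :=
        (I.isInteriorPoint_iff_of_mem_atlas (n := ∞) (by simp) (chart_mem_atlas H c) hsrc).1 hx₁
      have hinv : (extChartAt I c).symm (extChartAt I c x₁) = x₁ := (extChartAt I c).left_inv hc
      have h := hC c (extChartAt I c x₁) hint ((hgeo hint).mono hKK₁) (I.interior M)
        (by rwa [hinv]) v α α₀ (fun _ => 1) hsol contDiffAt_const one_pos le_rfl
        (fun a => by rw [(HasDir.const _).2]; linarith)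
        (fun a b => by
          rw [show dirD (stdVec b) (fun _ => (1 : ℝ)) = fun _ => 0 from
            funext fun z => (HasDir.const _).2, (HasDir.const _).2, abs_zero]
          linarith)
        (Eventually.of_forall fun z => by
          have := hmax (Set.mem_univ ((extChartAt I c).symm z))
          simp only [hinv]
          exact this)
        (by rwa [hinv])
      rw [hinv] at h
      exact h.trans ((le_max_left _ _).trans (le_max_left _ _))
    · have hb : x₁ ∈ I.boundary M := by rw [← I.compl_interior]; exact hx₁
      rw [one_mul]
      exact (pow_le_pow_left₀ (gradNorm_nonneg I v x₁) (hB x₁ hb) 2).trans (le_max_right _ _)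
  have hfin : gradNorm I v x ^ 2 ≤ (2 * K + 1) * C' / 1 := le_of_test_le hK one_pos (hw0 x) le_rfl
    (hden x).2 (by linarith [(hden x).1]) (hden x₁).1
    (zero_le_one.trans ((le_max_right _ _).trans (le_max_left _ _)))
    (mul_nonneg zero_le_one (hw0 _)) hbound (hmax (Set.mem_univ x))
  nlinarith [sq_nonneg (gradNorm I v x - 1), gradNorm_nonneg I v x]

end Compactness

end ConformalRicci

/-! ### The theorem. -/

theorem theorem4p1 {n k : ℕ} (hn : 3 ≤ n) (hk : 2 ≤ k) (hkn : k ≤ n)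
    {H : Type*} [TopologicalSpace H] (I : ModelWithCorners ℝ (EuclideanSpace ℝ (Fin n)) H)
    {M : Type*} [EMetricSpace M] [CompactSpace M] [ChartedSpace H M] [IsManifold I ∞ M]
    [RiemannianBundle (fun x : M => TangentSpace I x)]
    [IsContMDiffRiemannianBundle I ∞ (EuclideanSpace ℝ (Fin n))
      (fun x : M => TangentSpace I x)]
    [IsRiemannianManifold I M] :
    -- the interior estimate
    (∀ (R V A A₀ : ℝ≥0) (a : ℝ), 0 < a →
      ∃ C : ℝ, ∀ (p : M) (r : ℝ), 0 < r → r⁻¹ ≤ R →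
        Metric.eball p (ENNReal.ofReal r) ⊆ I.interior M →
        ∀ v α α₀ : M → ℝ,
          ContMDiffOn I 𝓘(ℝ, ℝ) 3 v (Metric.eball p (ENNReal.ofReal r)) →
          ContMDiffOn I 𝓘(ℝ, ℝ) 1 α (Metric.eball p (ENNReal.ofReal r)) →
          ContMDiffOn I 𝓘(ℝ, ℝ) 1 α₀ (Metric.eball p (ENNReal.ofReal r)) →
          ConformalRicci.c0Norm v (Metric.eball p (ENNReal.ofReal r)) ≤ V →
          ConformalRicci.c1Norm I α (Metric.eball p (ENNReal.ofReal r)) ≤ A →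
          ConformalRicci.c1Norm I α₀ (Metric.eball p (ENNReal.ofReal r)) ≤ A₀ →
          (∀ x ∈ Metric.eball p (ENNReal.ofReal r), a ≤ α₀ x) →
          ConformalRicci.IsAdmissibleOn I (k - 1) v (Metric.eball p (ENNReal.ofReal r)) →
          ConformalRicci.IsSolutionOn I k α α₀ v (Metric.eball p (ENNReal.ofReal r)) →
          ∀ x ∈ Metric.eball p (ENNReal.ofReal (r / 2)), ConformalRicci.gradNorm I v x ≤ C) ∧
    -- the global estimate
    (∀ (V A A₀ B : ℝ≥0) (a : ℝ), 0 < a →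
      ∃ C : ℝ, ∀ v α α₀ : M → ℝ,
        ContMDiff I 𝓘(ℝ, ℝ) 1 v →
        ContMDiffOn I 𝓘(ℝ, ℝ) 3 v (I.interior M) →
        ContMDiffOn I 𝓘(ℝ, ℝ) 1 α (I.interior M) →
        ContMDiffOn I 𝓘(ℝ, ℝ) 1 α₀ (I.interior M) →
        ConformalRicci.c0Norm v Set.univ ≤ V →
        ConformalRicci.c1Norm I α (I.interior M) ≤ A →
        ConformalRicci.c1Norm I α₀ (I.interior M) ≤ A₀ →
        (∀ x ∈ I.interior M, a ≤ α₀ x) →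
        (∀ x ∈ I.boundary M, ConformalRicci.gradNorm I v x ≤ B) →
        ConformalRicci.IsAdmissibleOn I (k - 1) v (I.interior M) →
        ConformalRicci.IsSolutionOn I k α α₀ v (I.interior M) →
        ∀ x : M, ConformalRicci.gradNorm I v x ≤ C) := by
  obtain ⟨m, rfl⟩ : ∃ m, k = m + 2 := ⟨k - 2, by omega⟩
  refine ⟨fun R V A A₀ a ha => ?_, fun V A A₀ B a ha => ?_⟩
  -- A lower bound for r/2 valid for every r with r⁻¹ ≤ R; adding 1 to R covers R = 0. Balls of this
  -- radius centred in the half ball stay inside the full ball.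
  · have hR : (0 : ℝ) < 1 / (2 * (R + 1)) := by positivity
    obtain ⟨C, hC⟩ := ConformalRicci.interior_gradient_estimate I hn hkn (M := M)
      (V + A + A₀) ha (ENNReal.ofReal_pos.2 hR)
    refine ⟨C, fun p r hr hrR hsub v α α₀ hv hα hα₀ bv bα bα₀ hlow hadm hsol x hx => ?_⟩
    refine hC x (Metric.eball p (ENNReal.ofReal r)) v α α₀ (fun z hz => ?_) hsub fun K hK =>
      ConformalRicci.controlledSolution_of_norm_le I Metric.isOpen_eball
        (le_trans (by linarith [A.2, A₀.2]) hK) (le_trans (by linarith [V.2, A₀.2]) hK)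
        (le_trans (by linarith [V.2, A.2]) hK) hv hα hα₀ bv bα bα₀ hlow hadm hsol
    have hr2 : 1 / (2 * ((R : ℝ) + 1)) ≤ r / 2 := by
      have h1 : 1 ≤ r * (R + 1) := by
        have := mul_le_mul_of_nonneg_left hrR hr.le
        rw [mul_inv_cancel₀ hr.ne'] at this
        linarith
      rw [div_le_div_iff₀ (by positivity) two_pos]
      linarith
    calc edist z p ≤ edist z x + edist x p := edist_triangle _ _ _
      _ < ENNReal.ofReal (r / 2) + ENNReal.ofReal (r / 2) :=
        ENNReal.add_lt_add (lt_of_lt_of_le hz (ENNReal.ofReal_le_ofReal hr2)) hx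
      _ = ENNReal.ofReal r := by
        rw [← ENNReal.ofReal_add (by positivity) (by positivity), add_halves]
  · obtain ⟨C, hC⟩ := ConformalRicci.global_gradient_estimate I hn hkn (M := M)
      (V + A + A₀) B ha
    refine ⟨C, fun v α α₀ hv1 hv hα hα₀ bv bα bα₀ hlow hB hadm hsol => ?_⟩
    refine hC v α α₀ hv1 (fun x => ?_) hB fun K hK =>
      ConformalRicci.controlledSolution_of_norm_le I (I.isOpen_interior (n := ∞) (by simp))
        (le_trans (by linarith [A.2, A₀.2]) hK) (le_trans (by linarith [V.2, A₀.2]) hK)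
        (le_trans (by linarith [V.2, A.2]) hK) hv hα hα₀
        (le_trans (biSup_mono fun x _ => Set.mem_univ x) bv) bα bα₀ hlow hadm hsol
    have := ConformalRicci.abs_le_of_c0Norm_le bv (Set.mem_univ x)
    exact this.trans (by linarith [A.2, A₀.2])
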